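/- **Setting.** Let $E,\mathsf F$ be number fields, $\rho$ the complex conjugation, $\sigma\colon E\to\mathbf C$ and $\tau\colon \mathsf F\to\mathbf C$ embeddings, $\mathsf F^{(\tau,\rho)}=\tau(\mathsf F)\,\rho\tau(\mathsf F)$ and $K=\sigma(E)\,\mathsf F^{(\tau,\rho)}\subset\mathbf C$; $a\sim_K b$ means $a=bc$ with $c\in K^\times$. A pure motive $\mathcal M$ over $\mathsf F$ with coefficients in $E$, of weight $\mathsf w$ and rank $d(\mathcal M)\ge 1$, is considered through its realizations: $E$-vector spaces $H_{\rm B}(\mathcal M_\kappa)$ of dimension $d(\mathcal M)$ for all $\kappa\colon \mathsf F\to\mathbf C$; mutually inverse $E$-linear maps $F_{\infty,\kappa}\colon H_{\rm B}(\mathcal M_\kappa)\to H_{\rm B}(\mathcal M_{\rho\kappa})$ and $F_{\infty,\rho\kappa}$; a free $E\otimes_{\mathbf Q}\mathsf F$-module $H_{\rm dR}(\mathcal M)$ of rank $d(\mathcal M)$ with a filtration $\mathrm{Fil}^p$ by submodules; comparison isomorphisms $I_\kappa\colon H_{\rm B}(\mathcal M_\kappa)\otimes_{\mathbf Q}\mathbf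 C\cong H_{\rm dR}(\mathcal M)\otimes_{\mathsf F,\kappa}\mathbf C$ over $E\otimes_{\mathbf Q}\mathbf C$, with $\sigma$-components $I_{\kappa,\sigma}$; Hodge decompositions $H_{\rm B}(\mathcal M_\kappa)\otimes_{\mathbf Q}\mathbf C=\bigoplus_{p+q=\mathsf w}H^{p,q}(\mathcal M_\kappa)$ into $E\otimes_{\mathbf Q}\mathbf C$-submodules, such that $F_{\infty,\kappa}\otimes\mathrm{id}$ maps $H^{p,q}(\mathcal M_\kappa)$ onto $H^{q,p}(\mathcal M_{\rho\kappa})$ and $\mathrm{Fil}^p\otimes_{\mathsf F,\kappa}\mathbf C=I_\kappa(\bigoplus_{i\ge p}H^{i,\mathsf w-i}(\mathcal M_\kappa))$. If $\mathsf w$ is even, $\bigoplus_\kappa F_{\infty,\kappa}\otimes\mathrm{id}$ is assumed to act on $\bigoplus_\kappa H^{\mathsf w/2,\mathsf w/2}(\mathcal M_\kappa)$ as a scalar. Tensor products and extensions of scalars of motives are formed on realizations. **Hodge types.** Let $H^{p,q}(\mathcal M_\kappa)_\sigma\subset H_{\rm B}(\mathcal M_\kappa)\otimes_{E,\sigma}\mathbf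 C$ be the $\sigma$-component of $H^{p,q}(\mathcal M_\kappa)$, let $p_1^{\mathcal M_{\kappa,\sigma}}<\dots<p_t^{\mathcal M_{\kappa,\sigma}}$, $t=t^{\mathcal M_{\kappa,\sigma}}$, be the $p$ with $H^{p,q}(\mathcal M_\kappa)_\sigma\ne0$, and $q_i=\mathsf w-p_i$. $\mathcal M$ is *regular* at $\tau,\sigma$ if $\dim_{\mathbf C} H^{p,q}(\mathcal M_\kappa)_\sigma\le1$ for all $p$ and all $\kappa\in\{\tau,\rho\tau\}$. Suppose $t^{\mathcal M_{\tau,\sigma}}=t+1$ with $t=t^{\mathcal N_{\tau,\sigma}}$, and write $p_i^{\mathcal M},p_i^{\mathcal N},q_i^{\mathcal M},q_i^{\mathcal N}$ for the types at $\tau,\sigma$. The *interlace condition* says that for some $Q\in\mathbf Z$ and all $1\le i\le t$ $$-p^{\mathcal M}_{t+2-i}<p^{\mathcal N}_i+Q\le -p^{\mathcal M}_{t+1-i},\qquad -q^{\mathcal M}_i<q^{\mathcal N}_{t+1-i}+Q\le -q^{\mathcal M}_{i+1};$$ the *strong interlace condition* that for some $Q\in\mathbf Z$ and all $1\le i\le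 t$ $$-\min\{p^{\mathcal M}_{t+2-i},q^{\mathcal M}_i\}<\min\{p^{\mathcal N}_i,q^{\mathcal N}_{t+1-i}\}+Q,\qquad \max\{p^{\mathcal N}_i,q^{\mathcal N}_{t+1-i}\}+Q\le-\max\{p^{\mathcal M}_{t+1-i},q^{\mathcal M}_{i+1}\}.$$ **Periods.** Let $\mathcal B=\bigoplus_{\kappa\in\{\tau,\rho\tau\}}H_{\rm B}(\mathcal M_\kappa)$ (one summand if $\tau$ is real, two if $\tau$ is complex), and let $d^\pm_*(\mathcal M_\tau)$ be the dimensions of the $(\pm1)$-eigenspaces of the involution of $\mathcal B$ given by $F_\infty$. Let $\mathcal T^p=\bigoplus_{\kappa\in\{\tau,\rho\tau\}}\mathrm{Fil}^pH_{\rm dR}(\mathcal M)\otimes_{E\otimes\mathsf F,\sigma\otimes\kappa}K$, a filtration of the $K$-space $\mathcal T$ obtained from $H_{\rm dR}(\mathcal M)$ itself. Choose $E$-bases of the two eigenspaces and a $K$-basis of $\mathcal T$ adapted to the filtration, in the sense that every step is spanned by a final segment of the basis, and let $X=(X^+\,X^-)$ be the matrix of $\bigoplus_\kappa I_{\kappa,\sigma}$.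 Then $\delta_{(\tau,\sigma)}(\mathcal M)=\det X$, and $c^+_{(\tau,\sigma)}(\mathcal M)$ (resp. $c^-_{(\tau,\sigma)}(\mathcal M)$) is the upper left minor of $X$ of degree $d_*^+$ (resp. the upper right minor of degree $d_*^-$). The same definitions of $c^\pm$ apply to tensor products. For $\beta\ge1$, $c_{\beta,(\tau,\sigma)}(\mathcal M)=f_\beta(X)$, where $X$ is formed with a basis adapted to the steps $\mathcal T_\mu=\bigoplus_{\kappa}\mathrm{Fil}^{p_\mu^{\mathcal M_{\kappa,\sigma}}}H_{\rm dR}(\mathcal M)\otimes_{E\otimes\mathsf F,\sigma\otimes\kappa}K$ ($1\le\mu\le t=t^{\mathcal M_{\tau,\sigma}}$), of successive codimensions $s_1,\dots,s_t$ (all $1$ for real and all $2$ for complex $\tau$ if $\mathcal M$ is regular), and $f_\beta\ne0$ is a polynomial with rational coefficients such that $$f_\beta\Bigl(p\,x\begin{pmatrix}h_+&\\&h_-\end{pmatrix}\Bigr)=\prod_{\mu=1}^t\det(p_{\mu\mu})^{a_\mu}\det(h_+)\det(h_-)\,f_\beta(x),\qquad (a_\mu)=(\underbrace{2,\dots,2}_{\beta},\underbrace{1,\dots,1}_{t-2\beta},\underbrace{0,\dots,0}_{\beta}),$$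 for all matrices $x$, all invertible lower block triangular $p$ with diagonal blocks $p_{\mu\mu}$ of sizes $s_\mu$, and all $h_\pm\in\mathrm{GL}_{d_*^\pm}(\mathbf C)$. Put $c_{0,(\tau,\sigma)}=\delta_{(\tau,\sigma)}$. Finally, let $$c^\pm_{(\tau,\sigma)}(\mathcal M,\mathcal N)=\begin{cases}c^\pm_{(\tau,\sigma)}(\mathcal M\otimes_{\mathsf F}\mathcal N)&\tau\text{ real},\\ c^\pm_{(\tau,\sigma)}(\mathcal M\otimes_{\mathsf F}\mathcal N)\;c^\pm_{(\iota_0,\sigma)}(\mathcal M^{[\tau]}\otimes_{\mathsf F^{(\tau,\rho)}}\mathcal N^{[\rho\tau]})&\tau\text{ complex},\end{cases}$$ where $\mathcal M^{[\tau]},\mathcal N^{[\rho\tau]}$ are the extensions of scalars to $\mathsf F^{(\tau,\rho)}$ along $\tau$ and $\rho\tau$, and $\iota_0$ is the inclusion $\mathsf F^{(\tau,\rho)}\subset\mathbf C$. **Proposition.** Let $\mathcal M,\mathcal N$ be pure motives over $\mathsf F$ with coefficients in $E$, regular at $\tau$ and $\sigma$, with $t^{\mathcal M_{\tau,\sigma}}=t^{\mathcal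 N_{\tau,\sigma}}+1$. Put $d=d(\mathcal N)$ and drop the index $(\tau,\sigma)$ of the periods. For all choices of the bases and of the polynomials $f_\beta$ the following holds (double signs in the same order). (1) Let $\tau$ be real and let $\mathcal M,\mathcal N$ satisfy the interlace condition at $\tau$ and $\sigma$. If $d$ is even, then $$c^\pm(\mathcal M,\mathcal N)\sim_K\prod_{\beta=1}^{d/2}c_\beta(\mathcal M)\prod_{\beta=0}^{d/2-1}c_\beta(\mathcal N)\cdot\begin{cases}c^\pm(\mathcal N)&\text{if }d_*^+(\mathcal M_\tau)>d_*^-(\mathcal M_\tau),\\c^\mp(\mathcal N)&\text{if }d_*^+(\mathcal M_\tau)<d_*^-(\mathcal M_\tau).\end{cases}$$ If $d$ is odd, then $$c^\pm(\mathcal M,\mathcal N)\sim_K\prod_{\beta=1}^{(d-1)/2}c_\beta(\mathcal M)\prod_{\beta=0}^{(d-1)/2}c_\beta(\mathcal N)\cdot\begin{cases}c^\pm(\mathcal M)&\text{if }d_*^+(\mathcal N_\tau)>d_*^-(\mathcal N_\tau),\\c^\mp(\mathcal M)&\text{if }d_*^+(\mathcal N_\tau)<d_*^-(\mathcal N_\tau).\end{cases}$$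 (2) Let $\tau$ be complex and let $\mathcal M,\mathcal N$ satisfy the strong interlace condition at $\tau$ and $\sigma$. If $d$ is even, then $$c^\pm(\mathcal M,\mathcal N)\sim_K\prod_{\beta=1}^{d/2}c_\beta(\mathcal M)^2\prod_{\beta=0}^{d/2-1}c_\beta(\mathcal N)^2\cdot c^+(\mathcal N)\,c^-(\mathcal N).$$ If $d$ is odd, then $$c^\pm(\mathcal M,\mathcal N)\sim_K\prod_{\beta=1}^{(d-1)/2}c_\beta(\mathcal M)^2\prod_{\beta=0}^{(d-1)/2}c_\beta(\mathcal N)^2\cdot c^+(\mathcal M)\,c^-(\mathcal M).$$ -/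

import Mathlib

namespace YoshidaPeriod

open scoped TensorProduct
open NumberField.ComplexEmbedding

noncomputable section

universe uR uS uT uV uW uE uF uB uD uB' uD'

/-! ### Extension of scalars along a ring homomorphism -/

section Ext

variable {R : Type uR} {S : Type uS} {T : Type uT} [CommRing R] [CommRing S] [CommRing T]
  {V : Type uV} {W : Type uW} [AddCommGroup V] [Module R V] [AddCommGroup W] [Module R W]

/-- The extension of scalars `S ⊗_{R, f} V` of an `R`-module `V` along `f : R → S`. -/
def Ext (f : R →+* S) (V : Type uV) [AddCommGroup V] [Module R V] : Type (max uS uV) :=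
  letI := f.toAlgebra
  S ⊗[R] V

instance (f : R →+* S) : AddCommGroup (Ext f V) :=
  letI := f.toAlgebra
  (inferInstance : AddCommGroup (S ⊗[R] V))

instance (f : R →+* S) : Module S (Ext f V) :=
  letI := f.toAlgebra
  (inferInstance : Module S (S ⊗[R] V))

/-- The canonical `f`-semilinear map `v ↦ 1 ⊗ v`. -/
def Ext.of (f : R →+* S) : V →ₛₗ[f] Ext f V :=
  letI := f.toAlgebra
  { toFun := fun v => (1 : S) ⊗ₜ[R] v
    map_add' := fun v w => TensorProduct.tmul_add (1 : S) v w
    map_smul' := fun r v => by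
      change (1 : S) ⊗ₜ[R] (r • v) = f r • ((1 : S) ⊗ₜ[R] v)
      rw [TensorProduct.tmul_smul, ← algebraMap_smul S r ((1 : S) ⊗ₜ[R] v)]
      rfl }

/-- The map `s ⊗ v ↦ s ⊗ g v` induced by an `R`-linear map `g`. -/
def Ext.map (f : R →+* S) (g : V →ₗ[R] W) : Ext f V →ₗ[S] Ext f W :=
  letI := f.toAlgebra
  LinearMap.baseChange S g

/-- Extension of scalars commutes with tensor products:
`(1 ⊗ (v ⊗ w)) ↦ (1 ⊗ v) ⊗ (1 ⊗ w)`. -/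
def Ext.tensorEquiv (f : R →+* S) (V : Type uV) (W : Type uW) [AddCommGroup V] [Module R V]
    [AddCommGroup W] [Module R W] :
    Ext f (V ⊗[R] W) ≃ₗ[S] Ext f V ⊗[S] Ext f W :=
  letI := f.toAlgebra
  TensorProduct.AlgebraTensorModule.distribBaseChange R S V W

/-- Transitivity of extension of scalars: `T ⊗_S (S ⊗_R V) = T ⊗_R V`. -/
def Ext.transEquiv (f : R →+* S) (g : S →+* T) (h : R →+* T) (hgf : g.comp f = h)
    (V : Type uV) [AddCommGroup V] [Module R V] : Ext g (Ext f V) ≃ₗ[T] Ext h V :=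
  letI := f.toAlgebra
  letI := g.toAlgebra
  letI := h.toAlgebra
  haveI : IsScalarTower R S T := IsScalarTower.of_algebraMap_eq' hgf.symm
  TensorProduct.AlgebraTensorModule.cancelBaseChange R S T T V

theorem Ext.finite (f : R →+* S) [Module.Finite R V] : Module.Finite S (Ext f V) :=
  letI := f.toAlgebra
  (inferInstance : Module.Finite S (S ⊗[R] V))

end Ext

/-! ### Systems of realizations -/

section Fields

variable {E : Type uE} {F : Type uF} [Field E] [CharZero E] [Field F] [CharZero F]

/-- `σ ⊗ τ : E ⊗_ℚ F → ℂ`, `x ⊗ y ↦ σ(x) τ(y)`. -/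
def embTensor (σ : E →+* ℂ) (τ : F →+* ℂ) : E ⊗[ℚ] F →+* ℂ :=
  (Algebra.TensorProduct.productMap σ.toRatAlgHom τ.toRatAlgHom).toRingHom

/-- The field `F^{(τ,ρ)} = τ(F) · ρτ(F) ⊆ ℂ`, where `ρ` is the complex conjugation. -/
def conjClosure (τ : F →+* ℂ) : Subfield ℂ := τ.fieldRange ⊔ (conjugate τ).fieldRange

/-- The field `E^σ F^{(τ,ρ)} = σ(E) · τ(F) · ρτ(F) ⊆ ℂ`. -/
def periodField (σ : E →+* ℂ) (τ : F →+* ℂ) : Subfield ℂ := σ.fieldRange ⊔ conjClosure τ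

/-- `τ` regarded as a homomorphism `F → F^{(τ,ρ)}`. -/
def toConjClosure (τ : F →+* ℂ) : F →+* conjClosure τ :=
  (Subfield.inclusion le_sup_left).comp τ.rangeRestrictField

/-- `ρτ` regarded as a homomorphism `F → F^{(τ,ρ)}`. -/
def conjToConjClosure (τ : F →+* ℂ) : F →+* conjClosure τ :=
  (Subfield.inclusion le_sup_right).comp (conjugate τ).rangeRestrictField

/-- `id ⊗ j : E ⊗_ℚ F → E ⊗_ℚ L`. -/
def scalarMap (E : Type uE) [Field E] [CharZero E] {L : Type uT} [Field L] [CharZero L]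
    (j : F →+* L) : E ⊗[ℚ] F →+* E ⊗[ℚ] L :=
  (Algebra.TensorProduct.map (AlgHom.id ℚ E) j.toRatAlgHom).toRingHom

theorem embTensor_comp_scalarMap {L : Type uT} [Field L] [CharZero L] (j : F →+* L)
    (σ : E →+* ℂ) (κ : L →+* ℂ) :
    (embTensor σ κ).comp (scalarMap E j) = embTensor σ (κ.comp j) := by
  have h : (Algebra.TensorProduct.productMap σ.toRatAlgHom κ.toRatAlgHom).comp
      (Algebra.TensorProduct.map (AlgHom.id ℚ E) j.toRatAlgHom) =
      Algebra.TensorProduct.productMap σ.toRatAlgHom (κ.comp j).toRatAlgHom := by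
    ext x <;> simp
  exact RingHom.ext fun x => DFunLike.congr_fun h x

/-- The embeddings belonging to the archimedean place of `τ`: the set `{τ, ρτ}`, which has one
element if `τ` is real and two elements if `τ` is complex. -/
abbrev Place (τ : F →+* ℂ) : Type uF := {κ : F →+* ℂ // κ = τ ∨ κ = conjugate τ}

instance (τ : F →+* ℂ) : Finite (Place τ) :=
  Set.Finite.to_subtype (Set.toFinite ({τ, conjugate τ} : Set (F →+* ℂ)))

/-- The action of the complex conjugation on `{τ, ρτ}`. -/
def Place.conj {τ : F →+* ℂ} (κ : Place τ) : Place τ :=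
  ⟨conjugate κ.1, by
    rcases κ.2 with h | h
    · exact Or.inr (by rw [h])
    · exact Or.inl (by rw [h]; exact involutive_conjugate F τ)⟩

end Fields

/-- The Betti and de Rham realizations, with their comparison isomorphisms, of a motive defined
over `F` with coefficients in `E`.

* `HB κ` is the Betti realization `H_B(M_κ)`, an `E`-vector space, for every `κ : F → ℂ`.
* `Finf κ κ' h : H_B(M_κ) → H_B(M_{κ'})` with `κ' = ρκ` is the map `F_{∞,κ}` induced by the complex
  conjugation.  (For a real embedding `κ` one has `κ' = κ`.)
* `HdR` is the de Rham realization, an `E ⊗_ℚ F`-module, with the filtration `Fil`.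
* `comp σ κ` is the `σ`-component
  `I_{κ,σ} : H_B(M_κ) ⊗_{E,σ} ℂ ≅ H_dR(M) ⊗_{E ⊗ F, σ ⊗ κ} ℂ` of the comparison isomorphism
  `I_κ : H_B(M_κ) ⊗_ℚ ℂ ≅ H_dR(M) ⊗_{F,κ} ℂ`.  Since `E ⊗_ℚ ℂ = ∏_σ ℂ`, an `E ⊗_ℚ ℂ`-linear
  isomorphism `I_κ` is the same thing as the family of its components. -/
structure Realization (E : Type uE) (F : Type uF) [Field E] [CharZero E] [Field F] [CharZero F] where
  HB : (F →+* ℂ) → Type uB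
  [instHB : ∀ κ, AddCommGroup (HB κ)]
  [modHB : ∀ κ, Module E (HB κ)]
  Finf : ∀ κ κ' : F →+* ℂ, κ' = conjugate κ → (HB κ →ₗ[E] HB κ')
  Finf_Finf : ∀ (κ κ' : F →+* ℂ) (h : κ' = conjugate κ) (h' : κ = conjugate κ') (x : HB κ),
    Finf κ' κ h' (Finf κ κ' h x) = x
  HdR : Type uD
  [instHdR : AddCommGroup HdR]
  [modHdR : Module (E ⊗[ℚ] F) HdR]
  Fil : ℤ → Submodule (E ⊗[ℚ] F) HdR
  comp : ∀ (σ : E →+* ℂ) (κ : F →+* ℂ), Ext σ (HB κ) ≃ₗ[ℂ] Ext (embTensor σ κ) HdR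

attribute [instance] Realization.instHB Realization.modHB Realization.instHdR Realization.modHdR

namespace Realization

variable {E : Type uE} {F : Type uF} [Field E] [CharZero E] [Field F] [CharZero F]

/-- The realizations of the tensor product `M ⊗_F N` (with coefficients in `E`). -/
def tensor (M : Realization.{uE, uF, uB, uD} E F) (N : Realization.{uE, uF, uB', uD'} E F) :
    Realization.{uE, uF, max uB uB', max uD uD'} E F where
  HB κ := M.HB κ ⊗[E] N.HB κ
  Finf κ κ' h := TensorProduct.map (M.Finf κ κ' h) (N.Finf κ κ' h)
  Finf_Finf κ κ' h h' x := by
    rw [← LinearMap.comp_apply, ← TensorProduct.map_comp]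
    have h1 : M.Finf κ' κ h' ∘ₗ M.Finf κ κ' h = LinearMap.id :=
      LinearMap.ext (M.Finf_Finf κ κ' h h')
    have h2 : N.Finf κ' κ h' ∘ₗ N.Finf κ κ' h = LinearMap.id :=
      LinearMap.ext (N.Finf_Finf κ κ' h h')
    rw [h1, h2, TensorProduct.map_id, LinearMap.id_apply]
  HdR := M.HdR ⊗[E ⊗[ℚ] F] N.HdR
  Fil p := ⨆ a : ℤ, Submodule.map₂ (TensorProduct.mk (E ⊗[ℚ] F) M.HdR N.HdR)
    (M.Fil a) (N.Fil (p - a))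
  comp σ κ := (Ext.tensorEquiv σ (M.HB κ) (N.HB κ)).trans
    ((TensorProduct.congr (M.comp σ κ) (N.comp σ κ)).trans
      (Ext.tensorEquiv (embTensor σ κ) M.HdR N.HdR).symm)

/-- The realizations of the motive over `L` obtained from `M` by extending scalars along
`j : F → L`: one has `(M_L)_κ = M_{κ ∘ j}` and `H_dR(M_L) = H_dR(M) ⊗_{F,j} L`. -/
def baseChange {L : Type uT} [Field L] [CharZero L] (M : Realization.{uE, uF, uB, uD} E F)
    (j : F →+* L) : Realization.{uE, uT, uB, max (max uE uT) uD} E L where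
  HB κ := M.HB (κ.comp j)
  Finf κ κ' h := M.Finf (κ.comp j) (κ'.comp j) (by rw [h, conjugate_comp])
  Finf_Finf κ κ' h h' x := M.Finf_Finf _ _ _ _ x
  HdR := Ext (scalarMap E j) M.HdR
  Fil p := Submodule.span (E ⊗[ℚ] L) (Ext.of (scalarMap E j) '' (M.Fil p : Set M.HdR))
  comp σ κ := (M.comp σ (κ.comp j)).trans
    (Ext.transEquiv (scalarMap E j) (embTensor σ κ) (embTensor σ (κ.comp j))
      (embTensor_comp_scalarMap j σ κ) M.HdR).symm

variable (M : Realization.{uE, uF, uB, uD} E F)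

/-- `H_B(M_τ)` if `τ` is real, `H_B(M_τ) ⊕ H_B(M_{ρτ})` if `τ` is complex. -/
abbrev Betti (τ : F →+* ℂ) : Type (max uF uB) := ∀ κ : Place τ, M.HB κ.1

/-- The involution of `Betti τ` given by `F_{∞,τ}` if `τ` is real and by
`F_{∞,τ} ⊕ F_{∞,ρτ}` if `τ` is complex. -/
def frob (τ : F →+* ℂ) : Module.End E (M.Betti τ) :=
  LinearMap.pi fun κ =>
    (M.Finf κ.conj.1 κ.1 (involutive_conjugate F κ.1).symm) ∘ₗ LinearMap.proj κ.conj

/-- The `(±1)`-eigenspace of the involution on `Betti τ`. -/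
def bettiSign (τ : F →+* ℂ) (ε : ℤˣ) : Submodule E (M.Betti τ) :=
  Module.End.eigenspace (M.frob τ) (((ε : ℤ) : E))

/-- The dimension `d_*^±(M_τ)`. -/
def dSign (τ : F →+* ℂ) (ε : ℤˣ) : ℕ := Module.finrank E (M.bettiSign τ ε)

/-- The complex de Rham space `⊕_{κ ∈ {τ,ρτ}} H_dR(M) ⊗_{E ⊗ F, σ ⊗ κ} ℂ`. -/
abbrev DRC (σ : E →+* ℂ) (τ : F →+* ℂ) : Type (max uF uD) :=
  ∀ κ : Place τ, Ext (embTensor σ κ.1) M.HdR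

/-- `x ↦ I^0_{τ,σ}(x ⊗ 1)`, where `I^0_{τ,σ}` is `I_{τ,σ}` if `τ` is real and
`I_{τ,σ} ⊕ I_{ρτ,σ}` if `τ` is complex. -/
def periodMap (σ : E →+* ℂ) (τ : F →+* ℂ) (x : M.Betti τ) : M.DRC σ τ :=
  fun κ => M.comp σ κ.1 (Ext.of σ (x κ))

/-- For a family `P` of submodules of `H_dR(M)` indexed by `{τ, ρτ}`, the `E^σ F^{(τ,ρ)}`-space
`⊕_κ P_κ ⊗_{E ⊗ F, σ ⊗ κ} E^σ F^{(τ,ρ)}`, realized inside the complex de Rham space. -/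
def ratPart (σ : E →+* ℂ) (τ : F →+* ℂ) (P : Place τ → Submodule (E ⊗[ℚ] F) M.HdR) :
    Submodule (periodField σ τ) (M.DRC σ τ) :=
  Submodule.pi Set.univ fun κ =>
    Submodule.span (periodField σ τ) (Ext.of (embTensor σ κ.1) '' (P κ : Set M.HdR))

/-- The rational de Rham space `𝒯_{τ,σ}(M)`. -/
def deRham (σ : E →+* ℂ) (τ : F →+* ℂ) : Submodule (periodField σ τ) (M.DRC σ τ) :=
  M.ratPart σ τ fun _ => ⊤

/-- The Hodge filtration `𝒯^p_{τ,σ}(M)` of `𝒯_{τ,σ}(M)`. -/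
def deRhamFil (σ : E →+* ℂ) (τ : F →+* ℂ) (p : ℤ) :
    Submodule (periodField σ τ) (M.DRC σ τ) :=
  M.ratPart σ τ fun _ => M.Fil p

/-- A `(τ,σ)`-period matrix: rational bases `u^±` of the `(±1)`-eigenspaces in Betti cohomology, a
rational basis `ω` of `𝒯_{τ,σ}(M)`, and the matrix `X = (X^+ X^-)` of `I^0_{τ,σ}` in these bases.
(The `E^σ`-bases of `V ⊗_{E,σ} E^σ` are the `E`-bases of `V`, because `σ : E → E^σ` is an
isomorphism.) -/
structure PeriodMatrix (σ : E →+* ℂ) (τ : F →+* ℂ) where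
  dp : ℕ
  dm : ℕ
  uplus : Module.Basis (Fin dp) E (M.bettiSign τ 1)
  uminus : Module.Basis (Fin dm) E (M.bettiSign τ (-1))
  omega : Module.Basis (Fin (dp + dm)) (periodField σ τ) (M.deRham σ τ)
  X : Matrix (Fin (dp + dm)) (Fin dp ⊕ Fin dm) ℂ
  plus_eq : ∀ j, M.periodMap σ τ (uplus j) =
    ∑ i, X i (Sum.inl j) • ((omega i : M.deRham σ τ) : M.DRC σ τ)
  minus_eq : ∀ j, M.periodMap σ τ (uminus j) =
    ∑ i, X i (Sum.inr j) • ((omega i : M.deRham σ τ) : M.DRC σ τ)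

namespace PeriodMatrix

variable {M} {σ : E →+* ℂ} {τ : F →+* ℂ} (P : M.PeriodMatrix σ τ)

/-- The subspace `W` is spanned by a final segment `ω_{k+1}, …, ω_{d_*}` of the basis `ω`. -/
def AdaptedTo (W : Submodule (periodField σ τ) (M.DRC σ τ)) : Prop :=
  ∃ k : ℕ, W = Submodule.span (periodField σ τ)
    {y | ∃ i : Fin (P.dp + P.dm), k ≤ (i : ℕ) ∧ y = ((P.omega i : M.deRham σ τ) : M.DRC σ τ)}

/-- The basis `ω` is adapted to the Hodge filtration. -/
def HodgeAdapted : Prop := ∀ p : ℤ, P.AdaptedTo (M.deRhamFil σ τ p)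

/-- `det X`. -/
def detX : ℂ := (P.X.submatrix finSumFinEquiv id).det

/-- The upper left minor `f^+(X)` of degree `d_*^+` for the sign `+`, the upper right minor
`f^-(X)` of degree `d_*^-` for the sign `-`. -/
def minor (ε : ℤˣ) : ℂ :=
  if ε = 1 then (P.X.submatrix (Fin.castLE (Nat.le_add_right P.dp P.dm)) Sum.inl).det
  else (P.X.submatrix (Fin.castLE (Nat.le_add_left P.dm P.dp)) Sum.inr).det

end PeriodMatrix

/-- `c` is a value of the period `δ_{(τ,σ)}(M)`. -/
def IsDelta (σ : E →+* ℂ) (τ : F →+* ℂ) (c : ℂ) : Prop :=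
  ∃ P : M.PeriodMatrix σ τ, P.HodgeAdapted ∧ c = P.detX

/-- `c` is a value of the period `c^±_{(τ,σ)}(M)`, for some choice of the rational bases. -/
def IsPeriod (σ : E →+* ℂ) (τ : F →+* ℂ) (ε : ℤˣ) (c : ℂ) : Prop :=
  ∃ P : M.PeriodMatrix σ τ, P.HodgeAdapted ∧ c = P.minor ε

end Realization

/-! ### Relative invariant polynomials -/

/-- The (1-based) index of the block containing the row `i` (rows are numbered from `0`), for
blocks of sizes `s 1, …, s t`. -/
def blockIndex (t : ℕ) (s : ℕ → ℕ) (i : ℕ) : ℕ :=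
  ((Finset.Icc 1 t).filter fun μ => ∑ ν ∈ Finset.Icc 1 μ, s ν ≤ i).card + 1

/-- The value at `x` of a polynomial in the matrix entries with rational coefficients. -/
def evalPoly {m n : ℕ} (f : MvPolynomial (Fin (m + n) × (Fin m ⊕ Fin n)) ℚ)
    (x : Matrix (Fin (m + n)) (Fin m ⊕ Fin n) ℂ) : ℂ :=
  MvPolynomial.aeval (fun ij => x ij.1 ij.2) f

/-- The polynomial function `f` is of type `{(a 1, …, a t); (kp, km)}` with respect to the
partitions `m + n = s 1 + ⋯ + s t` and `m + n` of the size of the matrices. -/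
def IsOfType {m n : ℕ} (t : ℕ) (s a : ℕ → ℕ) (kp km : ℕ)
    (f : MvPolynomial (Fin (m + n) × (Fin m ⊕ Fin n)) ℚ) : Prop :=
  ∀ p : Matrix (Fin (m + n)) (Fin (m + n)) ℂ,
    (∀ i j : Fin (m + n), blockIndex t s i < blockIndex t s j → p i j = 0) → IsUnit p →
    ∀ (hp : Matrix (Fin m) (Fin m) ℂ) (hm : Matrix (Fin n) (Fin n) ℂ), IsUnit hp → IsUnit hm →
    ∀ x : Matrix (Fin (m + n)) (Fin m ⊕ Fin n) ℂ,
      evalPoly f (p * x * Matrix.fromBlocks hp 0 0 hm) =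
        (∏ μ ∈ Finset.Icc 1 t,
          (p.toSquareBlock (fun i : Fin (m + n) => blockIndex t s i) μ).det ^ a μ) *
        hp.det ^ kp * hm.det ^ km * evalPoly f x

/-- The exponents `(2, …, 2, 1, …, 1, 0, …, 0)` with `β` twos, `t - 2β` ones and `β` zeros. -/
def betaExponent (t β μ : ℕ) : ℕ := if μ ≤ β then 2 else if μ ≤ t - β then 1 else 0

/-! ### Pure motives -/

/-- A pure motive defined over `F` with coefficients in `E`, given by its realizations: they are
subject to the following properties.

* All `H_B(M_κ)` have `E`-dimension `rank`, and `H_dR(M)` is free of rank `rank` over `E ⊗_ℚ F`.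
* `hodge σ κ p` is the `σ`-component `H^{p,q}(M_κ)_σ ⊆ H_B(M_κ) ⊗_{E,σ} ℂ`, `q = weight - p`, of the
  Hodge decomposition of `H_B(M_κ) ⊗_ℚ ℂ`.
* `F_{∞,κ} ⊗ id` maps `H^{p,q}(M_κ)` onto `H^{q,p}(M_{ρκ})`.
* `Fil^p H_dR(M) ⊗_{F,κ} ℂ = I_κ(⊕_{i ≥ p} H^{i, weight - i}(M_κ))`.
* If the weight is even, the involution `⊕_κ (F_{∞,κ} ⊗ id)` acts on
  `⊕_κ H^{weight/2, weight/2}(M_κ)` as multiplication by a scalar. -/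
structure PureMotive (E : Type uE) (F : Type uF) [Field E] [CharZero E] [Field F] [CharZero F]
    extends Realization.{uE, uF, uB, uD} E F where
  weight : ℤ
  rank : ℕ
  rank_pos : 0 < rank
  betti_basis : ∀ κ, Nonempty (Module.Basis (Fin rank) E (HB κ))
  deRham_basis : Nonempty (Module.Basis (Fin rank) (E ⊗[ℚ] F) HdR)
  hodge : ∀ (σ : E →+* ℂ) (κ : F →+* ℂ), ℤ → Submodule ℂ (Ext σ (HB κ))
  hodge_internal : ∀ σ κ, DirectSum.IsInternal (hodge σ κ)
  hodge_Finf : ∀ (σ : E →+* ℂ) (κ κ' : F →+* ℂ) (h : κ' = conjugate κ) (p : ℤ),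
    (hodge σ κ p).map (Ext.map σ (Finf κ κ' h)) = hodge σ κ' (weight - p)
  fil_eq : ∀ (σ : E →+* ℂ) (κ : F →+* ℂ) (p : ℤ),
    Submodule.span ℂ (Ext.of (embTensor σ κ) '' (Fil p : Set HdR)) =
      (⨆ i : {i : ℤ // p ≤ i}, hodge σ κ i.1).map (comp σ κ).toLinearMap
  middle_scalar : ∀ m : ℤ, weight = 2 * m → ∃ c : ℂ, ∀ (σ : E →+* ℂ)
    (x : ∀ κ : F →+* ℂ, Ext σ (HB κ)), (∀ κ, x κ ∈ hodge σ κ m) →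
    ∀ (κ κ' : F →+* ℂ) (h : κ' = conjugate κ), Ext.map σ (Finf κ κ' h) (x κ) = c • x κ'

namespace PureMotive

variable {E : Type uE} {F : Type uF} [Field E] [CharZero E] [Field F] [CharZero F]
  (M : PureMotive.{uE, uF, uB, uD} E F) (N : PureMotive.{uE, uF, uB', uD'} E F)

theorem finite_hodgeTypes (σ : E →+* ℂ) (κ : F →+* ℂ) : {p : ℤ | M.hodge σ κ p ≠ ⊥}.Finite := by
  obtain ⟨b⟩ := M.betti_basis κ
  have : Module.Finite E (M.HB κ) := Module.Finite.of_basis b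
  have : Module.Finite ℂ (Ext σ (M.HB κ)) := Ext.finite σ
  exact WellFoundedGT.finite_ne_bot_of_iSupIndep (M.hodge_internal σ κ).submodule_iSupIndep

/-- The set of the `p` with `H^{p,q}(M_κ)_σ ≠ 0`. -/
def hodgeTypes (σ : E →+* ℂ) (κ : F →+* ℂ) : Finset ℤ := (M.finite_hodgeTypes σ κ).toFinset

/-- The number `t^{M_{κ,σ}}` of Hodge types. -/
def numTypes (σ : E →+* ℂ) (κ : F →+* ℂ) : ℕ := (M.hodgeTypes σ κ).card

/-- The Hodge types `p_1 < p_2 < ⋯ < p_t` of `H_B(M_κ) ⊗_{E,σ} ℂ` in increasing order, numbered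
from `1` (the value is irrelevant if `i` is not in `{1, …, t}`). -/
def hodgeP (σ : E →+* ℂ) (κ : F →+* ℂ) (i : ℕ) : ℤ :=
  if h : i - 1 < (M.hodgeTypes σ κ).card then
    (M.hodgeTypes σ κ).orderEmbOfFin rfl ⟨i - 1, h⟩
  else 0

/-- The numbers `q_i = weight - p_i`. -/
def hodgeQ (σ : E →+* ℂ) (κ : F →+* ℂ) (i : ℕ) : ℤ := M.weight - M.hodgeP σ κ i

/-- `M` is regular at `τ` and `σ`: every `H^{p,q}(M_κ)_σ` with `κ ∈ {τ, ρτ}` has dimension at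
most `1`. -/
def IsRegularAt (σ : E →+* ℂ) (τ : F →+* ℂ) : Prop :=
  ∀ (κ : Place τ) (p : ℤ), Module.finrank ℂ (M.hodge σ κ.1 p) ≤ 1

/-- The interlace condition at `τ` and `σ` (for `t^M = t^N + 1`). -/
def Interlace (σ : E →+* ℂ) (τ : F →+* ℂ) : Prop :=
  ∃ Q : ℤ, ∀ i : ℕ, 1 ≤ i → i ≤ N.numTypes σ τ →
    (-M.hodgeP σ τ (N.numTypes σ τ + 2 - i) < N.hodgeP σ τ i + Q ∧
      N.hodgeP σ τ i + Q ≤ -M.hodgeP σ τ (N.numTypes σ τ + 1 - i)) ∧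
    (-M.hodgeQ σ τ i < N.hodgeQ σ τ (N.numTypes σ τ + 1 - i) + Q ∧
      N.hodgeQ σ τ (N.numTypes σ τ + 1 - i) + Q ≤ -M.hodgeQ σ τ (i + 1))

/-- The strong interlace condition at `τ` and `σ` (for `t^M = t^N + 1`). -/
def StrongInterlace (σ : E →+* ℂ) (τ : F →+* ℂ) : Prop :=
  ∃ Q : ℤ, ∀ i : ℕ, 1 ≤ i → i ≤ N.numTypes σ τ →
    -min (M.hodgeP σ τ (N.numTypes σ τ + 2 - i)) (M.hodgeQ σ τ i) <
      min (N.hodgeP σ τ i) (N.hodgeQ σ τ (N.numTypes σ τ + 1 - i)) + Q ∧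
    max (N.hodgeP σ τ i) (N.hodgeQ σ τ (N.numTypes σ τ + 1 - i)) + Q ≤
      -max (M.hodgeP σ τ (N.numTypes σ τ + 1 - i)) (M.hodgeQ σ τ (i + 1))

/-- The `μ`-th step of the Hodge filtration on `𝒯_{τ,σ}(M)`, the steps being counted at every
`κ ∈ {τ, ρτ}`: the sum over `κ` of the rational forms of `Fil^{p_μ(κ)} H_dR(M)`, where `p_μ(κ)` is
the `μ`-th Hodge type at `κ`. -/
def hodgeStep (σ : E →+* ℂ) (τ : F →+* ℂ) (μ : ℕ) :
    Submodule (periodField σ τ) (M.DRC σ τ) :=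
  M.ratPart σ τ fun κ => M.Fil (M.hodgeP σ κ.1 μ)

/-- The size `s_μ` of the `μ`-th step: the sum of the dimensions of the `μ`-th Hodge components of
`M_κ` for `κ ∈ {τ, ρτ}`.  If `M` is regular, it is `1` for real and `2` for complex `τ`. -/
def stepDim (σ : E →+* ℂ) (τ : F →+* ℂ) (μ : ℕ) : ℕ :=
  ∑ᶠ κ : Place τ, Module.finrank ℂ (M.hodge σ κ.1 (M.hodgeP σ κ.1 μ))

/-- `c` is a value of the fundamental period `c_{β,(τ,σ)}(M)`, that is `c = f_β(X)` for a
period matrix `X` whose de Rham basis is adapted to the steps of the Hodge filtration, and a nonzero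
polynomial `f_β` with rational coefficients which is of type
`{(2, …, 2, 1, …, 1, 0, …, 0); (1, 1)}` (`β` twos, `t - 2β` ones, `β` zeros) with respect to the
partitions `d_* = s_1 + ⋯ + s_t` and `d_* = d_*^+ + d_*^-`.  By convention, `c_0` is `δ`. -/
def IsFundamentalPeriod (σ : E →+* ℂ) (τ : F →+* ℂ) (β : ℕ) (c : ℂ) : Prop :=
  if β = 0 then M.IsDelta σ τ c
  else ∃ P : M.PeriodMatrix σ τ,
    (∀ μ, 1 ≤ μ → μ ≤ M.numTypes σ τ → P.AdaptedTo (M.hodgeStep σ τ μ)) ∧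
    ∃ f : MvPolynomial (Fin (P.dp + P.dm) × (Fin P.dp ⊕ Fin P.dm)) ℚ, f ≠ 0 ∧
      IsOfType (M.numTypes σ τ) (M.stepDim σ τ) (betaExponent (M.numTypes σ τ) β) 1 1 f ∧
      c = evalPoly f P.X

/-- `c` is a value of the period `c^±_{(τ,σ)}(M, N)`, which is `c^±_{(τ,σ)}(M ⊗_F N)` if `τ` is real
and `c^±_{(τ,σ)}(M ⊗_F N) · c^±_{(ι₀,σ)}(M^{[τ]} ⊗ N^{[ρτ]})` if `τ` is complex.  Here `M^{[τ]}` and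
`N^{[ρτ]}` are the extensions of scalars to `L = F^{(τ,ρ)}` along `τ` and `ρτ`, their tensor
product is taken over `L`, and `ι₀` is the inclusion of `L` in `ℂ`. -/
def IsTensorPeriod (σ : E →+* ℂ) (τ : F →+* ℂ) (ε : ℤˣ) (c : ℂ) : Prop :=
  (IsReal τ → (M.tensor N.toRealization).IsPeriod σ τ ε c) ∧
  (¬ IsReal τ → ∃ c₁ c₂ : ℂ, (M.tensor N.toRealization).IsPeriod σ τ ε c₁ ∧
    ((M.baseChange (toConjClosure τ)).tensor
      (N.baseChange (conjToConjClosure τ))).IsPeriod σ (conjClosure τ).subtype ε c₂ ∧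
    c = c₁ * c₂)

end PureMotive

/-- `a ∼_K b`: the number `a` is a multiple of `b` by a nonzero element of `K`. -/
def EqUpTo (K : Subfield ℂ) (a b : ℂ) : Prop := ∃ c ∈ K, c ≠ 0 ∧ a = b * c

end

end YoshidaPeriod

/-!
The proof computes all periods up to factors in `K` by factoring period matrices.

At each embedding `κ` of the place, a regular motive has two bases (`Frame`): a basis `ω` of the
rational form of the de Rham space, adapted to the Hodge filtration, and a basis `h` of the Betti
space made of vectors of pure Hodge type. Since the graded pieces of the filtration are lines, the
matrix of `h` in terms of `ω` is triangular; write `λ_m(κ)` for its diagonal entries. The vectors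
`h` can be chosen so that `F_∞` maps the `m`-th vector at `κ` to `±` the vector number `n - 1 - m`
at the conjugate embedding (`FrameFamily`, `PureMotive.exists_frameFamily`). The eigenspaces of
`F_∞` then have bases with coordinates in `K` with respect to `h`; comparing them with the Betti
bases gives matrices `H^+` and `H^-` (`FrameFamily.EigenData`). So a period matrix is a product `C
A G H`: `C` has entries in `K` and is triangular for the steps of the filtration in use, `A` is
triangular with diagonal entries `λ`, `G` has entries in `K`, and `H` is made of the blocks `H^±`.
With `λ_m = ∏_κ λ_m(κ)` this has the following consequences up to factors in `K`.

* If `F_∞` exchanges a step of the filtration with its complement, `c^±` is the product of the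
  factors `λ_m` outside this step and of `det H^±` (`FrameFamily.isPeriod_eqUpTo`). This applies
  to motives of even rank and to tensor products.
* `δ` is the product of all `λ_m` and of `det H^+ det H^-` (`FrameFamily.isDelta_eqUpTo`).
* `c_β` is `∏_m λ_m ^ a_m det H^+ det H^-`, where `a` is `(2, …, 2, 1, …, 1, 0, …, 0)`
  (`FrameFamily.evalPoly_period_eqUpTo`). The equivariance of `f_β` reduces this to the
  nonvanishing of `f_β` at `G`. The columns of `G` are eigenvectors of an involution which
  reverses the blocks, so the orbit of `G` under the group in the equivariance property is open,
  and a nonzero relative invariant does not vanish on it (`evalPoly_ne_zero`).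

Tensor products and extensions of scalars inherit such bases (`FrameFamily.tensor`,
`FrameFamily.baseChange`). Write `r = d(N)`. The interlace condition, and the strong one at a
complex place, implies that for some step of the filtration of the tensor product the vectors
outside this step are the products of the `a`-th and the `i`-th vector with `a + i < r`
(`PureMotive.Interlace.exists_cut`, `PureMotive.StrongInterlace.exists_cut`), so that the factors
`λ` of `M` and `N` enter the period with the exponents `r - a` and `r - i`. These are the total
exponents on the right hand side (`prod_eqUpTo_of_even`, `prod_eqUpTo_of_odd`).

It remains to compare the determinants. At a real place the `ε`-eigenspace of the tensor product
is the sum of two products of eigenspaces (`FrameFamily.exists_realTensorData`), and the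
determinants match because the eigenspaces of the factor of even rank have equal dimensions while
those of the other one differ by one. At a complex place each eigenspace is isomorphic to the
Betti space of one embedding, so the signs do not matter, and the period of the twisted tensor
product is given by the same formula as that of the tensor product.
-/

namespace YoshidaPeriod

open scoped TensorProduct
open NumberField.ComplexEmbedding

noncomputable section

/-! ### Calculus of equality up to a factor in a subfield -/

section EqUpTo

variable {K : Subfield ℂ} {a b c a' b' : ℂ}

theorem EqUpTo.refl (K : Subfield ℂ) (a : ℂ) : EqUpTo K a a :=
  ⟨1, K.one_mem, one_ne_zero, (mul_one a).symm⟩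

theorem EqUpTo.symm (h : EqUpTo K a b) : EqUpTo K b a := by
  obtain ⟨c, hc, h0, rfl⟩ := h
  exact ⟨c⁻¹, K.inv_mem hc, inv_ne_zero h0, by field_simp⟩

theorem EqUpTo.trans (h : EqUpTo K a b) (h' : EqUpTo K b c) : EqUpTo K a c := by
  obtain ⟨x, hx, hx0, rfl⟩ := h
  obtain ⟨y, hy, hy0, rfl⟩ := h'
  exact ⟨y * x, K.mul_mem hy hx, mul_ne_zero hy0 hx0, by ring⟩

theorem EqUpTo.mul (h : EqUpTo K a b) (h' : EqUpTo K a' b') : EqUpTo K (a * a') (b * b') := by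
  obtain ⟨x, hx, hx0, rfl⟩ := h
  obtain ⟨y, hy, hy0, rfl⟩ := h'
  exact ⟨x * y, K.mul_mem hx hy, mul_ne_zero hx0 hy0, by ring⟩

theorem EqUpTo.pow (h : EqUpTo K a b) (n : ℕ) : EqUpTo K (a ^ n) (b ^ n) := by
  obtain ⟨x, hx, hx0, rfl⟩ := h
  exact ⟨x ^ n, K.pow_mem hx n, pow_ne_zero n hx0, by ring⟩

theorem EqUpTo.prod {α : Type*} (s : Finset α) {f g : α → ℂ} (h : ∀ i ∈ s, EqUpTo K (f i) (g i)) :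
    EqUpTo K (∏ i ∈ s, f i) (∏ i ∈ s, g i) := by
  classical
  induction s using Finset.induction_on with
  | empty => simpa using EqUpTo.refl K 1
  | insert i s hi ih =>
    rw [Finset.prod_insert hi, Finset.prod_insert hi]
    exact (h i (Finset.mem_insert_self i s)).mul
      (ih fun j hj => h j (Finset.mem_insert_of_mem hj))

theorem EqUpTo.mul_left (hc : c ∈ K) (h0 : c ≠ 0) : EqUpTo K (c * a) a :=
  ⟨c, hc, h0, mul_comm c a⟩

theorem det_mem_subfield {m : Type*} [Fintype m] [DecidableEq m] {A : Matrix m m ℂ}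
    (h : ∀ i j, A i j ∈ K) : A.det ∈ K := by
  rw [Matrix.det_apply]
  refine K.sum_mem fun p _ => ?_
  have := K.prod_mem (t := Finset.univ) (f := fun i => A (p i) i) fun i _ => h _ _
  rcases Int.units_eq_one_or (Equiv.Perm.sign p) with hs | hs <;> rw [hs]
  · simpa using this
  · simpa using this

end EqUpTo

/-! ### Extension of scalars -/

section Ext

variable {R S T : Type*} [CommRing R] [CommRing S] [CommRing T]
  {V W : Type*} [AddCommGroup V] [Module R V] [AddCommGroup W] [Module R W]

/-- The basis of an extension of scalars deduced from a basis of the module. -/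
def Ext.basis {ι : Type*} (f : R →+* S) (b : Module.Basis ι R V) : Module.Basis ι S (Ext f V) :=
  letI := f.toAlgebra
  b.baseChange S

theorem Ext.basis_apply {ι : Type*} (f : R →+* S) (b : Module.Basis ι R V) (i : ι) :
    Ext.basis f b i = Ext.of f (b i) :=
  let _ := f.toAlgebra
  b.baseChange_apply S i

theorem Ext.span_range_of (f : R →+* S) (V : Type*) [AddCommGroup V] [Module R V] :
    Submodule.span S (Set.range (Ext.of f (V := V))) = ⊤ := by
  let _ := f.toAlgebra
  refine eq_top_iff.2 fun x hx => ?_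
  clear hx
  change S ⊗[R] V at x
  induction x using TensorProduct.induction_on with
  | zero => exact Submodule.zero_mem _
  | tmul s v =>
    have : (s ⊗ₜ[R] v : S ⊗[R] V) = s • ((1 : S) ⊗ₜ[R] v) := by
      rw [TensorProduct.smul_tmul', smul_eq_mul, mul_one]
    rw [this]
    exact Submodule.smul_mem _ _ (Submodule.subset_span ⟨v, rfl⟩)
  | add x y hx hy => exact Submodule.add_mem _ hx hy

theorem Ext.map_of (f : R →+* S) (g : V →ₗ[R] W) (v : V) :
    Ext.map f g (Ext.of f v) = Ext.of f (g v) := by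
  let _ := f.toAlgebra
  exact LinearMap.baseChange_tmul g 1 v

theorem Ext.hom_ext {f : R →+* S} {X : Type*} [AddCommGroup X] [Module S X]
    {a b : Ext f V →ₗ[S] X} (h : ∀ v, a (Ext.of f v) = b (Ext.of f v)) : a = b :=
  LinearMap.ext_on_range (v := Ext.of f (V := V)) (Ext.span_range_of f V) h

theorem Ext.tensorEquiv_of (f : R →+* S) (v : V) (w : W) :
    Ext.tensorEquiv f V W (Ext.of f (v ⊗ₜ[R] w)) = Ext.of f v ⊗ₜ[S] Ext.of f w := by
  let _ := f.toAlgebra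
  exact TensorProduct.AlgebraTensorModule.distribBaseChange_tmul ..

theorem Ext.map_tensor {V' W' : Type*} [AddCommGroup V'] [Module R V'] [AddCommGroup W']
    [Module R W'] (f : R →+* S) (a : V →ₗ[R] V') (b : W →ₗ[R] W') (x : Ext f V) (y : Ext f W) :
    Ext.map f (TensorProduct.map a b) ((Ext.tensorEquiv f V W).symm (x ⊗ₜ[S] y)) =
      (Ext.tensorEquiv f V' W').symm (Ext.map f a x ⊗ₜ[S] Ext.map f b y) := by
  rw [LinearEquiv.eq_symm_apply]
  have key : (Ext.tensorEquiv f V' W').toLinearMap ∘ₗ Ext.map f (TensorProduct.map a b) =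
      TensorProduct.map (Ext.map f a) (Ext.map f b) ∘ₗ (Ext.tensorEquiv f V W).toLinearMap := by
    let _ := f.toAlgebra
    refine Ext.hom_ext fun z => ?_
    induction z using TensorProduct.induction_on with
    | zero => simp
    | tmul v w =>
      simp only [LinearMap.comp_apply, LinearEquiv.coe_coe, Ext.map_of, Ext.tensorEquiv_of,
        TensorProduct.map_tmul]
    | add p q hp hq => rw [map_add, map_add, map_add, hp, hq]
  have := LinearMap.congr_fun key ((Ext.tensorEquiv f V W).symm (x ⊗ₜ[S] y))
  simpa using this

end Ext

/-! ### Rational forms of complex vector spaces -/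

section KForm

variable {K : Subfield ℂ} {W : Type*} [AddCommGroup W] [Module ℂ W] {ι : Type*}

theorem mem_span_subfield_iff [Finite ι] (b : Module.Basis ι ℂ W) (x : W) :
    x ∈ Submodule.span K (Set.range b) ↔ ∀ i, b.repr x i ∈ K := by
  classical
  have := Fintype.ofFinite ι
  constructor
  · intro hx i
    induction hx using Submodule.span_induction with
    | mem x hx =>
      obtain ⟨j, rfl⟩ := hx
      rw [Module.Basis.repr_self, Finsupp.single_apply]
      split_ifs
      exacts [K.one_mem, K.zero_mem]
    | zero => simp
    | add x y _ _ hx hy => simpa using K.add_mem hx hy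
    | smul a x _ hx =>
      have : b.repr (a • x) i = (a : ℂ) * b.repr x i := by
        rw [show a • x = (a : ℂ) • x from rfl]; simp
      rw [this]
      exact K.mul_mem a.2 hx
  · intro h
    rw [← b.sum_repr x]
    refine Submodule.sum_mem _ fun i _ => ?_
    exact Submodule.smul_mem _ (⟨_, h i⟩ : K) (Submodule.subset_span ⟨i, rfl⟩)

theorem mem_span_image_iff_repr [Finite ι] (b : Module.Basis ι ℂ W) (A : Set ι) (x : W) :
    x ∈ Submodule.span ℂ (b '' A) ↔ ∀ i, i ∉ A → b.repr x i = 0 := by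
  rw [b.mem_span_image]
  constructor
  · intro h i hi
    by_contra h0
    exact hi (h (by simpa using h0))
  · intro h i hi
    by_contra h0
    exact (by simpa using hi : b.repr x i ≠ 0) (h i h0)

/-- A `K`-subspace of a `K`-form is recovered from its complex span. -/
theorem mem_of_mem_span_complex (b : Module.Basis ι ℂ W) {S : Submodule K W}
    (hS : S ≤ Submodule.span K (Set.range b)) {x : W}
    (hx : x ∈ Submodule.span K (Set.range b)) (hx' : x ∈ Submodule.span ℂ (S : Set W)) :
    x ∈ S := by
  by_contra hxS
  set T := Submodule.span K (Set.range b) with hT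
  -- a `K`-linear form on `T` which separates `x` from `S` extends to a complex linear form
  obtain ⟨f, hf, hfS⟩ := Submodule.exists_le_ker_of_notMem
    (show (⟨x, hx⟩ : T) ∉ S.comap T.subtype from hxS)
  let g : W →ₗ[ℂ] ℂ := b.constr ℂ fun i =>
    ((f ⟨b i, Submodule.subset_span ⟨i, rfl⟩⟩ : K) : ℂ)
  have hg : ∀ y (hy : y ∈ T), g y = ((f ⟨y, hy⟩ : K) : ℂ) := by
    intro y hy
    induction hy using Submodule.span_induction with
    | mem y hy => obtain ⟨i, rfl⟩ := hy; simp [g, Module.Basis.constr_basis]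
    | zero =>
      rw [map_zero]
      exact (congrArg Subtype.val (map_zero f)).symm
    | add y z hy hz h1 h2 =>
      rw [map_add, h1, h2]
      exact congrArg Subtype.val (map_add f ⟨y, hy⟩ ⟨z, hz⟩).symm
    | smul a y hy h1 =>
      refine (g.map_smul (a : ℂ) y).trans ?_
      rw [h1]
      exact congrArg Subtype.val (map_smul f a ⟨y, hy⟩).symm
  have h0 : Submodule.span ℂ (S : Set W) ≤ LinearMap.ker g := by
    rw [Submodule.span_le]
    intro y hy
    have h2 : f ⟨y, hS hy⟩ = 0 := hfS (show (⟨y, hS hy⟩ : T) ∈ S.comap T.subtype from hy)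
    simp [hg y (hS hy), h2]
  have h3 := h0 hx'
  rw [LinearMap.mem_ker, hg x hx] at h3
  exact hf (by simpa using h3)

/-- Subspaces of the same `K`-form with the same complex span are equal. -/
theorem eq_of_span_complex_eq (b : Module.Basis ι ℂ W) {S S' : Submodule K W}
    (hS : S ≤ Submodule.span K (Set.range b)) (hS' : S' ≤ Submodule.span K (Set.range b))
    (h : Submodule.span ℂ (S : Set W) = Submodule.span ℂ (S' : Set W)) : S = S' :=
  le_antisymm
    (fun _ hx => mem_of_mem_span_complex b hS' (hS hx) (h ▸ Submodule.subset_span hx))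
    (fun _ hx => mem_of_mem_span_complex b hS (hS' hx) (h ▸ Submodule.subset_span hx))

theorem span_complex_span_subfield (K : Subfield ℂ) (A : Set W) :
    Submodule.span ℂ (Submodule.span K A : Set W) = Submodule.span ℂ A :=
  Submodule.span_span_of_tower K ℂ A

end KForm

end

noncomputable section

/-! ### Determinants of triangular shape and minors of period matrices -/

section Minor

/-- A matrix whose off-diagonal nonzero entries strictly raise a level has the product of its
diagonal entries as determinant: a permutation that nowhere lowers the level preserves the sum of
the levels, so it is trivial. -/
theorem det_of_level {ι : Type*} [Fintype ι] [DecidableEq ι] {A : Matrix ι ι ℂ} (lev : ι → ℤ)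
    (h : ∀ l m, l ≠ m → ¬ lev m < lev l → A l m = 0) : A.det = ∏ m, A m m := by
  rw [Matrix.det_apply, Finset.sum_eq_single 1]
  · simp
  · intro p _ hp
    by_cases hz : ∃ i, A (p i) i = 0
    · obtain ⟨i, hi⟩ := hz
      rw [Finset.prod_eq_zero (f := fun i => A (p i) i) (Finset.mem_univ i) hi, smul_zero]
    · exfalso
      push Not at hz
      have hle : ∀ i, lev i ≤ lev (p i) := fun i => by
        by_contra hlt
        refine hz i (h _ _ ?_ (by lia))
        intro hh
        rw [hh] at hlt
        exact hlt le_rfl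
      obtain ⟨i, hi⟩ : ∃ i, p i ≠ i := by
        by_contra! hall
        exact hp (Equiv.ext hall)
      have hlt : lev i < lev (p i) := by
        by_contra hnot
        exact hz i (h _ _ hi hnot)
      have h1 : ∑ i, lev i < ∑ i, lev (p i) :=
        Finset.sum_lt_sum (fun i _ => hle i) ⟨i, Finset.mem_univ i, hlt⟩
      rw [Equiv.sum_comp p lev] at h1
      exact lt_irrefl _ h1
  · intro h1
    exact absurd (Finset.mem_univ _) h1

/-- If some rows of `P` vanish outside the columns in `low`, these rows of `P * Q` only involve the
rows of `Q` in `low`. -/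
theorem submatrix_mul_of_zero {a b c d : Type*} [Fintype b] (low : b → Prop) [DecidablePred low]
    (P : Matrix a b ℂ) (Q : Matrix b c ℂ) (r : d → a) (h : ∀ i l, ¬ low l → P (r i) l = 0) :
    (P * Q).submatrix r id =
      P.submatrix r (Subtype.val : {l // low l} → b) *
        Q.submatrix (Subtype.val : {l // low l} → b) id := by
  ext i j
  rw [Matrix.submatrix_apply, Matrix.mul_apply]
  symm
  simp only [id]
  rw [← Fintype.sum_subtype_add_sum_subtype low]
  have : ∑ l : {l // ¬ low l}, P (r i) l * Q l j = 0 :=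
    Finset.sum_eq_zero fun l _ => by rw [h i l l.2, zero_mul]
  rw [this, add_zero]
  simp only [Matrix.mul_apply, Matrix.submatrix_apply, id]

variable {K : Subfield ℂ} {W : Type*} [AddCommGroup W] [Module ℂ W]

/-- The minor formed by the first `k` coordinates, with respect to `Ω`, of vectors `v` is the
product of the factors `lam` of low level times `det H`, up to a factor in `K`.

The matrix of the `v` is `C A G H`, where `C` compares `Ω` with the other rational basis `Ω₀`, `A`
compares `Ω₀` with the Hodge basis `Hb`, and `G` is the matrix of the vectors `w` with respect to
`Hb`.  As `C` and `A` are triangular for the filtration, the minor only involves the coordinates of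
low level, so it is the product of four determinants; those of `C` and of `G` belong to `K`. -/
theorem minor_eqUpTo_of_bases {N k : ℕ} (hk : k ≤ N) {ι J : Type*} [Fintype ι] [DecidableEq ι]
    [Fintype J] [DecidableEq J]
    (Ω : Module.Basis (Fin N) ℂ W) (Ω₀ Hb : Module.Basis ι ℂ W) (low : ι → Prop) [DecidablePred low]
    (hC : ∀ l i, Ω.repr (Ω₀ l) i ∈ K)
    (hCU : ∀ l, ¬ low l → ∀ i : Fin N, (i : ℕ) < k → Ω.repr (Ω₀ l) i = 0)
    (lev : ι → ℤ) (hlow : ∀ l m, ¬ low m → lev m ≤ lev l → ¬ low l) (lam : ι → ℂ)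
    (hdiag : ∀ m, Ω₀.repr (Hb m) m = lam m)
    (htri : ∀ m l, l ≠ m → ¬ lev m < lev l → Ω₀.repr (Hb m) l = 0)
    (hcard : Fintype.card {m // low m} = k) (e : Fin k ≃ J)
    (w : J → W) (hwK : ∀ j m, Hb.repr (w j) m ∈ K)
    (hinj : ∀ a : J → ℂ, (∀ m, low m → Hb.repr (∑ j, a j • w j) m = 0) → a = 0)
    (H : Matrix J (Fin k) ℂ) (v : Fin k → W) (hv : ∀ j, v j = ∑ i, H i j • w i) :
    EqUpTo K (Matrix.of fun i j : Fin k => Ω.repr (v j) (Fin.castLE hk i)).det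
      ((∏ m : {m // low m}, lam m) * (H.submatrix e id).det) := by
  -- `C` and `G` have coefficients in `K`, and `A` is triangular with diagonal entries `lam`
  set C := Ω.toMatrix Ω₀ with hCdef
  set A := Ω₀.toMatrix Hb with hAdef
  set G := Hb.toMatrix w with hGdef
  have hX : (Matrix.of fun i j : Fin k => Ω.repr (v j) (Fin.castLE hk i)) =
      (C * (A * (G * H))).submatrix (Fin.castLE hk) id := by
    have h1 : C * (A * (G * H)) = Ω.toMatrix v := by
      rw [← Matrix.mul_assoc, ← Matrix.mul_assoc, Module.Basis.toMatrix_mul_toMatrix,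
        Module.Basis.toMatrix_mul_toMatrix]
      ext i j
      simp [Matrix.mul_apply, Module.Basis.toMatrix_apply, hv, mul_comm]
    rw [h1]
    rfl
  let eL : Fin k ≃ {m // low m} := (Fintype.equivFinOfCardEq hcard).symm
  let C' : Matrix (Fin k) {m // low m} ℂ := C.submatrix (Fin.castLE hk) Subtype.val
  let A' : Matrix {m // low m} {m // low m} ℂ := A.submatrix Subtype.val Subtype.val
  let G' : Matrix {m // low m} J ℂ := G.submatrix Subtype.val id
  -- the rows of index `< k` only involve the vectors of low level
  have h1 : (C * (A * (G * H))).submatrix (Fin.castLE hk) id = C' * (A' * (G' * H)) := by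
    rw [submatrix_mul_of_zero low C _ _ fun i l hl => hCU l hl _ i.2,
      submatrix_mul_of_zero low A (G * H) (Subtype.val : {m // low m} → ι)]
    · rfl
    · intro l m hm
      refine htri m l ?_ ?_
      · rintro rfl; exact hm l.2
      · intro hlt; exact hlow _ _ hm hlt.le l.2
  have h2 : C' * (A' * (G' * H)) = C'.submatrix id eL *
      (A'.submatrix eL eL * (G'.submatrix eL e * H.submatrix e id)) := by
    rw [Matrix.submatrix_mul_equiv, Matrix.submatrix_mul_equiv, Matrix.submatrix_mul_equiv,
      Matrix.submatrix_id_id]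
  rw [hX, h1, h2, Matrix.det_mul, Matrix.det_mul, Matrix.det_mul,
    Matrix.det_submatrix_equiv_self, det_of_level (fun m : {m // low m} => lev m)]
  · have hA : (∏ m : {m // low m}, A' m m) = ∏ m : {m // low m}, lam m :=
      Finset.prod_congr rfl fun m _ => hdiag m
    rw [hA]
    set c := (C'.submatrix id eL).det with hc
    set g := (G'.submatrix eL e).det with hg
    refine ⟨c * g, K.mul_mem (det_mem_subfield fun i j => hC _ _)
      (det_mem_subfield fun i j => hwK _ _), mul_ne_zero ?_ ?_, by ring⟩
    · intro h0
      obtain ⟨y, hy0, hy⟩ := Matrix.exists_vecMul_eq_zero_iff.2 h0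
      -- extending `y` by zero gives a relation between all the rows of the invertible matrix `C`
      let y' : Fin N → ℂ := fun i => if h : (i : ℕ) < k then y ⟨i, h⟩ else 0
      have hsum : ∀ l, Matrix.vecMul y' C l = ∑ i : Fin k, y i * C (Fin.castLE hk i) l := by
        intro l
        simp only [Matrix.vecMul, dotProduct]
        symm
        refine Finset.sum_of_injOn (Fin.castLE hk) (Fin.castLE_injective hk).injOn
          (by simp) ?_ ?_
        · intro i _ hi
          have : ¬ (i : ℕ) < k := fun h => hi ⟨⟨i, h⟩, by simp, rfl⟩
          simp [y', this]
        · intro i _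
          simp [y']
      have hy' : Matrix.vecMul y' C = 0 := by
        ext l
        rw [hsum]
        by_cases hl : low l
        · have := congrFun hy (eL.symm ⟨l, hl⟩)
          simpa [Matrix.vecMul, dotProduct, C'] using this
        · refine Finset.sum_eq_zero fun i _ => ?_
          rw [show C (Fin.castLE hk i) l = 0 from hCU l hl _ i.2, mul_zero]
      have hz : y' = 0 := by
        have := congrArg (fun z => Matrix.vecMul z (Ω₀.toMatrix Ω)) hy'
        simpa [Matrix.vecMul_vecMul, hCdef] using this
      apply hy0
      ext i
      have := congrFun hz (Fin.castLE hk i)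
      simpa [y'] using this
    · -- a relation between the columns of `G'` is a combination of the `w` without low coordinates
      intro h0
      obtain ⟨a, ha0, ha⟩ := Matrix.exists_mulVec_eq_zero_iff.2 h0
      apply ha0
      have := hinj (a ∘ e.symm) fun m hm => by
        have h3 := congrFun ha (eL.symm ⟨m, hm⟩)
        simp only [Matrix.mulVec, dotProduct, Matrix.submatrix_apply,
          Equiv.apply_symm_apply, Pi.zero_apply] at h3
        rw [map_sum, Finsupp.finsetSum_apply, ← Equiv.sum_comp e]
        simpa [G', hGdef, Module.Basis.toMatrix_apply, mul_comm] using h3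
      ext i
      have h4 := congrFun this (e i)
      simpa using h4
  · intro l m hlm hlt
    exact htri m l (fun h => hlm (Subtype.ext h)) hlt

end Minor

end

noncomputable section

/-! ### Relative invariants on an open orbit -/

section Density

/-- A polynomial vanishing on a neighbourhood of a point of an affine space is zero. -/
theorem mvPolynomial_eq_zero_of_eventually {α : Type*} [Finite α] (f : MvPolynomial α ℂ) (x : α → ℂ)
    (h : ∀ᶠ y in nhds x, MvPolynomial.eval y f = 0) : f = 0 := by
  have := Fintype.ofFinite α
  obtain ⟨r, hr, hball⟩ := Metric.eventually_nhds_iff_ball.1 h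
  refine MvPolynomial.funext_set (fun i => Metric.ball (x i) r) (fun i =>
    infinite_of_mem_nhds (x i) (Metric.ball_mem_nhds _ hr)) fun y hy => ?_
  rw [map_zero]
  refine hball y ?_
  rw [← ball_pi x hr] at *
  exact hy

/-- If the products `(1 + a q) x (1 + b k)`, with `a` and `b` linear, move `x` in all directions to
first order, then they fill a neighbourhood of `x`. -/
theorem eventually_of_surjective {A : Type*} [NormedRing A] [NormedAlgebra ℂ A]
    [FiniteDimensional ℂ A] (a b : A →ₗ[ℂ] A) (x : A)
    (hsurj : ∀ y, ∃ q k, a q * x + x * b k = y) {p : A → Prop}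
    (hp : ∀ q k, IsUnit (1 + a q) → IsUnit (1 + b k) → p ((1 + a q) * x * (1 + b k))) :
    ∀ᶠ y in nhds x, p y := by
  have : CompleteSpace A := FiniteDimensional.complete ℂ A
  let a' : A × A →L[ℂ] A := a.toContinuousLinearMap ∘L ContinuousLinearMap.fst ℂ A A
  let b' : A × A →L[ℂ] A := b.toContinuousLinearMap ∘L ContinuousLinearMap.snd ℂ A A
  have h1 := ((a'.hasStrictFDerivAt (x := 0)).const_add 1).mul_const' x
  have h2 := h1.mul' ((b'.hasStrictFDerivAt (x := 0)).const_add 1)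
  have h3 := h2.map_nhds_eq_of_surj (by
    rw [LinearMap.range_eq_top]
    intro y
    obtain ⟨q, k, h⟩ := hsurj y
    refine ⟨(q, k), ?_⟩
    simpa [a', b', add_comm] using h)
  have hx : (((fun z => (1 + a' z) * x) * fun z => 1 + b' z) (0 : A × A)) = x := by simp
  rw [hx] at h3
  rw [← h3, Filter.eventually_map]
  have hu : ∀ c : A × A →L[ℂ] A, ∀ᶠ z in nhds 0, IsUnit (1 + c z) := by
    intro c
    have hc : Continuous fun z => 1 + c z := by fun_prop
    refine hc.continuousAt.eventually (Units.isOpen.mem_nhds ?_)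
    simp
  filter_upwards [hu a', hu b'] with z hz1 hz2
  exact hp z.1 z.2 hz1 hz2

/-- The linear map keeping the entries of a matrix at the positions satisfying `P`. -/
def maskEntries {J : Type*} (P : J → J → Prop) [∀ i j, Decidable (P i j)] :
    Matrix J J ℂ →ₗ[ℂ] Matrix J J ℂ where
  toFun q := Matrix.of fun i j => if P i j then q i j else 0
  map_add' q r := by ext i j; simp only [Matrix.of_apply, Matrix.add_apply]; split_ifs <;> simp
  map_smul' c q := by ext i j; simp

/-- An involution `θ` exchanging the blocks `μ` and `t - μ` makes the space of matrices the sum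
of the lower block triangular matrices and of the centralizer of `θ`: a strictly upper block
triangular matrix `u` is `(u + θ u θ) - θ u θ`.  If the columns of `x` are eigenvectors of `θ`, this
says that the products `p x h`, with `p` lower block triangular and `h` block diagonal, fill a
neighbourhood of `x`. -/
theorem exists_lower_add_diagonal {J : Type*} [Fintype J] [DecidableEq J] (blk : J → ℕ) (t : ℕ)
    (θ x d : Matrix J J ℂ) (hθ : θ * θ = 1) (hblk : ∀ i j, θ i j ≠ 0 → blk i + blk j = t)
    (hx : IsUnit x) (D : J → J → Prop) [∀ i j, Decidable (D i j)]
    (hd : ∀ k : Matrix J J ℂ, d * k = k * d → maskEntries D k = k) (hθx : θ * x = x * d)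
    (y : Matrix J J ℂ) :
    ∃ q k, maskEntries (fun i j => ¬ blk i < blk j) q * x + x * maskEntries D k = y := by
  obtain ⟨z, hz⟩ := hx.exists_right_inv
  have hz' : z * x = 1 := mul_eq_one_comm.1 hz
  set u := maskEntries (fun i j => blk i < blk j) (y * z) with hu
  have hlow : ∀ i j, blk i < blk j → (θ * u * θ) i j = 0 := by
    intro i j hij
    rw [Matrix.mul_apply]
    refine Finset.sum_eq_zero fun l _ => ?_
    rw [Matrix.mul_apply]
    by_cases hl : θ l j = 0
    · rw [hl, mul_zero]
    rw [Finset.sum_eq_zero, zero_mul]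
    intro l' _
    by_cases hl' : θ i l' = 0
    · rw [hl', zero_mul]
    have h1 := hblk _ _ hl
    have h2 := hblk _ _ hl'
    have h3 : ¬ blk l' < blk l := by omega
    simp [hu, maskEntries, h3]
  refine ⟨y * z - θ * u * θ, z * (u + θ * u * θ) * x, ?_⟩
  have hc : θ * (u + θ * u * θ) = (u + θ * u * θ) * θ := by
    rw [mul_add, add_mul, mul_assoc (θ * u), hθ, mul_one, mul_assoc θ u θ, ← mul_assoc θ θ, hθ,
      one_mul, add_comm]
  have hzθ : z * θ = d * z := by
    calc z * θ = z * (θ * x) * z := by rw [mul_assoc z, mul_assoc θ, hz, mul_one]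
      _ = d * z := by rw [hθx, ← mul_assoc, hz', one_mul]
  rw [hd]
  · have h1 : maskEntries (fun i j => ¬ blk i < blk j) (y * z - θ * u * θ) =
        y * z - u - θ * u * θ := by
      ext i j
      by_cases hij : blk i < blk j
      · have h1 := hlow i j hij
        have h2 : u i j = (y * z) i j := by simp [hu, maskEntries, hij]
        simp [maskEntries, hij, h1, h2]
      · simp [maskEntries, hu, hij]
    rw [h1, ← mul_assoc, ← mul_assoc, hz, one_mul, ← add_mul, sub_sub, sub_add_cancel, mul_assoc,
      hz', mul_one]
  · calc d * (z * (u + θ * u * θ) * x) = (d * z) * (u + θ * u * θ) * x := by simp only [mul_assoc]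
      _ = z * (θ * (u + θ * u * θ)) * x := by rw [← hzθ]; simp only [mul_assoc]
      _ = z * (u + θ * u * θ) * (θ * x) := by rw [hc]; simp only [mul_assoc]
      _ = z * (u + θ * u * θ) * x * d := by rw [hθx]; simp only [mul_assoc]

theorem evalPoly_eq_eval {m n : ℕ} (f : MvPolynomial (Fin (m + n) × (Fin m ⊕ Fin n)) ℚ)
    (x : Matrix (Fin (m + n)) (Fin m ⊕ Fin n) ℂ) :
    evalPoly f x = MvPolynomial.eval (fun ij => x ij.1 ij.2)
      (MvPolynomial.map (algebraMap ℚ ℂ) f) := by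
  rw [evalPoly, MvPolynomial.aeval_def, MvPolynomial.eval_map]

-- the norm only serves to make the matrices a complete normed algebra
open scoped Matrix.Norms.Operator in
/-- A nonzero relative invariant does not vanish at a matrix of eigenvectors of an involution
reversing the blocks, because the orbit of this matrix is open. -/
theorem evalPoly_ne_zero {m n t : ℕ} {s a : ℕ → ℕ} {kp km : ℕ}
    {f : MvPolynomial (Fin (m + n) × (Fin m ⊕ Fin n)) ℚ} (hf0 : f ≠ 0)
    (hf : IsOfType t s a kp km f) (x : Matrix (Fin (m + n)) (Fin m ⊕ Fin n) ℂ)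
    (hx : IsUnit (x.submatrix finSumFinEquiv id))
    (θ : Matrix (Fin (m + n)) (Fin (m + n)) ℂ) (hθ : θ * θ = 1) (t' : ℕ)
    (hblk : ∀ i j, θ i j ≠ 0 → blockIndex t s i + blockIndex t s j = t')
    (hθx : θ * x =
      x * (Matrix.fromBlocks 1 0 0 (-1) : Matrix (Fin m ⊕ Fin n) (Fin m ⊕ Fin n) ℂ)) :
    evalPoly f x ≠ 0 := by
  intro h0
  apply hf0
  let e : Fin m ⊕ Fin n ≃ Fin (m + n) := finSumFinEquiv
  -- the positions in the two diagonal blocks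
  let D : Fin m ⊕ Fin n → Fin m ⊕ Fin n → Prop := fun i j => i.isLeft = j.isLeft
  -- if `f x = 0`, then `f` vanishes on the orbit of `x`, hence near `x`
  have hev : ∀ᶠ y in nhds (x.submatrix e id),
      evalPoly f (Matrix.submatrix y e.symm id) = 0 := by
    refine eventually_of_surjective
      (maskEntries fun i j => ¬ blockIndex t s (e i) < blockIndex t s (e j)) (maskEntries D) _
      (exists_lower_add_diagonal (fun i => blockIndex t s (e i)) t' (θ.submatrix e e) _
        (Matrix.fromBlocks 1 0 0 (-1)) ?_ (fun i j => hblk _ _) hx D ?_ ?_) ?_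
    · rw [Matrix.submatrix_mul_equiv, hθ, Matrix.submatrix_one_equiv]
    · intro k hk
      obtain ⟨k1, k2, k3, k4, rfl⟩ : ∃ k1 k2 k3 k4, k = Matrix.fromBlocks k1 k2 k3 k4 :=
        ⟨_, _, _, _, (Matrix.fromBlocks_toBlocks k).symm⟩
      rw [Matrix.fromBlocks_multiply, Matrix.fromBlocks_multiply, Matrix.fromBlocks_inj] at hk
      obtain ⟨-, h2, h3, -⟩ := hk
      have hk2 : k2 = 0 := by
        simpa [eq_neg_iff_add_eq_zero, ← two_smul ℂ k2] using h2
      have hk3 : k3 = 0 := by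
        simpa [neg_eq_iff_add_eq_zero, ← two_smul ℂ k3] using h3
      ext i j
      rcases i with i | i <;> rcases j with j | j <;> simp [maskEntries, D, hk2, hk3]
    · have := congrArg (fun z : Matrix (Fin (m + n)) (Fin m ⊕ Fin n) ℂ => z.submatrix e id) hθx
      rw [Matrix.submatrix_mul_equiv, this]
      rw [← Matrix.submatrix_mul_equiv x _ e (Equiv.refl _) id]
      rfl
    · intro q k hq hk
      set p := 1 + maskEntries (fun i j => ¬ blockIndex t s (e i) < blockIndex t s (e j)) q with hp
      set h := 1 + maskEntries D k with hh
      have hh' : h = Matrix.fromBlocks h.toBlocks₁₁ 0 0 h.toBlocks₂₂ := by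
        ext i j
        rcases i with i | i <;> rcases j with j | j <;>
          simp [hh, maskEntries, D, Matrix.toBlocks₁₁, Matrix.toBlocks₂₂]
      have hhu : IsUnit h.toBlocks₁₁ ∧ IsUnit h.toBlocks₂₂ := by
        rw [hh', Matrix.isUnit_iff_isUnit_det, Matrix.det_fromBlocks_zero₁₂, IsUnit.mul_iff] at hk
        simpa only [Matrix.isUnit_iff_isUnit_det] using hk
      have key := hf (p.submatrix e.symm e.symm) (fun i j hij => by
          have hne : e.symm i ≠ e.symm j := by
            intro heq
            rw [e.symm.injective heq] at hij
            exact lt_irrefl _ hij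
          simp [hp, maskEntries, hij, hne])
        ((Matrix.isUnit_submatrix_equiv e.symm e.symm).2 hq) h.toBlocks₁₁ h.toBlocks₂₂ hhu.1 hhu.2 x
      rw [h0, mul_zero, ← hh'] at key
      rw [← key]
      congr 1
      have h5 : (x.submatrix e id).submatrix e.symm (Equiv.refl _) = x := by ext i j; simp
      rw [← Matrix.submatrix_mul_equiv _ _ _ (Equiv.refl _),
        ← Matrix.submatrix_mul_equiv _ _ _ e.symm]
      erw [h5]
      rfl
  -- transport to a neighbourhood in the space of families of entries
  let T : (Fin (m + n) × (Fin m ⊕ Fin n) → ℂ) →ₗ[ℂ] Matrix (Fin m ⊕ Fin n) (Fin m ⊕ Fin n) ℂ :=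
    { toFun := fun y => Matrix.of fun i j => y (e i, j)
      map_add' := fun _ _ => rfl
      map_smul' := fun _ _ => rfl }
  have hT : Continuous T := T.continuous_of_finiteDimensional
  have hTx : T (fun ij => x ij.1 ij.2) = x.submatrix e id := rfl
  rw [← hTx] at hev
  have := mvPolynomial_eq_zero_of_eventually (MvPolynomial.map (algebraMap ℚ ℂ) f) _ (by
    filter_upwards [hT.continuousAt.eventually hev] with y hy
    rw [evalPoly_eq_eval] at hy
    rw [← hy]
    have hTy : (fun ij : Fin (m + n) × (Fin m ⊕ Fin n) =>
        Matrix.submatrix (T y) e.symm id ij.1 ij.2) = y := by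
      ext ij
      change y (e (e.symm ij.1), ij.2) = y ij
      rw [Equiv.apply_symm_apply]
    rw [hTy])
  exact (MvPolynomial.map_injective _ (algebraMap ℚ ℂ).injective) (by rw [this, map_zero])

end Density

end

noncomputable section

section Invariant

variable {K : Subfield ℂ} {W : Type*} [AddCommGroup W] [Module ℂ W]

theorem toSquareBlock_mul_of_lower {J : Type*} [Fintype J] [DecidableEq J] {b : J → ℕ}
    {C A : Matrix J J ℂ} (hC : ∀ i j, b i < b j → C i j = 0) (hA : ∀ i j, b i < b j → A i j = 0)
    (μ : ℕ) : (C * A).toSquareBlock b μ = C.toSquareBlock b μ * A.toSquareBlock b μ := by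
  ext i j
  rw [Matrix.toSquareBlock_def, Matrix.of_apply, Matrix.mul_apply, Matrix.mul_apply,
    ← Fintype.sum_subtype_add_sum_subtype fun l => b l = μ]
  have : ∑ l : {l // ¬ b l = μ}, C i l * A l j = 0 := by
    refine Finset.sum_eq_zero fun l _ => ?_
    rcases lt_or_gt_of_ne l.2 with h | h
    · rw [hA l j (by rw [j.2]; exact h), mul_zero]
    · rw [hC i l (by rw [i.2]; exact h), zero_mul]
  rw [this, add_zero]
  rfl

theorem det_toSquareBlock_ne_zero {J : Type*} [Fintype J] [DecidableEq J] {b : J → ℕ}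
    {C : Matrix J J ℂ} (hC : ∀ i j, b i < b j → C i j = 0) (hu : C.det ≠ 0) (μ : ℕ) :
    (C.toSquareBlock b μ).det ≠ 0 := by
  have hb : C.BlockTriangular (OrderDual.toDual ∘ b) := fun i j hij => hC i j hij
  by_cases hμ : ∃ i, b i = μ
  · intro h0
    apply hu
    obtain ⟨i, rfl⟩ := hμ
    rw [hb.det]
    exact Finset.prod_eq_zero (Finset.mem_image_of_mem _ (Finset.mem_univ i)) h0
  · have : IsEmpty {i // b i = μ} := ⟨fun i => hμ ⟨i, i.2⟩⟩
    rw [Matrix.det_isEmpty]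
    exact one_ne_zero

theorem det_toSquareBlock_of_level {J : Type*} [Fintype J] [DecidableEq J] {b : J → ℕ}
    {A : Matrix J J ℂ} (hA : ∀ i j, i ≠ j → ¬ b j < b i → A i j = 0) (μ : ℕ) :
    (A.toSquareBlock b μ).det = ∏ i with b i = μ, A i i := by
  have h := det_of_level (A := A.toSquareBlock b μ) (fun i => (b i : ℤ)) fun l m _ _ =>
    hA l m (fun h => ‹l ≠ m› (Subtype.ext h)) (by simp [l.2, m.2])
  rw [h, Finset.prod_subtype (p := fun i => b i = μ) _ (by simp)]
  rfl

theorem toMatrix_comp_mul_toMatrix {ι J : Type*} [Fintype ι] (b : Module.Basis ι ℂ W)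
    (Θ : W →ₗ[ℂ] W) (v : J → W) : b.toMatrix (Θ ∘ b) * b.toMatrix v = b.toMatrix (Θ ∘ v) := by
  ext i j
  have : Θ (v j) = ∑ l, b.repr (v j) l • Θ (b l) := by
    conv_lhs => rw [← b.sum_repr (v j), map_sum]
    simp only [map_smul]
  simp only [Matrix.mul_apply, Module.Basis.toMatrix_apply, Function.comp_apply, this, map_sum,
    map_smul, Finsupp.finsetSum_apply, Finsupp.smul_apply, smul_eq_mul, mul_comm]

/-- The value of a relative invariant of degrees `a` at a period matrix, in terms of a rational
basis `Ω₀` and a Hodge basis `Hb` of the same space which agree modulo higher blocks up to the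
factors `lam`, and of a rational basis `w` of eigenvectors of the involution `Θ`.  The period matrix
is `p G h`, where `p` is lower block triangular with diagonal blocks of determinant `∏ lam` up to
`K`, `h` consists of the blocks `Hp` and `Hm`, and `G` is the matrix of `w` in the basis `Hb`. -/
theorem evalPoly_eqUpTo {m n t : ℕ} {s a : ℕ → ℕ} {kp km : ℕ}
    {f : MvPolynomial (Fin (m + n) × (Fin m ⊕ Fin n)) ℚ} (hf0 : f ≠ 0)
    (hf : IsOfType t s a kp km f) (Ω Ω₀ Hb : Module.Basis (Fin (m + n)) ℂ W)
    (hC : ∀ l i, Ω.repr (Ω₀ l) i ∈ K)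
    (hCb : ∀ i l : Fin (m + n), blockIndex t s i < blockIndex t s l → Ω.repr (Ω₀ l) i = 0)
    (lam : Fin (m + n) → ℂ)
    (hdiag : ∀ i, Ω₀.repr (Hb i) i = lam i)
    (htri : ∀ i l : Fin (m + n), l ≠ i → ¬ blockIndex t s i < blockIndex t s l →
      Ω₀.repr (Hb i) l = 0)
    (w : Fin m ⊕ Fin n → W) (hwK : ∀ j i, Hb.repr (w j) i ∈ K) (hw : LinearIndependent ℂ w)
    (Θ : W →ₗ[ℂ] W) (hΘ : ∀ x, Θ (Θ x) = x) (t' : ℕ)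
    (hblk : ∀ i j : Fin (m + n), Hb.repr (Θ (Hb j)) i ≠ 0 →
      blockIndex t s i + blockIndex t s j = t')
    (hwp : ∀ j, Θ (w (Sum.inl j)) = w (Sum.inl j)) (hwm : ∀ j, Θ (w (Sum.inr j)) = -w (Sum.inr j))
    (Hp : Matrix (Fin m) (Fin m) ℂ) (Hm : Matrix (Fin n) (Fin n) ℂ)
    (hHp : Hp.det ≠ 0) (hHm : Hm.det ≠ 0)
    (X : Matrix (Fin (m + n)) (Fin m ⊕ Fin n) ℂ)
    (hXp : ∀ i j, X i (Sum.inl j) = Ω.repr (∑ l, Hp l j • w (Sum.inl l)) i)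
    (hXm : ∀ i j, X i (Sum.inr j) = Ω.repr (∑ l, Hm l j • w (Sum.inr l)) i) :
    EqUpTo K (evalPoly f X)
      ((∏ μ ∈ Finset.Icc 1 t,
        (∏ i ∈ Finset.univ.filter fun i : Fin (m + n) => blockIndex t s i = μ, lam i) ^ a μ) *
          Hp.det ^ kp * Hm.det ^ km) := by
  set b : Fin (m + n) → ℕ := fun i => blockIndex t s i with hb
  set C := Ω.toMatrix Ω₀ with hCdef
  set A := Ω₀.toMatrix Hb with hAdef
  set G : Matrix (Fin (m + n)) (Fin m ⊕ Fin n) ℂ := Hb.toMatrix w with hGdef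
  have hCu : IsUnit C := by
    rw [Matrix.isUnit_iff_isUnit_det]
    exact (isUnit_iff_exists.2 ⟨Ω₀.toMatrix Ω, by simp [hCdef], by simp [hCdef]⟩ : IsUnit C).map
      Matrix.detMonoidHom
  have hAu : IsUnit A := isUnit_iff_exists.2 ⟨Hb.toMatrix Ω₀, by simp [hAdef], by simp [hAdef]⟩
  have hX : X = C * A * G * Matrix.fromBlocks Hp 0 0 Hm := by
    rw [Module.Basis.toMatrix_mul_toMatrix, Module.Basis.toMatrix_mul_toMatrix]
    ext i j
    rcases j with j | j
    · simp [hXp, Matrix.mul_apply, Module.Basis.toMatrix_apply, mul_comm]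
    · simp [hXm, Matrix.mul_apply, Module.Basis.toMatrix_apply, mul_comm]
  have hCl : ∀ i j, b i < b j → C i j = 0 := fun i j hij => hCb i j hij
  have hAl : ∀ i j, b i < b j → A i j = 0 := fun i j hij =>
    htri j i (by rintro rfl; exact lt_irrefl _ hij) (not_lt.2 hij.le)
  have hCA : ∀ i j, b i < b j → (C * A) i j = 0 := by
    intro i j hij
    rw [Matrix.mul_apply]
    refine Finset.sum_eq_zero fun l _ => ?_
    rcases lt_or_ge (b i) (b l) with h | h
    · rw [hCl i l h, zero_mul]
    · rw [hAl l j (h.trans_lt hij), mul_zero]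
  rw [hX, hf (C * A) hCA (hCu.mul hAu) Hp Hm ((Matrix.isUnit_iff_isUnit_det _).2 hHp.isUnit)
    ((Matrix.isUnit_iff_isUnit_det _).2 hHm.isUnit)]
  -- `f G` belongs to `K`, and it is nonzero because the columns of `G` are eigenvectors
  have hGK : evalPoly f G ∈ K := by
    rw [evalPoly, MvPolynomial.aeval_def, MvPolynomial.eval₂_eq]
    refine K.sum_mem fun d _ => K.mul_mem ?_ (K.prod_mem fun i _ => K.pow_mem (hwK _ _) _)
    rw [eq_ratCast]
    exact SubfieldClass.ratCast_mem K _
  have hGu : IsUnit (G.submatrix finSumFinEquiv id) := by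
    rw [← Matrix.mulVec_injective_iff_isUnit]
    intro x y hxy
    have h1 : ∀ z : Fin m ⊕ Fin n → ℂ, ∀ i, (G.submatrix finSumFinEquiv id).mulVec z i =
        Hb.repr (∑ j, z j • w j) (finSumFinEquiv i) := by
      intro z i
      simp [Matrix.mulVec, dotProduct, hGdef, Module.Basis.toMatrix_apply, mul_comm]
    have h2 : ∑ j, x j • w j = ∑ j, y j • w j := by
      apply Hb.repr.injective
      ext i
      have h3 := congrFun hxy (finSumFinEquiv.symm i)
      rw [h1, h1] at h3
      simpa using h3
    have h4 := Fintype.linearIndependent_iff.1 hw (x - y) (by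
      simp only [Pi.sub_apply, sub_smul, Finset.sum_sub_distrib, h2, sub_self])
    ext j
    exact sub_eq_zero.1 (h4 j)
  have hG0 : evalPoly f G ≠ 0 := by
    refine evalPoly_ne_zero hf0 hf G hGu (Hb.toMatrix (Θ ∘ Hb)) ?_ t' hblk ?_
    · rw [toMatrix_comp_mul_toMatrix, ← Module.Basis.toMatrix_self Hb]
      congr 1
      ext j
      exact hΘ _
    · rw [toMatrix_comp_mul_toMatrix]
      ext i j
      rcases j with j | j
      · simp [Matrix.mul_apply, Module.Basis.toMatrix_apply, hwp, hGdef, Matrix.one_apply]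
      · simp [Matrix.mul_apply, Module.Basis.toMatrix_apply, hwm, hGdef, Matrix.one_apply]
  have hblock : ∀ μ, ((C * A).toSquareBlock b μ).det =
      (C.toSquareBlock b μ).det * ∏ i : Fin (m + n) with b i = μ, lam i := by
    intro μ
    rw [toSquareBlock_mul_of_lower hCl hAl, Matrix.det_mul,
      det_toSquareBlock_of_level (A := A) fun i j hij hlt => htri j i hij hlt]
    congr 1
    exact Finset.prod_congr rfl fun i _ => hdiag i
  have hprod : ∏ μ ∈ Finset.Icc 1 t, ((C * A).toSquareBlock b μ).det ^ a μ =
      (∏ μ ∈ Finset.Icc 1 t, (C.toSquareBlock b μ).det ^ a μ) *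
        ∏ μ ∈ Finset.Icc 1 t, (∏ i with b i = μ, lam i) ^ a μ := by
    rw [← Finset.prod_mul_distrib]
    exact Finset.prod_congr rfl fun μ _ => by rw [hblock, mul_pow]
  refine ⟨(∏ μ ∈ Finset.Icc 1 t, (C.toSquareBlock b μ).det ^ a μ) * evalPoly f G,
    K.mul_mem (K.prod_mem fun μ _ => K.pow_mem (det_mem_subfield fun i j => hC _ _) _) hGK,
    mul_ne_zero (Finset.prod_ne_zero_iff.2 fun μ _ => pow_ne_zero _
      (det_toSquareBlock_ne_zero hCl ((Matrix.isUnit_iff_isUnit_det _).1 hCu).ne_zero μ)) hG0, ?_⟩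
  change (∏ μ ∈ Finset.Icc 1 t, ((C * A).toSquareBlock b μ).det ^ a μ) * _ * _ * _ = _
  rw [hprod]
  ring

end Invariant

end

noncomputable section

/-! ### Rational forms of extensions of scalars -/

section KForm

variable {K : Subfield ℂ} {W : Type*} [AddCommGroup W] [Module ℂ W] {ι : Type*}

theorem mem_span_subfield_image_iff [Finite ι] (b : Module.Basis ι ℂ W) (A : Set ι) (x : W) :
    x ∈ Submodule.span K (b '' A) ↔ (∀ i, b.repr x i ∈ K) ∧ ∀ i, i ∉ A → b.repr x i = 0 := by
  have := Fintype.ofFinite ι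
  constructor
  · intro h
    refine ⟨(mem_span_subfield_iff b x).1 (Submodule.span_mono (Set.image_subset_range _ _) h),
      (mem_span_image_iff_repr b A x).1 ?_⟩
    rw [← span_complex_span_subfield K]
    exact Submodule.subset_span h
  · rintro ⟨h1, h2⟩
    rw [← b.sum_repr x]
    refine Submodule.sum_mem _ fun i _ => ?_
    by_cases hi : i ∈ A
    · exact Submodule.smul_mem _ (⟨_, h1 i⟩ : K) (Submodule.subset_span ⟨i, hi, rfl⟩)
    · rw [h2 i hi, zero_smul]
      exact Submodule.zero_mem _

variable {R : Type*} [CommRing R] {V V' : Type*} [AddCommGroup V] [Module R V] [AddCommGroup V']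
  [Module R V']

/-- The submodule of the `v` such that `1 ⊗ v` belongs to a given `K`-subspace, when the ring acts
through `K`. -/
def Ext.comapOf {f : R →+* ℂ} (hf : ∀ r, f r ∈ K) (T : Submodule K (Ext f V)) : Submodule R V where
  carrier := {v | Ext.of f v ∈ T}
  add_mem' {a b} ha hb := by
    change Ext.of f (a + b) ∈ T
    rw [map_add]
    exact T.add_mem ha hb
  zero_mem' := by
    change Ext.of f (0 : V) ∈ T
    rw [map_zero]
    exact T.zero_mem
  smul_mem' r v hv := by
    change Ext.of f (r • v) ∈ T
    rw [map_smulₛₗ]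
    exact T.smul_mem (⟨f r, hf r⟩ : K) hv

theorem Ext.mem_comapOf {f : R →+* ℂ} (hf : ∀ r, f r ∈ K) (T : Submodule K (Ext f V)) {v : V} :
    v ∈ Ext.comapOf hf T ↔ Ext.of f v ∈ T :=
  Iff.rfl

/-- If `R` acts through `K`, the `K`-form of an `R`-submodule is spanned by the images of
generators. -/
theorem Ext.span_of_span {f : R →+* ℂ} (hf : ∀ r, f r ∈ K) (S : Set V) :
    Submodule.span K (Ext.of f '' (Submodule.span R S : Set V)) =
      Submodule.span K (Ext.of f '' S) := by
  refine le_antisymm ?_ (Submodule.span_mono (Set.image_mono Submodule.subset_span))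
  rw [Submodule.span_le]
  rintro _ ⟨v, hv, rfl⟩
  have : Submodule.span R S ≤ Ext.comapOf hf (Submodule.span K (Ext.of f '' S)) :=
    Submodule.span_le.2 fun s hs => Submodule.subset_span ⟨s, hs, rfl⟩
  exact this hv

theorem Ext.tensorEquiv_symm_mem_span {f : R →+* ℂ} {P : Set V} {P' : Set V'} {x : Ext f V}
    {y : Ext f V'} (hx : x ∈ Submodule.span K (Ext.of f '' P))
    (hy : y ∈ Submodule.span K (Ext.of f '' P')) :
    (Ext.tensorEquiv f V V').symm (x ⊗ₜ y) ∈
      Submodule.span K (Ext.of f '' Set.image2 (fun v w => v ⊗ₜ[R] w) P P') := by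
  induction hx, hy using Submodule.span_induction₂ with
  | mem_mem x y hx hy =>
    obtain ⟨v, hv, rfl⟩ := hx
    obtain ⟨w, hw, rfl⟩ := hy
    rw [← Ext.tensorEquiv_of, LinearEquiv.symm_apply_apply]
    exact Submodule.subset_span ⟨_, ⟨v, hv, w, hw, rfl⟩, rfl⟩
  | zero_left y hy => rw [TensorProduct.zero_tmul, map_zero]; exact Submodule.zero_mem _
  | zero_right x hx => rw [TensorProduct.tmul_zero, map_zero]; exact Submodule.zero_mem _
  | add_left x y z _ _ _ h1 h2 =>
    rw [TensorProduct.add_tmul, map_add]; exact Submodule.add_mem _ h1 h2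
  | add_right x y z _ _ _ h1 h2 =>
    rw [TensorProduct.tmul_add, map_add]; exact Submodule.add_mem _ h1 h2
  | smul_left r x y _ _ h =>
    rw [show r • x = (r : ℂ) • x from rfl, ← TensorProduct.smul_tmul', map_smul]
    exact Submodule.smul_mem _ r h
  | smul_right r x y _ _ h =>
    rw [show r • y = (r : ℂ) • y from rfl, TensorProduct.tmul_smul, map_smul]
    exact Submodule.smul_mem _ r h

end KForm

/-! ### Tensor products of realizations -/

namespace Realization

variable {E F : Type*} [Field E] [CharZero E] [Field F] [CharZero F] (M N : Realization E F)
  (σ : E →+* ℂ) (κ : F →+* ℂ)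

/-- The product `H_dR(M) × H_dR(N) → H_dR(M ⊗ N)`. -/
def deRhamMul : M.HdR →ₗ[E ⊗[ℚ] F] N.HdR →ₗ[E ⊗[ℚ] F] (M.tensor N).HdR :=
  TensorProduct.mk (E ⊗[ℚ] F) M.HdR N.HdR

/-- The product `H_B(M_κ) × H_B(N_κ) → H_B((M ⊗ N)_κ)`. -/
def bettiMul : M.HB κ →ₗ[E] N.HB κ →ₗ[E] (M.tensor N).HB κ :=
  TensorProduct.mk E (M.HB κ) (N.HB κ)

/-- The complex de Rham components of a tensor product. -/
def deRhamTensor : Ext (embTensor σ κ) M.HdR ⊗[ℂ] Ext (embTensor σ κ) N.HdR ≃ₗ[ℂ]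
    Ext (embTensor σ κ) (M.tensor N).HdR :=
  (Ext.tensorEquiv (embTensor σ κ) M.HdR N.HdR).symm

/-- The complex Betti components of a tensor product. -/
def bettiTensor : Ext σ (M.HB κ) ⊗[ℂ] Ext σ (N.HB κ) ≃ₗ[ℂ] Ext σ ((M.tensor N).HB κ) :=
  (Ext.tensorEquiv σ (M.HB κ) (N.HB κ)).symm

theorem deRhamTensor_of (x : M.HdR) (y : N.HdR) :
    M.deRhamTensor N σ κ (Ext.of (embTensor σ κ) x ⊗ₜ Ext.of (embTensor σ κ) y) =
      Ext.of (embTensor σ κ) (M.deRhamMul N x y) :=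
  (LinearEquiv.symm_apply_eq _).2 (Ext.tensorEquiv_of ..).symm

theorem bettiTensor_of (x : M.HB κ) (y : N.HB κ) :
    M.bettiTensor N σ κ (Ext.of σ x ⊗ₜ Ext.of σ y) = Ext.of σ (M.bettiMul N κ x y) :=
  (LinearEquiv.symm_apply_eq _).2 (Ext.tensorEquiv_of ..).symm

theorem comp_bettiTensor (x : Ext σ (M.HB κ)) (y : Ext σ (N.HB κ)) :
    (M.tensor N).comp σ κ (M.bettiTensor N σ κ (x ⊗ₜ y)) =
      M.deRhamTensor N σ κ (M.comp σ κ x ⊗ₜ N.comp σ κ y) := by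
  have key : ∀ z, (M.tensor N).comp σ κ z = M.deRhamTensor N σ κ
      (TensorProduct.congr (M.comp σ κ) (N.comp σ κ) (Ext.tensorEquiv σ (M.HB κ) (N.HB κ) z)) :=
    fun _ => rfl
  refine (key _).trans (congrArg (M.deRhamTensor N σ κ) ?_)
  refine (congrArg _ ((Ext.tensorEquiv σ (M.HB κ) (N.HB κ)).apply_symm_apply _)).trans ?_
  exact TensorProduct.congr_tmul ..

theorem map_bettiTensor {κ κ' : F →+* ℂ} (h : κ' = conjugate κ) (x : Ext σ (M.HB κ))
    (y : Ext σ (N.HB κ)) :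
    Ext.map σ ((M.tensor N).Finf κ κ' h) (M.bettiTensor N σ κ (x ⊗ₜ y)) =
      M.bettiTensor N σ κ' (Ext.map σ (M.Finf κ κ' h) x ⊗ₜ Ext.map σ (N.Finf κ κ' h) y) :=
  Ext.map_tensor σ _ _ x y

theorem finf_bettiMul {κ κ' : F →+* ℂ} (h : κ' = conjugate κ) (x : M.HB κ) (y : N.HB κ) :
    (M.tensor N).Finf κ κ' h (M.bettiMul N κ x y) =
      M.bettiMul N κ' (M.Finf κ κ' h x) (N.Finf κ κ' h y) :=
  TensorProduct.map_tmul _ _ x y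

/-- The map `H_dR(M) → H_dR(M_L)`. -/
def deRhamExt {L : Type*} [Field L] [CharZero L] (j : F →+* L) :
    M.HdR →ₛₗ[scalarMap E j] (M.baseChange j).HdR :=
  Ext.of (scalarMap E j)

/-- The complex de Rham components of an extension of scalars. -/
def deRhamBaseChange {L : Type*} [Field L] [CharZero L] (j : F →+* L) (κ : L →+* ℂ) :
    Ext (embTensor σ (κ.comp j)) M.HdR ≃ₗ[ℂ] Ext (embTensor σ κ) (M.baseChange j).HdR :=
  (Ext.transEquiv (scalarMap E j) (embTensor σ κ) (embTensor σ (κ.comp j))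
    (embTensor_comp_scalarMap j σ κ) M.HdR).symm

/-- The products generate `H_dR(M ⊗ N)`. -/
theorem top_le_of_deRhamMul {A : Submodule (E ⊗[ℚ] F) (M.tensor N).HdR}
    (h : ∀ x y, M.deRhamMul N x y ∈ A) : ⊤ ≤ A := by
  refine le_trans (TensorProduct.span_tmul_eq_top (E ⊗[ℚ] F) M.HdR N.HdR).ge
    (Submodule.span_le.2 ?_)
  rintro _ ⟨x, y, rfl⟩
  exact h x y

/-- The products of elements of `Fil^a` and `Fil^{p-a}` generate the step `Fil^p` of the tensor
product. -/
theorem tensor_fil_le {p : ℤ} {A : Submodule (E ⊗[ℚ] F) (M.tensor N).HdR}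
    (h : ∀ a, ∀ x ∈ M.Fil a, ∀ y ∈ N.Fil (p - a), M.deRhamMul N x y ∈ A) :
    (M.tensor N).Fil p ≤ A :=
  iSup_le fun a => Submodule.map₂_le.2 (h a)

theorem deRhamMul_mem_fil {p a : ℤ} {x : M.HdR} {y : N.HdR} (hx : x ∈ M.Fil a)
    (hy : y ∈ N.Fil (p - a)) : M.deRhamMul N x y ∈ (M.tensor N).Fil p :=
  le_iSup (fun a : ℤ => Submodule.map₂ (TensorProduct.mk (E ⊗[ℚ] F) M.HdR N.HdR)
    (M.Fil a) (N.Fil (p - a))) a (Submodule.apply_mem_map₂ _ hx hy)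

variable {σ κ} in
theorem deRhamTensor_mem_span {K : Subfield ℂ} {P : Set M.HdR} {P' : Set N.HdR}
    {x : Ext (embTensor σ κ) M.HdR} {y : Ext (embTensor σ κ) N.HdR}
    (hx : x ∈ Submodule.span K (Ext.of (embTensor σ κ) '' P))
    (hy : y ∈ Submodule.span K (Ext.of (embTensor σ κ) '' P')) :
    M.deRhamTensor N σ κ (x ⊗ₜ y) ∈ Submodule.span K
      (Ext.of (embTensor σ κ) '' Set.image2 (fun v w => M.deRhamMul N v w) P P') :=
  Ext.tensorEquiv_symm_mem_span hx hy

end Realization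

/-! ### Rational and Hodge bases of a system of realizations -/

variable {E F : Type*} [Field E] [CharZero E] [Field F] [CharZero F]

/-- Compatible bases of the `σ`-components at the embedding `κ` of a system of realizations:

* a complex basis `ω` of the de Rham component which is a `K`-basis of its rational form, adapted to
  the Hodge filtration; `lev i` is the step of the filtration at which `ω i` appears;
* a complex basis `h` of the Betti component, consisting of vectors of pure Hodge type, such that
  `h i` corresponds to `lam i • ω i` modulo the higher steps of the filtration. -/
structure Frame (R : Realization E F) (σ : E →+* ℂ) (κ : F →+* ℂ) (K : Subfield ℂ) (ι : Type)
    [Fintype ι] where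
  mem : ∀ x, embTensor σ κ x ∈ K
  ω : Module.Basis ι ℂ (Ext (embTensor σ κ) R.HdR)
  h : Module.Basis ι ℂ (Ext σ (R.HB κ))
  lam : ι → ℂ
  lam_ne : ∀ i, lam i ≠ 0
  lev : ι → ℤ
  top_eq : Submodule.span K (Set.range (Ext.of (embTensor σ κ) (V := R.HdR))) =
    Submodule.span K (Set.range ω)
  fil_eq : ∀ p, Submodule.span K (Ext.of (embTensor σ κ) '' (R.Fil p : Set R.HdR)) =
    Submodule.span K (ω '' {i | p ≤ lev i})
  diag : ∀ i, ω.repr (R.comp σ κ (h i)) i = lam i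
  tri : ∀ i l, l ≠ i → ¬ lev i < lev l → ω.repr (R.comp σ κ (h i)) l = 0

namespace Frame

variable {σ : E →+* ℂ} {κ : F →+* ℂ} {K : Subfield ℂ} {ι ι' : Type} [Fintype ι] [Fintype ι']

/-- The de Rham basis of a tensor product. -/
def tensorω {M N : Realization E F} (m : Frame M σ κ K ι) (n : Frame N σ κ K ι') :
    Module.Basis (ι × ι') ℂ (Ext (embTensor σ κ) (M.tensor N).HdR) :=
  (m.ω.tensorProduct n.ω).map (M.deRhamTensor N σ κ)

theorem tensorω_repr {M N : Realization E F} (m : Frame M σ κ K ι) (n : Frame N σ κ K ι')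
    (x : Ext (embTensor σ κ) M.HdR) (y : Ext (embTensor σ κ) N.HdR) (i : ι × ι') :
    (tensorω m n).repr (M.deRhamTensor N σ κ (x ⊗ₜ y)) i = m.ω.repr x i.1 * n.ω.repr y i.2 := by
  rw [tensorω, Module.Basis.map_repr, LinearEquiv.trans_apply, LinearEquiv.symm_apply_apply]
  exact (Module.Basis.tensorProduct_repr_tmul_apply ..).trans (mul_comm _ _)

theorem tensorω_apply {M N : Realization E F} (m : Frame M σ κ K ι) (n : Frame N σ κ K ι')
    (i : ι × ι') : tensorω m n i = M.deRhamTensor N σ κ (m.ω i.1 ⊗ₜ n.ω i.2) := by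
  rw [tensorω, Module.Basis.map_apply]
  exact congrArg _ (Module.Basis.tensorProduct_apply' ..)

theorem tmul_mem_span_tensorω {M N : Realization E F} (m : Frame M σ κ K ι) (n : Frame N σ κ K ι')
    {A : Set ι} {B : Set ι'} {x : Ext (embTensor σ κ) M.HdR} {y : Ext (embTensor σ κ) N.HdR}
    (hx : x ∈ Submodule.span K (m.ω '' A)) (hy : y ∈ Submodule.span K (n.ω '' B)) :
    M.deRhamTensor N σ κ (x ⊗ₜ y) ∈ Submodule.span K (tensorω m n '' (A ×ˢ B)) := by
  rw [mem_span_subfield_image_iff] at hx hy ⊢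
  refine ⟨fun i => ?_, fun i hi => ?_⟩
  · rw [tensorω_repr]
    exact K.mul_mem (hx.1 _) (hy.1 _)
  · rw [tensorω_repr]
    by_cases h1 : i.1 ∈ A
    · rw [hy.2 i.2 fun h2 => hi ⟨h1, h2⟩, mul_zero]
    · rw [hx.2 i.1 h1, zero_mul]

/-- The Hodge basis of a tensor product. -/
def tensorh {M N : Realization E F} (m : Frame M σ κ K ι) (n : Frame N σ κ K ι') :
    Module.Basis (ι × ι') ℂ (Ext σ ((M.tensor N).HB κ)) :=
  (m.h.tensorProduct n.h).map (M.bettiTensor N σ κ)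

theorem tensorh_apply {M N : Realization E F} (m : Frame M σ κ K ι) (n : Frame N σ κ K ι')
    (i : ι × ι') : tensorh m n i = M.bettiTensor N σ κ (m.h i.1 ⊗ₜ n.h i.2) := by
  rw [tensorh, Module.Basis.map_apply]
  exact congrArg _ (Module.Basis.tensorProduct_apply' ..)

theorem tensorh_repr {M N : Realization E F} (m : Frame M σ κ K ι) (n : Frame N σ κ K ι')
    (x : Ext σ (M.HB κ)) (y : Ext σ (N.HB κ)) (i : ι × ι') :
    (tensorh m n).repr (M.bettiTensor N σ κ (x ⊗ₜ y)) i = m.h.repr x i.1 * n.h.repr y i.2 := by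
  rw [tensorh, Module.Basis.map_repr, LinearEquiv.trans_apply, LinearEquiv.symm_apply_apply]
  exact (Module.Basis.tensorProduct_repr_tmul_apply ..).trans (mul_comm _ _)

theorem tensorω_comp_repr {M N : Realization E F} (m : Frame M σ κ K ι) (n : Frame N σ κ K ι')
    (i l : ι × ι') : (tensorω m n).repr ((M.tensor N).comp σ κ (tensorh m n i)) l =
      m.ω.repr (M.comp σ κ (m.h i.1)) l.1 * n.ω.repr (N.comp σ κ (n.h i.2)) l.2 := by
  rw [tensorh_apply, Realization.comp_bettiTensor, tensorω_repr]

/-- The bases of a tensor product: the levels are added and the factors `lam` are multiplied. -/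
def tensor {M N : Realization E F} (m : Frame M σ κ K ι) (n : Frame N σ κ K ι') :
    Frame (M.tensor N) σ κ K (ι × ι') where
  mem := m.mem
  ω := tensorω m n
  h := tensorh m n
  lam i := m.lam i.1 * n.lam i.2
  lam_ne i := mul_ne_zero (m.lam_ne _) (n.lam_ne _)
  lev i := m.lev i.1 + n.lev i.2
  top_eq := by
    have hω : ∀ i, m.ω i ∈ Submodule.span K (Ext.of (embTensor σ κ) '' (Set.univ : Set M.HdR)) :=
      fun i => by
        rw [Set.image_univ, m.top_eq]
        exact Submodule.subset_span ⟨i, rfl⟩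
    have hω' : ∀ i, n.ω i ∈ Submodule.span K (Ext.of (embTensor σ κ) '' (Set.univ : Set N.HdR)) :=
      fun i => by
        rw [Set.image_univ, n.top_eq]
        exact Submodule.subset_span ⟨i, rfl⟩
    apply le_antisymm
    · rw [Submodule.span_le]
      rintro _ ⟨t, rfl⟩
      have key : (⊤ : Submodule (E ⊗[ℚ] F) (M.tensor N).HdR) ≤
          Ext.comapOf m.mem (Submodule.span K (Set.range (tensorω m n))) := by
        refine M.top_le_of_deRhamMul N fun x y => ?_
        rw [Ext.mem_comapOf, ← Realization.deRhamTensor_of, ← Set.image_univ, ← Set.univ_prod_univ]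
        refine tmul_mem_span_tensorω m n ?_ ?_
        · rw [Set.image_univ, ← m.top_eq]
          exact Submodule.subset_span ⟨x, rfl⟩
        · rw [Set.image_univ, ← n.top_eq]
          exact Submodule.subset_span ⟨y, rfl⟩
      exact key (Submodule.mem_top (x := t))
    · rw [Submodule.span_le]
      rintro _ ⟨i, rfl⟩
      rw [tensorω_apply]
      exact Submodule.span_mono (Set.image_subset_range _ _)
        (M.deRhamTensor_mem_span N (hω i.1) (hω' i.2))
  fil_eq p := by
    apply le_antisymm
    · rw [Submodule.span_le]
      rintro _ ⟨t, ht, rfl⟩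
      have key : (M.tensor N).Fil p ≤ Ext.comapOf m.mem (Submodule.span K
          (tensorω m n '' {i | p ≤ m.lev i.1 + n.lev i.2})) := by
        refine M.tensor_fil_le N fun a x hx y hy => ?_
        rw [Ext.mem_comapOf, ← Realization.deRhamTensor_of]
        have h1 : Ext.of (embTensor σ κ) x ∈ Submodule.span K (m.ω '' {i | a ≤ m.lev i}) := by
          rw [← m.fil_eq]
          exact Submodule.subset_span ⟨x, hx, rfl⟩
        have h2 : Ext.of (embTensor σ κ) y ∈ Submodule.span K (n.ω '' {i | p - a ≤ n.lev i}) := by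
          rw [← n.fil_eq]
          exact Submodule.subset_span ⟨y, hy, rfl⟩
        refine Submodule.span_mono (Set.image_mono ?_) (tmul_mem_span_tensorω m n h1 h2)
        rintro i ⟨hi, hi'⟩
        simp only [Set.mem_ofPred_eq] at hi hi' ⊢
        lia
      exact key ht
    · rw [Submodule.span_le]
      rintro _ ⟨i, hi, rfl⟩
      rw [tensorω_apply]
      have h1 : m.ω i.1 ∈ Submodule.span K
          (Ext.of (embTensor σ κ) '' (M.Fil (m.lev i.1) : Set M.HdR)) := by
        rw [m.fil_eq]
        exact Submodule.subset_span ⟨i.1, le_refl (m.lev i.1), rfl⟩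
      have h2 : n.ω i.2 ∈ Submodule.span K
          (Ext.of (embTensor σ κ) '' (N.Fil (p - m.lev i.1) : Set N.HdR)) := by
        rw [n.fil_eq]
        refine Submodule.subset_span ⟨i.2, ?_, rfl⟩
        simp only [Set.mem_ofPred_eq] at hi ⊢
        lia
      refine Submodule.span_mono (Set.image_mono ?_) (M.deRhamTensor_mem_span N h1 h2)
      rintro _ ⟨x, hx, y, hy, rfl⟩
      exact M.deRhamMul_mem_fil N hx hy
  diag i := by
    rw [tensorω_comp_repr, m.diag, n.diag]
  tri i l hil hlt := by
    rw [tensorω_comp_repr]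
    by_cases h1 : m.ω.repr (M.comp σ κ (m.h i.1)) l.1 = 0
    · rw [h1, zero_mul]
    by_cases h2 : n.ω.repr (N.comp σ κ (n.h i.2)) l.2 = 0
    · rw [h2, mul_zero]
    exfalso
    by_cases e1 : l.1 = i.1
    · by_cases e2 : l.2 = i.2
      · exact hil (Prod.ext e1 e2)
      · have := not_imp_comm.1 (n.tri i.2 l.2 e2) h2
        rw [e1] at hlt
        lia
    · have h3 := not_imp_comm.1 (m.tri i.1 l.1 e1) h1
      by_cases e2 : l.2 = i.2
      · rw [e2] at hlt
        lia
      · have := not_imp_comm.1 (n.tri i.2 l.2 e2) h2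
        lia

/-- The `K`-forms of the subspaces of `H_dR(M_L)` generated by subsets of `H_dR(M)`. -/
theorem baseChange_span {L : Type*} [Field L] [CharZero L] {M : Realization E F} {j : F →+* L}
    {κ : L →+* ℂ} (hK : ∀ x, embTensor σ κ x ∈ K) (A : Set M.HdR) :
    Submodule.span K (Ext.of (embTensor σ κ) '' (Submodule.span (E ⊗[ℚ] L)
      (M.deRhamExt j '' A) : Set (M.baseChange j).HdR)) =
    (Submodule.span K (Ext.of (embTensor σ (κ.comp j)) '' A)).map
      ((M.deRhamBaseChange σ j κ).restrictScalars K).toLinearMap := by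
  rw [Ext.span_of_span hK, Submodule.map_span, ← Set.image_comp, ← Set.image_comp]
  congr 1

/-- The bases of an extension of scalars along `j`, at an embedding `κ` of the larger field: they
are those of the original system at `κ ∘ j`. -/
def baseChange {L : Type*} [Field L] [CharZero L] {M : Realization E F} {j : F →+* L}
    {κ : L →+* ℂ} (m : Frame M σ (κ.comp j) K ι) (hK : ∀ x, embTensor σ κ x ∈ K) :
    Frame (M.baseChange j) σ κ K ι where
  mem := hK
  ω := m.ω.map (M.deRhamBaseChange σ j κ)
  h := m.h
  lam := m.lam
  lam_ne := m.lam_ne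
  lev := m.lev
  top_eq := by
    have h := baseChange_span (M := M) (j := j) hK (κ := κ) Set.univ
    rw [Set.image_univ, Set.image_univ, m.top_eq, Submodule.map_span, ← Set.range_comp,
      show Submodule.span (E ⊗[ℚ] L) (Set.range (M.deRhamExt j)) = ⊤ from
        Ext.span_range_of (scalarMap E j) M.HdR, Submodule.top_coe, Set.image_univ] at h
    rw [h]
    rw [Module.Basis.coe_map]
    rfl
  fil_eq p := by
    refine (baseChange_span hK (M.Fil p : Set M.HdR)).trans ?_
    rw [m.fil_eq, Submodule.map_span, ← Set.image_comp]
    rw [Module.Basis.coe_map]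
    rfl
  diag i := by
    rw [Module.Basis.map_repr, LinearEquiv.trans_apply]
    refine (congrArg (fun z => m.ω.repr z i) ?_).trans (m.diag i)
    exact LinearEquiv.symm_apply_apply (M.deRhamBaseChange σ j κ) _
  tri i l hil hlt := by
    rw [Module.Basis.map_repr, LinearEquiv.trans_apply]
    refine (congrArg (fun z => m.ω.repr z l) ?_).trans (m.tri i l hil hlt)
    exact LinearEquiv.symm_apply_apply (M.deRhamBaseChange σ j κ) _

end Frame

end

noncomputable section

/-! ### The Betti and de Rham spaces of an archimedean place -/

variable {E F : Type*} [Field E] [CharZero E] [Field F] [CharZero F]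

instance (τ : F →+* ℂ) : Fintype (Place τ) := Fintype.ofFinite _

instance (τ : F →+* ℂ) : DecidableEq (Place τ) := Classical.decEq _

theorem Place.conj_conj {F : Type*} [Field F] {τ : F →+* ℂ} (κ : Place τ) : κ.conj.conj = κ :=
  Subtype.ext (involutive_conjugate F κ.1)

namespace Realization

variable (R : Realization E F) (σ : E →+* ℂ) (τ : F →+* ℂ)

/-- The complex Betti space `⊕_{κ ∈ {τ,ρτ}} H_B(M_κ) ⊗_{E,σ} ℂ`. -/
abbrev BettiC := ∀ κ : Place τ, Ext σ (R.HB κ.1)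

/-- The complex linear extension of the involution `frob`. -/
def frobC : R.BettiC σ τ →ₗ[ℂ] R.BettiC σ τ :=
  LinearMap.pi fun κ =>
    Ext.map σ (R.Finf κ.conj.1 κ.1 (involutive_conjugate F κ.1).symm) ∘ₗ LinearMap.proj κ.conj

/-- The canonical semilinear map from the Betti space to the complex Betti space. -/
def bettiOf : R.Betti τ →ₛₗ[σ] R.BettiC σ τ where
  toFun x κ := Ext.of σ (x κ)
  map_add' x y := by ext κ; exact map_add (Ext.of σ) _ _
  map_smul' a x := by ext κ; exact map_smulₛₗ (Ext.of σ) _ _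

/-- The comparison isomorphism between the complex Betti and de Rham spaces. -/
def compC : R.BettiC σ τ ≃ₗ[ℂ] R.DRC σ τ :=
  LinearEquiv.piCongrRight fun κ => R.comp σ κ.1

variable {σ τ}

theorem compC_bettiOf (x : R.Betti τ) : R.compC σ τ (R.bettiOf σ τ x) = R.periodMap σ τ x := rfl

theorem frobC_bettiOf (x : R.Betti τ) :
    R.frobC σ τ (R.bettiOf σ τ x) = R.bettiOf σ τ (R.frob τ x) := by
  ext κ
  exact Ext.map_of _ _ _

theorem map_finf_finf {κ κ' : F →+* ℂ} (h : κ' = conjugate κ) (h' : κ = conjugate κ')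
    (x : Ext σ (R.HB κ)) : Ext.map σ (R.Finf κ' κ h') (Ext.map σ (R.Finf κ κ' h) x) = x := by
  have : Ext.map σ (R.Finf κ' κ h') ∘ₗ Ext.map σ (R.Finf κ κ' h) = LinearMap.id :=
    Ext.hom_ext fun v => by
      rw [LinearMap.comp_apply, Ext.map_of, Ext.map_of, R.Finf_Finf, LinearMap.id_apply]
  exact LinearMap.congr_fun this x

theorem frob_frob (x : R.Betti τ) : R.frob τ (R.frob τ x) = x := by
  ext κ
  have key : ∀ κ'' : Place τ, ∀ h : κ'' = κ, ∀ h1 : κ.conj.1 = conjugate κ''.1,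
      R.Finf κ.conj.1 κ.1 (involutive_conjugate F κ.1).symm
        (R.Finf κ''.1 κ.conj.1 h1 (x κ'')) = x κ := by
    rintro _ rfl h1
    exact R.Finf_Finf _ _ _ _ _
  exact key κ.conj.conj κ.conj_conj _

theorem span_range_bettiOf : Submodule.span ℂ (Set.range (R.bettiOf σ τ)) = ⊤ := by
  rw [eq_top_iff]
  intro x _
  have : x = ∑ κ, Pi.single κ (x κ) := (Finset.univ_sum_single x).symm
  rw [this]
  refine Submodule.sum_mem _ fun κ _ => ?_
  have h2 : ∀ y : Ext σ (R.HB κ.1), (Pi.single κ y : R.BettiC σ τ) ∈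
      Submodule.span ℂ (Set.range (R.bettiOf σ τ)) := by
    intro y
    have hy : y ∈ Submodule.span ℂ (Set.range (Ext.of σ (V := R.HB κ.1))) := by
      rw [Ext.span_range_of]; trivial
    induction hy using Submodule.span_induction with
    | mem y hy =>
      obtain ⟨v, rfl⟩ := hy
      refine Submodule.subset_span ⟨Pi.single κ v, ?_⟩
      ext κ'
      by_cases h : κ' = κ
      · subst h
        simp [bettiOf]
      · simp [bettiOf, h]
    | zero => simp
    | add y z _ _ hy hz => rw [Pi.single_add]; exact Submodule.add_mem _ hy hz
    | smul a y _ hy => rw [Pi.single_smul]; exact Submodule.smul_mem _ a hy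
  exact h2 _

theorem frobC_frobC (x : R.BettiC σ τ) : R.frobC σ τ (R.frobC σ τ x) = x := by
  have : R.frobC σ τ ∘ₗ R.frobC σ τ = LinearMap.id :=
    LinearMap.ext_on_range (v := R.bettiOf σ τ) R.span_range_bettiOf fun v => by
      rw [LinearMap.comp_apply, frobC_bettiOf, frobC_bettiOf, frob_frob, LinearMap.id_apply]
  exact LinearMap.congr_fun this x

theorem mem_bettiSign {ε : ℤˣ} {x : R.Betti τ} :
    x ∈ R.bettiSign τ ε ↔ R.frob τ x = ((ε : ℤ) : E) • x :=
  Module.End.mem_eigenspace_iff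

end Realization

/-! ### Families of bases at a place -/

/-- Rational and Hodge bases at the embeddings of a place, such that the maps `F_∞` permute the
vectors of the Hodge bases up to sign: `F_∞` maps `h m` to `± h (bar m)`. -/
structure FrameFamily (R : Realization E F) (σ : E →+* ℂ) (τ : F →+* ℂ) (K : Subfield ℂ) (ι : Type)
    [Fintype ι] where
  fr : ∀ κ : Place τ, Frame R σ κ.1 K ι
  bar : ι → ι
  bar_bar : ∀ m, bar (bar m) = m
  sgn : ι → ℤˣ
  finf_h : ∀ (κ κ' : Place τ) (h : κ'.1 = conjugate κ.1) (m : ι),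
    Ext.map σ (R.Finf κ.1 κ'.1 h) ((fr κ).h m) = ((sgn m : ℤ) : ℂ) • (fr κ').h (bar m)

namespace FrameFamily

variable {R : Realization E F} {σ : E →+* ℂ} {τ : F →+* ℂ} {K : Subfield ℂ} {ι : Type} [Fintype ι]
  (fam : FrameFamily R σ τ K ι)

/-- The rational basis of the complex de Rham space of the place. -/
def ratBasis : Module.Basis (Σ _ : Place τ, ι) ℂ (R.DRC σ τ) :=
  Pi.basis fun κ => (fam.fr κ).ω

/-- The Hodge basis of the complex de Rham space of the place. -/
def hodgeBasis : Module.Basis (Σ _ : Place τ, ι) ℂ (R.DRC σ τ) :=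
  Pi.basis fun κ => (fam.fr κ).h.map (R.comp σ κ.1)

theorem ratBasis_repr (x : R.DRC σ τ) (i : Σ _ : Place τ, ι) :
    fam.ratBasis.repr x i = (fam.fr i.1).ω.repr (x i.1) i.2 :=
  Pi.basis_repr _ _ _

theorem hodgeBasis_repr_compC (x : R.BettiC σ τ) (i : Σ _ : Place τ, ι) :
    fam.hodgeBasis.repr (R.compC σ τ x) i = (fam.fr i.1).h.repr (x i.1) i.2 := by
  refine (Pi.basis_repr _ _ _).trans ?_
  rw [Module.Basis.map_repr, LinearEquiv.trans_apply]
  exact congrArg (fun z => (fam.fr i.1).h.repr z i.2) (LinearEquiv.symm_apply_apply _ _)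

theorem hodgeBasis_apply (i : Σ _ : Place τ, ι) :
    fam.hodgeBasis i = Pi.single i.1 (R.comp σ i.1.1 ((fam.fr i.1).h i.2)) := by
  rw [hodgeBasis, Pi.basis_apply, Module.Basis.map_apply]

theorem ratBasis_repr_hodgeBasis_self (i : Σ _ : Place τ, ι) :
    fam.ratBasis.repr (fam.hodgeBasis i) i = (fam.fr i.1).lam i.2 := by
  rw [ratBasis_repr, hodgeBasis_apply, Pi.single_eq_same, (fam.fr i.1).diag]

theorem ratBasis_repr_hodgeBasis_of_ne {i l : Σ _ : Place τ, ι} (h : l.1 ≠ i.1) :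
    fam.ratBasis.repr (fam.hodgeBasis i) l = 0 := by
  rw [ratBasis_repr, hodgeBasis_apply, Pi.single_eq_of_ne h, map_zero, Finsupp.zero_apply]

theorem ratBasis_repr_hodgeBasis {i l : Σ _ : Place τ, ι} (h : l ≠ i)
    (hlev : ¬ (fam.fr i.1).lev i.2 < (fam.fr l.1).lev l.2) :
    fam.ratBasis.repr (fam.hodgeBasis i) l = 0 := by
  obtain ⟨κ, l⟩ := l
  obtain ⟨κ', i⟩ := i
  by_cases hk : κ = κ'
  · subst hk
    rw [ratBasis_repr, hodgeBasis_apply, Pi.single_eq_same]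
    exact (fam.fr κ).tri i l (fun e => h (by rw [e])) hlev
  · exact fam.ratBasis_repr_hodgeBasis_of_ne hk

/-- The rational form of a family of subspaces spanned, at each embedding, by a part of the rational
basis, is spanned by these parts. -/
theorem ratPart_eq (hK : periodField σ τ = K) {P : Place τ → Submodule (E ⊗[ℚ] F) R.HdR}
    {A : Set (Σ _ : Place τ, ι)}
    (hP : ∀ κ, Submodule.span K (Ext.of (embTensor σ κ.1) '' (P κ : Set R.HdR)) =
      Submodule.span K ((fam.fr κ).ω '' {i | (⟨κ, i⟩ : Σ _ : Place τ, ι) ∈ A})) :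
    R.ratPart σ τ P = Submodule.span (periodField σ τ) (fam.ratBasis '' A) := by
  subst hK
  ext x
  rw [mem_span_subfield_image_iff]
  simp only [ratBasis_repr, Realization.ratPart, Submodule.mem_pi, Set.mem_univ, forall_true_left]
  simp_rw [hP, mem_span_subfield_image_iff]
  constructor
  · intro h
    exact ⟨fun i => (h i.1).1 i.2, fun i hi => (h i.1).2 i.2 hi⟩
  · rintro ⟨h1, h2⟩ κ
    exact ⟨fun i => h1 ⟨κ, i⟩, fun i hi => h2 ⟨κ, i⟩ hi⟩

theorem deRham_eq (hK : periodField σ τ = K) :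
    R.deRham σ τ = Submodule.span (periodField σ τ) (Set.range fam.ratBasis) := by
  rw [← Set.image_univ]
  refine fam.ratPart_eq hK fun κ => ?_
  simp [(fam.fr κ).top_eq]

theorem deRhamFil_eq (hK : periodField σ τ = K) (p : ℤ) :
    R.deRhamFil σ τ p = Submodule.span (periodField σ τ)
      (fam.ratBasis '' {i | p ≤ (fam.fr i.1).lev i.2}) :=
  fam.ratPart_eq hK fun κ => (fam.fr κ).fil_eq p

end FrameFamily

end

noncomputable section

/-! ### Period matrices in terms of rational and Hodge bases -/

section KForm

variable {K : Subfield ℂ} {W : Type*} [AddCommGroup W] [Module ℂ W] {ι : Type*}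

theorem finrank_span_subfield_image [Finite ι] (b : Module.Basis ι ℂ W) (A : Set ι) :
    Module.finrank K (Submodule.span K (b '' A)) = A.ncard := by
  classical
  have := Fintype.ofFinite ι
  have hli : LinearIndependent K fun i : A => b i :=
    (b.linearIndependent.comp _ Subtype.val_injective).restrict_scalars' K
  have h := finrank_span_eq_card hli
  rw [show Set.range (fun i : A => b i) = b '' A by ext; simp] at h
  rw [h, Set.ncard_eq_toFinset_card', Set.toFinset_card]

end KForm

variable {E F : Type*} [Field E] [CharZero E] [Field F] [CharZero F]

namespace FrameFamily

variable {R : Realization E F} {σ : E →+* ℂ} {τ : F →+* ℂ} {K : Subfield ℂ} {ι : Type} [Fintype ι]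
  (fam : FrameFamily R σ τ K ι)

/-- The number of columns of a period matrix. -/
theorem card_eq (fam : FrameFamily R σ τ K ι) (hK : periodField σ τ = K) (P : R.PeriodMatrix σ τ) :
    P.dp + P.dm = Fintype.card (Σ _ : Place τ, ι) := by
  have h1 := finrank_span_subfield_image (K := periodField σ τ) fam.ratBasis Set.univ
  rw [Set.image_univ, ← fam.deRham_eq hK, Module.finrank_eq_card_basis P.omega, Set.ncard_univ,
    Nat.card_eq_fintype_card, Fintype.card_fin] at h1
  exact h1

/-- The rational basis of a period matrix is a basis of the complex de Rham space. -/
theorem exists_basis (fam : FrameFamily R σ τ K ι) (hK : periodField σ τ = K)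
    (P : R.PeriodMatrix σ τ) :
    ∃ Ω : Module.Basis (Fin (P.dp + P.dm)) ℂ (R.DRC σ τ), (∀ i, Ω i = (P.omega i : R.DRC σ τ)) ∧
      Submodule.span (periodField σ τ) (Set.range Ω) = R.deRham σ τ := by
  have hspanK : Submodule.span (periodField σ τ) (Set.range fun i => (P.omega i : R.DRC σ τ)) =
      R.deRham σ τ := by
    have h := congrArg (Submodule.map (R.deRham σ τ).subtype) P.omega.span_eq
    rw [Submodule.map_span, ← Set.range_comp, Submodule.map_top, Submodule.range_subtype] at h
    exact h
  have hspan : ⊤ ≤ Submodule.span ℂ (Set.range fun i => (P.omega i : R.DRC σ τ)) := by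
    rw [← span_complex_span_subfield (periodField σ τ), hspanK, fam.deRham_eq hK,
      span_complex_span_subfield, fam.ratBasis.span_eq]
  have hfin : Fintype.card (Fin (P.dp + P.dm)) = Module.finrank ℂ (R.DRC σ τ) := by
    rw [Module.finrank_eq_card_basis fam.ratBasis, Fintype.card_fin, fam.card_eq hK]
  have : FiniteDimensional ℂ (R.DRC σ τ) := fam.ratBasis.finiteDimensional_of_finite
  refine ⟨Module.Basis.mk (linearIndependent_of_top_le_span_of_card_eq_finrank hspan hfin) hspan,
    fun i => Module.Basis.mk_apply _ _ _, ?_⟩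
  rw [Module.Basis.coe_mk, hspanK]

theorem repr_ratBasis_mem (hK : periodField σ τ = K) {N : ℕ}
    {Ω : Module.Basis (Fin N) ℂ (R.DRC σ τ)}
    (hΩ : Submodule.span (periodField σ τ) (Set.range Ω) = R.deRham σ τ) (l) (i) :
    Ω.repr (fam.ratBasis l) i ∈ K := by
  have h : fam.ratBasis l ∈ Submodule.span (periodField σ τ) (Set.range Ω) := by
    rw [hΩ, fam.deRham_eq hK]
    exact Submodule.subset_span ⟨l, rfl⟩
  rw [mem_span_subfield_iff] at h
  exact hK ▸ h i

/-- If the basis of a period matrix is adapted to a subspace spanned by a part of the reference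
basis, the first coordinates of the vectors of this part vanish. -/
theorem repr_ratBasis_eq_zero (hK : periodField σ τ = K) (P : R.PeriodMatrix σ τ)
    {Ω : Module.Basis (Fin (P.dp + P.dm)) ℂ (R.DRC σ τ)} (hΩ : ∀ i, Ω i = (P.omega i : R.DRC σ τ))
    {T : Submodule (periodField σ τ) (R.DRC σ τ)} {A : Set (Σ _ : Place τ, ι)}
    (hA : T = Submodule.span (periodField σ τ) (fam.ratBasis '' A)) (hT : P.AdaptedTo T)
    {l} (hl : l ∈ A) {i : Fin (P.dp + P.dm)}
    (hi : (i : ℕ) + A.ncard < Fintype.card (Σ _ : Place τ, ι)) :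
    Ω.repr (fam.ratBasis l) i = 0 := by
  obtain ⟨k, hk⟩ := hT
  have hset : {y | ∃ i : Fin (P.dp + P.dm), k ≤ (i : ℕ) ∧ y = (P.omega i : R.DRC σ τ)} =
      Ω '' {i | k ≤ (i : ℕ)} := by
    ext y
    constructor
    · rintro ⟨i, hi, rfl⟩; exact ⟨i, hi, hΩ i⟩
    · rintro ⟨i, hi, rfl⟩; exact ⟨i, hi, hΩ i⟩
  rw [hset] at hk
  have hmem : fam.ratBasis l ∈ T := hA ▸ Submodule.subset_span ⟨l, hl, rfl⟩
  rw [hk, mem_span_subfield_image_iff] at hmem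
  refine hmem.2 i fun hki => ?_
  have hcard := finrank_span_subfield_image (K := periodField σ τ) fam.ratBasis A
  rw [← hA, hk, finrank_span_subfield_image] at hcard
  have hle : {j : Fin (P.dp + P.dm) | i ≤ j}.ncard ≤ {j : Fin (P.dp + P.dm) | k ≤ (j : ℕ)}.ncard :=
    Set.ncard_le_ncard (fun j hj => le_trans (show k ≤ (i : ℕ) from hki) (Fin.le_def.1 hj))
  have hIci : {j : Fin (P.dp + P.dm) | i ≤ j}.ncard = P.dp + P.dm - i := by
    rw [show {j : Fin (P.dp + P.dm) | i ≤ j} = ((Finset.Ici i : Finset _) : Set _) by ext; simp,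
      Set.ncard_coe_finset, Fin.card_Ici]
  have := fam.card_eq hK P
  omega

/-- Corresponding families in the `ε`-eigenspaces: vectors `u` of the rational Betti eigenspace,
linearly independent eigenvectors `w` with coordinates in `K` with respect to the Hodge basis, and
the invertible matrix `H` which expresses the former in terms of the latter.  If `J` has as many
elements as the dimension of the eigenspace, these families are bases, and `det H` is the factor in
`ℂˣ / Kˣ` by which the Betti and the Hodge rational structures of the eigenspace differ. -/
structure EigenData (ε : ℤˣ) (J : Type) [Fintype J] [DecidableEq J] where
  u : J → R.Betti τ
  w : J → R.BettiC σ τ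
  H : Matrix J J ℂ
  u_mem : ∀ j, u j ∈ R.bettiSign τ ε
  w_eig : ∀ j, R.frobC σ τ (w j) = ((ε : ℤ) : ℂ) • w j
  w_li : LinearIndependent ℂ w
  w_repr : ∀ j κ m, (fam.fr κ).h.repr (w j κ) m ∈ K
  u_eq : ∀ j, R.bettiOf σ τ (u j) = ∑ i, H i j • w i
  det_ne : H.det ≠ 0

variable {fam} {ε : ℤˣ} {J : Type} [Fintype J] [DecidableEq J]

theorem EigenData.bettiOf_li (d : fam.EigenData ε J) :
    LinearIndependent ℂ fun j => R.bettiOf σ τ (d.u j) := by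
  rw [Fintype.linearIndependent_iff]
  intro a ha
  simp_rw [d.u_eq, Finset.smul_sum, smul_smul] at ha
  rw [Finset.sum_comm] at ha
  simp_rw [← Finset.sum_smul] at ha
  have h1 := Fintype.linearIndependent_iff.1 d.w_li _ ha
  have h2 : d.H.mulVec a = 0 := by
    ext i
    refine Eq.trans ?_ (h1 i)
    simp [Matrix.mulVec, dotProduct, mul_comm]
  by_contra hne
  push Not at hne
  obtain ⟨i, hi⟩ := hne
  exact d.det_ne (Matrix.exists_mulVec_eq_zero_iff.1 ⟨a, fun h => hi (congrFun h i), h2⟩)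

/-- The vectors `u` are linearly independent over the field of coefficients. -/
theorem EigenData.u_li (d : fam.EigenData ε J) :
    LinearIndependent E fun j => (⟨d.u j, d.u_mem j⟩ : R.bettiSign τ ε) := by
  rw [Fintype.linearIndependent_iff]
  intro a ha i
  have h1 : ∑ j, a j • d.u j = 0 := by
    have := congrArg Subtype.val ha
    simpa using this
  have h2 : ∑ j, σ (a j) • R.bettiOf σ τ (d.u j) = 0 := by
    rw [← map_zero (R.bettiOf σ τ), ← h1, map_sum]
    exact Finset.sum_congr rfl fun j _ => (map_smulₛₗ _ _ _).symm
  have := Fintype.linearIndependent_iff.1 d.bettiOf_li _ h2 i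
  simpa using this

/-- The expression of an arbitrary basis of the rational eigenspace in terms of the vectors `w`. -/
theorem EigenData.exists_matrix (d : fam.EigenData ε J) (hσ : ∀ a, σ a ∈ K) {k : ℕ}
    (b : Module.Basis (Fin k) E (R.bettiSign τ ε)) (hk : k ≤ Fintype.card J) :
    ∃ (e : Fin k ≃ J) (B : Matrix J (Fin k) ℂ),
      (∀ j, R.bettiOf σ τ (b j) = ∑ i, B i j • d.w i) ∧
      EqUpTo K (B.submatrix e id).det d.H.det := by
  have hfr : Module.finrank E (R.bettiSign τ ε) = k := by
    rw [Module.finrank_eq_card_basis b, Fintype.card_fin]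
  have : Module.Finite E (R.bettiSign τ ε) := Module.Finite.of_basis b
  have hcard : Fintype.card J = Module.finrank E (R.bettiSign τ ε) :=
    le_antisymm d.u_li.fintype_card_le_finrank (hfr.trans_le hk)
  let ub : Module.Basis J E (R.bettiSign τ ε) :=
    Module.Basis.mk d.u_li (d.u_li.span_eq_top_of_card_eq_finrank' hcard).ge
  have hub : ∀ j, ((ub j : R.bettiSign τ ε) : R.Betti τ) = d.u j := fun j => by
    simp [ub]
  let e : Fin k ≃ J := (Fintype.equivFinOfCardEq (hcard.trans hfr)).symm
  let C : Matrix J (Fin k) E := ub.toMatrix b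
  refine ⟨e, d.H * C.map σ, fun j => ?_, ?_⟩
  · have h1 : ((b j : R.bettiSign τ ε) : R.Betti τ) = ∑ i, C i j • d.u i := by
      have := congrArg Subtype.val (ub.sum_repr (b j))
      refine this.symm.trans ?_
      rw [Submodule.coe_sum]
      exact Finset.sum_congr rfl fun i _ => by rw [Submodule.coe_smul, hub]; rfl
    rw [h1, map_sum]
    simp_rw [map_smulₛₗ, d.u_eq, Finset.smul_sum, smul_smul]
    rw [Finset.sum_comm]
    refine Finset.sum_congr rfl fun i _ => ?_
    rw [← Finset.sum_smul]
    congr 1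
    simp [Matrix.mul_apply, mul_comm]
  · have hdet : ((d.H * C.map σ).submatrix e id).det = d.H.det * σ (C.submatrix e id).det := by
      rw [← Matrix.submatrix_mul_equiv d.H (C.map σ) e e id, Matrix.det_mul,
        Matrix.det_submatrix_equiv_self, RingHom.map_det]
      rfl
    rw [hdet, mul_comm]
    refine EqUpTo.mul_left (hσ _) ?_
    rw [map_ne_zero]
    have h2 : C.submatrix e id = (ub.reindex e.symm).toMatrix b := by
      ext i j
      simp [C, Module.Basis.toMatrix_apply]
    rw [h2]
    exact ((Matrix.isUnit_iff_isUnit_det _).1 (isUnit_iff_exists.2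
      ⟨b.toMatrix (ub.reindex e.symm),
        Module.Basis.toMatrix_mul_toMatrix_flip _ _,
        Module.Basis.toMatrix_mul_toMatrix_flip _ _⟩)).ne_zero

end FrameFamily

end

noncomputable section

/-! ### The periods `c^±` -/

variable {E F : Type*} [Field E] [CharZero E] [Field F] [CharZero F]

theorem mem_periodField {E F : Type*} [Field E] [Field F] (σ : E →+* ℂ) (τ : F →+* ℂ)
    (a : E) : σ a ∈ periodField σ τ :=
  (le_sup_left : σ.fieldRange ≤ _) ⟨a, rfl⟩

namespace FrameFamily

variable {R : Realization E F} {σ : E →+* ℂ} {τ : F →+* ℂ} {K : Subfield ℂ} {ι : Type} [Fintype ι]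

theorem nonempty_basis (fam : FrameFamily R σ τ K ι) (κ : Place τ) :
    Nonempty (Module.Basis ι E (R.HB κ.1)) := by
  let b := Module.Basis.ofVectorSpace E (R.HB κ.1)
  exact ⟨b.reindex ((Ext.basis σ b).indexEquiv (fam.fr κ).h)⟩

/-- Linear independence is preserved by the extension of scalars to `ℂ`. -/
theorem bettiOf_linearIndependent (fam : FrameFamily R σ τ K ι) {J : Type*} [Fintype J]
    {v : J → R.Betti τ} (hv : LinearIndependent E v) :
    LinearIndependent ℂ fun j => R.bettiOf σ τ (v j) := by
  classical
  let e := fun κ => (fam.nonempty_basis κ).some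
  let b : Module.Basis (Σ _ : Place τ, ι) E (R.Betti τ) := Pi.basis e
  let B : Module.Basis (Σ _ : Place τ, ι) ℂ (R.BettiC σ τ) := Pi.basis fun κ => Ext.basis σ (e κ)
  have hB : ∀ i, B i = R.bettiOf σ τ (b i) := by
    intro i
    ext κ
    simp only [B, b, Pi.basis_apply, Ext.basis_apply]
    by_cases h : κ = i.1
    · subst h
      simp [Realization.bettiOf]
    · simp [Realization.bettiOf, h]
  -- a left inverse of `v` extends to complex linear forms
  obtain ⟨g, hg⟩ := LinearMap.exists_leftInverse_of_injective (Fintype.linearCombination E v)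
    (LinearMap.ker_eq_bot.2 (linearIndependent_iff_injective_fintypeLinearCombination.1 hv))
  rw [Fintype.linearIndependent_iff]
  intro a ha j
  let f : R.BettiC σ τ →ₗ[ℂ] ℂ := B.constr ℂ fun i => σ (g (b i) j)
  have hf : ∀ x, f (R.bettiOf σ τ x) = σ (g x j) := by
    intro x
    conv_lhs => rw [← b.sum_repr x]
    conv_rhs => rw [← b.sum_repr x]
    simp only [map_sum, map_smulₛₗ, ← hB, f, Module.Basis.constr_basis, Finset.sum_apply,
      Pi.smul_apply, smul_eq_mul, map_mul, RingHom.id_apply]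
  have h1 := congrArg f ha
  rw [map_sum, map_zero] at h1
  rw [← h1]
  have h2 : ∀ i, g (v i) = Pi.single i 1 := by
    intro i
    have := LinearMap.congr_fun hg (Pi.single i 1)
    simpa [Fintype.linearCombination_apply_single] using this
  simp_rw [map_smul, hf, h2]
  simp [Pi.single_apply, apply_ite σ]

variable (fam : FrameFamily R σ τ K ι)

/-- The action of `F_∞` on the coordinates with respect to the Hodge basis. -/
theorem repr_frobC (x : R.BettiC σ τ) (κ : Place τ) (m : ι) :
    (fam.fr κ).h.repr (R.frobC σ τ x κ) (fam.bar m) =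
      ((fam.sgn m : ℤ) : ℂ) * (fam.fr κ.conj).h.repr (x κ.conj) m := by
  classical
  have hinj : ∀ i, fam.bar i = fam.bar m ↔ i = m := fun i =>
    ⟨fun h => by rw [← fam.bar_bar i, h, fam.bar_bar], fun h => by rw [h]⟩
  have key : ∀ h : κ.1 = conjugate κ.conj.1, ((fam.fr κ).h.coord (fam.bar m)) ∘ₗ
      Ext.map σ (R.Finf κ.conj.1 κ.1 h) =
      ((fam.sgn m : ℤ) : ℂ) • (fam.fr κ.conj).h.coord m := by
    intro h
    refine (fam.fr κ.conj).h.ext fun i => ?_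
    rw [LinearMap.comp_apply, fam.finf_h κ.conj κ, LinearMap.smul_apply, map_smul,
      Module.Basis.coord_apply, Module.Basis.coord_apply, Module.Basis.repr_self,
      Module.Basis.repr_self, Finsupp.single_apply, Finsupp.single_apply]
    simp only [hinj]
    split_ifs with h
    · rw [h]
    · simp
  exact LinearMap.congr_fun (key (involutive_conjugate F κ.1).symm) (x κ.conj)

/-- If `F_∞` maps the vectors of level `≥ c` to vectors of level `< c`, an eigenvector is determined
by its coordinates of level `< c`. -/
theorem eq_zero_of_repr_low (c : ℤ)
    (hcut : ∀ κ m, c ≤ (fam.fr κ).lev m → (fam.fr κ.conj).lev (fam.bar m) < c) {ε : ℤˣ}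
    {x : R.BettiC σ τ} (hx : R.frobC σ τ x = ((ε : ℤ) : ℂ) • x)
    (h : ∀ κ m, (fam.fr κ).lev m < c → (fam.fr κ).h.repr (x κ) m = 0) : x = 0 := by
  ext κ
  apply (fam.fr κ).h.repr.injective
  ext m
  rw [Pi.zero_apply, map_zero, Finsupp.zero_apply]
  by_cases hm : (fam.fr κ).lev m < c
  · exact h κ m hm
  · have hm' : (fam.fr κ.conj).lev (fam.bar m) < c :=
      hcut κ m (not_lt.1 hm)
    have h1 := fam.repr_frobC x κ (fam.bar m)
    rw [h _ _ hm', mul_zero, fam.bar_bar, hx, Pi.smul_apply, map_smul, Finsupp.smul_apply,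
      smul_eq_mul] at h1
    refine (mul_eq_zero.1 h1).resolve_left ?_
    rcases Int.units_eq_one_or ε with rfl | rfl <;> simp

open Classical in
/-- If `F_∞` exchanges the levels `< c` and `≥ c`, half of the Hodge basis has level `< c`. -/
theorem two_mul_card_low (c : ℤ)
    (hcut : ∀ κ m, (fam.fr κ).lev m < c ↔ c ≤ (fam.fr κ.conj).lev (fam.bar m)) :
    2 * Fintype.card {x : Σ _ : Place τ, ι // (fam.fr x.1).lev x.2 < c} =
      Fintype.card (Σ _ : Place τ, ι) := by
  let e : {x : Σ _ : Place τ, ι // (fam.fr x.1).lev x.2 < c} ≃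
      {x : Σ _ : Place τ, ι // ¬ (fam.fr x.1).lev x.2 < c} :=
    { toFun := fun x => ⟨⟨x.1.1.conj, fam.bar x.1.2⟩, not_lt.2 ((hcut _ _).1 x.2)⟩
      invFun := fun x => ⟨⟨x.1.1.conj, fam.bar x.1.2⟩, by
        rw [hcut, Place.conj_conj, fam.bar_bar]
        exact not_lt.1 x.2⟩
      left_inv := fun x => by
        refine Subtype.ext (Sigma.ext (Place.conj_conj _) (heq_of_eq (fam.bar_bar _)))
      right_inv := fun x => by
        refine Subtype.ext (Sigma.ext (Place.conj_conj _) (heq_of_eq (fam.bar_bar _))) }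
  have h1 := Fintype.card_congr e
  have h2 := Fintype.card_subtype_compl fun x : Σ _ : Place τ, ι => (fam.fr x.1).lev x.2 < c
  have h3 := Fintype.card_subtype_le fun x : Σ _ : Place τ, ι => (fam.fr x.1).lev x.2 < c
  omega

open Classical in
/-- An eigenspace has at most the dimension of the part of level `< c`, because its elements are
determined by their coordinates of level `< c`. -/
theorem finrank_eigenspace_le (c : ℤ)
    (hcut : ∀ κ m, c ≤ (fam.fr κ).lev m → (fam.fr κ.conj).lev (fam.bar m) < c)
    {ε : ℤˣ} {k : ℕ} (b : Module.Basis (Fin k) E (R.bettiSign τ ε)) :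
    k ≤ Fintype.card {x : Σ _ : Place τ, ι // (fam.fr x.1).lev x.2 < c} := by
  let res : R.BettiC σ τ →ₗ[ℂ] ({x : Σ _ : Place τ, ι // (fam.fr x.1).lev x.2 < c} → ℂ) :=
    LinearMap.pi fun x => (fam.fr x.1.1).h.coord x.1.2 ∘ₗ LinearMap.proj x.1.1
  have hb : LinearIndependent E fun j => ((b j : R.bettiSign τ ε) : R.Betti τ) :=
    b.linearIndependent.map' _ (Submodule.ker_subtype _)
  have hspan : Submodule.span ℂ (Set.range fun j => R.bettiOf σ τ (b j : R.Betti τ)) ≤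
      Module.End.eigenspace (R.frobC σ τ) ((ε : ℤ) : ℂ) := by
    rw [Submodule.span_le]
    rintro _ ⟨j, rfl⟩
    rw [SetLike.mem_coe, Module.End.mem_eigenspace_iff, R.frobC_bettiOf,
      R.mem_bettiSign.1 (b j).2, map_smulₛₗ, map_intCast]
  have hli := (fam.bettiOf_linearIndependent hb).map (f := res)
    (Submodule.disjoint_def.2 fun x hx hx' => fam.eq_zero_of_repr_low c hcut
      (Module.End.mem_eigenspace_iff.1 (hspan hx)) fun κ m hm => congrFun hx' ⟨⟨κ, m⟩, hm⟩)
  have := hli.fintype_card_le_finrank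
  rwa [Fintype.card_fin, Module.finrank_fintype_fun_eq_card] at this

variable {fam} in
/-- A combination of the eigenvectors `w` with vanishing coordinates of level `< c` is trivial. -/
theorem EigenData.eq_zero_of_low (c : ℤ)
    (hcut : ∀ κ m, (fam.fr κ).lev m < c ↔ c ≤ (fam.fr κ.conj).lev (fam.bar m))
    {ε : ℤˣ} {J : Type} [Fintype J] [DecidableEq J] (d : fam.EigenData ε J) (a : J → ℂ)
    (ha : ∀ l : Σ _ : Place τ, ι, (fam.fr l.1).lev l.2 < c →
      fam.hodgeBasis.repr (∑ j, a j • R.compC σ τ (d.w j)) l = 0) : a = 0 := by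
  have h0 : ∑ j, a j • d.w j = 0 := by
    have hmem : ∑ j, a j • d.w j ∈ Module.End.eigenspace (R.frobC σ τ) ((ε : ℤ) : ℂ) :=
      Submodule.sum_mem _ fun j _ => Submodule.smul_mem _ _
        (Module.End.mem_eigenspace_iff.2 (d.w_eig j))
    refine fam.eq_zero_of_repr_low c (fun κ m h => not_le.1 fun h' =>
      absurd ((hcut κ m).2 h') (not_lt.2 h)) (Module.End.mem_eigenspace_iff.1 hmem) fun κ m hm => ?_
    have h1 := ha ⟨κ, m⟩ hm
    have h2 : ∑ j, a j • R.compC σ τ (d.w j) = R.compC σ τ (∑ j, a j • d.w j) := by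
      rw [map_sum]
      exact Finset.sum_congr rfl fun j _ => (map_smul _ _ _).symm
    rwa [h2, hodgeBasis_repr_compC] at h1
  ext j
  exact Fintype.linearIndependent_iff.1 d.w_li a h0 j

/-- The minor of a period matrix which belongs to the `ε`-eigenspace, if its degree is the
codimension of a step of the filtration. -/
theorem minor_eqUpTo (hK : periodField σ τ = K) (P : R.PeriodMatrix σ τ) (hP : P.HodgeAdapted)
    (c : ℤ) (hcut : ∀ κ m, (fam.fr κ).lev m < c ↔ c ≤ (fam.fr κ.conj).lev (fam.bar m))
    {ε : ℤˣ} {J : Type} [Fintype J] [DecidableEq J] (d : fam.EigenData ε J)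
    (hcard : 2 * Fintype.card J = Fintype.card (Σ _ : Place τ, ι))
    {Ω : Module.Basis (Fin (P.dp + P.dm)) ℂ (R.DRC σ τ)} (hΩ : ∀ i, Ω i = (P.omega i : R.DRC σ τ))
    (hΩ' : Submodule.span (periodField σ τ) (Set.range Ω) = R.deRham σ τ)
    {k : ℕ} (hk : k ≤ P.dp + P.dm) (b : Module.Basis (Fin k) E (R.bettiSign τ ε)) :
    EqUpTo K (Matrix.of fun i j : Fin k =>
        Ω.repr (R.periodMap σ τ (b j : R.Betti τ)) (Fin.castLE hk i)).det
      ((∏ x : {x : Σ _ : Place τ, ι // (fam.fr x.1).lev x.2 < c}, (fam.fr x.1.1).lam x.1.2) *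
        d.H.det) := by
  classical
  have hcL := fam.two_mul_card_low c hcut
  have hkJ : k ≤ Fintype.card J := by
    have := fam.finrank_eigenspace_le c (fun κ m h => not_le.1 fun h' =>
      absurd ((hcut κ m).2 h') (not_lt.2 h)) b
    omega
  obtain ⟨e, B, hB, hBdet⟩ := d.exists_matrix (fun a => hK ▸ mem_periodField σ τ a) b hkJ
  have hkJ' : Fintype.card J = k := by
    rw [← Fintype.card_congr e, Fintype.card_fin]
  have hkL : Fintype.card {x : Σ _ : Place τ, ι // (fam.fr x.1).lev x.2 < c} = k := by omega
  refine (minor_eqUpTo_of_bases hk Ω fam.ratBasis fam.hodgeBasis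
    (fun x => (fam.fr x.1).lev x.2 < c) (fam.repr_ratBasis_mem hK hΩ') ?_
    (fun x => (fam.fr x.1).lev x.2) ?_ (fun x => (fam.fr x.1).lam x.2)
    fam.ratBasis_repr_hodgeBasis_self ?_ hkL e (fun j => R.compC σ τ (d.w j)) ?_ ?_ B
    (fun j => R.periodMap σ τ (b j : R.Betti τ)) ?_).trans ((EqUpTo.refl _ _).mul hBdet)
  · -- the basis of the period matrix is adapted to the step `Fil^c`, of codimension `k`
    intro l hl i hi
    refine fam.repr_ratBasis_eq_zero hK P hΩ (fam.deRhamFil_eq hK c) (hP c) (not_lt.1 hl) ?_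
    have h1 : {x : Σ _ : Place τ, ι | c ≤ (fam.fr x.1).lev x.2}.ncard =
        Fintype.card {x : Σ _ : Place τ, ι // ¬ (fam.fr x.1).lev x.2 < c} := by
      rw [← Nat.card_coe_set_eq, Nat.card_eq_fintype_card]
      exact Fintype.card_congr (Equiv.subtypeEquivRight fun x =>
        (not_lt (a := (fam.fr x.1).lev x.2) (b := c)).symm)
    rw [h1, Fintype.card_subtype_compl]
    have := Fintype.card_subtype_le fun x : Σ _ : Place τ, ι => (fam.fr x.1).lev x.2 < c
    omega
  · intro l m hm hml hl
    exact hm (hml.trans_lt hl)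
  · intro m l hlm hlt
    exact fam.ratBasis_repr_hodgeBasis hlm hlt
  · intro j x
    rw [hodgeBasis_repr_compC]
    exact d.w_repr _ _ _
  · intro a ha
    exact d.eq_zero_of_low c hcut a ha
  · intro j
    rw [← R.compC_bettiOf, hB, map_sum]
    exact Finset.sum_congr rfl fun i _ => map_smul _ _ _

/-- The period `c^ε` of a system of realizations, if a step of the Hodge filtration is exchanged by
`F_∞` with a complement: it is the product of the factors `lam` outside this step, times the
determinant which compares the rational structures of the `ε`-eigenspace. -/
theorem isPeriod_eqUpTo (hK : periodField σ τ = K) (c : ℤ)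
    (hcut : ∀ κ m, (fam.fr κ).lev m < c ↔ c ≤ (fam.fr κ.conj).lev (fam.bar m))
    {ε : ℤˣ} {J : Type} [Fintype J] [DecidableEq J] (d : fam.EigenData ε J)
    (hcard : 2 * Fintype.card J = Fintype.card (Place τ) * Fintype.card ι) {x : ℂ}
    (hx : R.IsPeriod σ τ ε x) :
    EqUpTo K x ((∏ κ, ∏ m with (fam.fr κ).lev m < c, (fam.fr κ).lam m) * d.H.det) := by
  classical
  obtain ⟨P, hP, rfl⟩ := hx
  obtain ⟨Ω, hΩ, hΩ'⟩ := fam.exists_basis hK P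
  have hprod : ∏ x : {x : Σ _ : Place τ, ι // (fam.fr x.1).lev x.2 < c}, (fam.fr x.1.1).lam x.1.2 =
      ∏ κ, ∏ m with (fam.fr κ).lev m < c, (fam.fr κ).lam m := by
    rw [← Finset.prod_sigma (Finset.univ : Finset (Place τ))
      (fun κ => Finset.univ.filter fun m => (fam.fr κ).lev m < c)
      fun x => (fam.fr x.1).lam x.2]
    exact (Finset.prod_subtype (p := fun x : Σ _ : Place τ, ι => (fam.fr x.1).lev x.2 < c) _
      (fun x => by simp) fun x => (fam.fr x.1).lam x.2).symm
  have hcard' : 2 * Fintype.card J = Fintype.card (Σ _ : Place τ, ι) := by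
    rw [hcard, Fintype.card_sigma]
    simp
  rw [← hprod]
  have hrepr : ∀ (y : R.DRC σ τ) (a : Fin (P.dp + P.dm) → ℂ),
      y = ∑ i, a i • ((P.omega i : R.deRham σ τ) : R.DRC σ τ) → ∀ i, Ω.repr y i = a i := by
    rintro y a rfl i
    simp_rw [← hΩ]
    simp [Finsupp.single_apply]
  rcases Int.units_eq_one_or ε with rfl | rfl
  · convert fam.minor_eqUpTo hK P hP c hcut d hcard' hΩ hΩ' (Nat.le_add_right P.dp P.dm)
      P.uplus using 1
    rw [Realization.PeriodMatrix.minor, if_pos rfl]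
    congr 1
    ext i j
    exact (hrepr _ _ (P.plus_eq j) _).symm
  · convert fam.minor_eqUpTo hK P hP c hcut d hcard' hΩ hΩ' (Nat.le_add_left P.dm P.dp)
      P.uminus using 1
    rw [Realization.PeriodMatrix.minor, if_neg (by decide)]
    congr 1
    ext i j
    exact (hrepr _ _ (P.minus_eq j) _).symm

end FrameFamily

end

noncomputable section

/-! ### The determinant and the relative invariants of a period matrix -/

/-- The blocks of `c` consecutive rows, numbered from `1`. -/
theorem blockIndex_eq {n c : ℕ} (hc : 0 < c) {s : ℕ → ℕ}
    (hs : ∀ μ, 1 ≤ μ → μ ≤ n → s μ = c) {i : ℕ} (hi : i < n * c) :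
    blockIndex n s i = i / c + 1 := by
  have h1 : ∀ μ ∈ Finset.Icc 1 n, ∑ ν ∈ Finset.Icc 1 μ, s ν = μ * c := by
    intro μ hμ
    rw [Finset.sum_congr rfl fun ν hν => hs ν (Finset.mem_Icc.1 hν).1
      ((Finset.mem_Icc.1 hν).2.trans (Finset.mem_Icc.1 hμ).2)]
    simp
  have h2 : ((Finset.Icc 1 n).filter fun μ => ∑ ν ∈ Finset.Icc 1 μ, s ν ≤ i) =
      Finset.Icc 1 (i / c) := by
    ext μ
    have h3 : i / c < n := Nat.div_lt_of_lt_mul (by rwa [mul_comm])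
    simp only [Finset.mem_filter, Finset.mem_Icc]
    constructor
    · rintro ⟨h, h'⟩
      rw [h1 μ (Finset.mem_Icc.2 h)] at h'
      exact ⟨h.1, (Nat.le_div_iff_mul_le hc).2 h'⟩
    · rintro ⟨h, h'⟩
      have hμ : μ ∈ Finset.Icc 1 n := Finset.mem_Icc.2 ⟨h, h'.trans h3.le⟩
      refine ⟨Finset.mem_Icc.1 hμ, ?_⟩
      rw [h1 μ hμ]
      exact (Nat.le_div_iff_mul_le hc).1 h'
  rw [blockIndex, h2, Nat.card_Icc]
  rfl

theorem prod_Icc_one {α : Type*} [CommMonoid α] (f : ℕ → α) (n : ℕ) :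
    ∏ μ ∈ Finset.Icc 1 n, f μ = ∏ m : Fin n, f (m + 1) := by
  induction n with
  | zero => simp
  | succ n ih =>
    rw [Finset.prod_Icc_succ_top (by omega), ih, Fin.prod_univ_castSucc]
    rfl

theorem eq_zero_of_eq_neg {W : Type*} [AddCommGroup W] [Module ℂ W] {x : W} (h : x = -x) :
    x = 0 := by
  have h2 : (2 : ℂ) • x = 0 := by
    rw [two_smul]
    exact add_eq_zero_iff_eq_neg.2 h
  exact (smul_eq_zero.1 h2).resolve_left two_ne_zero

variable {E F : Type*} [Field E] [CharZero E] [Field F] [CharZero F]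

namespace FrameFamily

variable {R : Realization E F} {σ : E →+* ℂ} {τ : F →+* ℂ} {K : Subfield ℂ}

section General

variable {ι : Type} [Fintype ι] {fam : FrameFamily R σ τ K ι}
  {J J' : Type} [Fintype J] [DecidableEq J] [Fintype J'] [DecidableEq J']

theorem EigenData.sum_li (d : fam.EigenData 1 J) (d' : fam.EigenData (-1) J') :
    LinearIndependent ℂ (Sum.elim d.w d'.w) := by
  refine d.w_li.sum_type d'.w_li ?_
  have h1 : Submodule.span ℂ (Set.range d.w) ≤ Module.End.eigenspace (R.frobC σ τ) 1 := by
    rw [Submodule.span_le]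
    rintro _ ⟨j, rfl⟩
    refine Module.End.mem_eigenspace_iff.2 ((d.w_eig j).trans ?_)
    simp
  have h2 : Submodule.span ℂ (Set.range d'.w) ≤ Module.End.eigenspace (R.frobC σ τ) (-1) := by
    rw [Submodule.span_le]
    rintro _ ⟨j, rfl⟩
    refine Module.End.mem_eigenspace_iff.2 ((d'.w_eig j).trans ?_)
    simp
  refine Disjoint.mono h1 h2 (Submodule.disjoint_def.2 fun x hx hx' => ?_)
  rw [Module.End.mem_eigenspace_iff] at hx hx'
  exact eq_zero_of_eq_neg (((one_smul ℂ x).symm.trans (hx.symm.trans hx')).trans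
    ((neg_smul _ _).trans (congrArg _ (one_smul ℂ x))))

theorem EigenData.card_le (d : fam.EigenData 1 J) (P : R.PeriodMatrix σ τ) :
    Fintype.card J ≤ P.dp := by
  have : Module.Finite E (R.bettiSign τ 1) := Module.Finite.of_basis P.uplus
  have h := d.u_li.fintype_card_le_finrank
  rwa [Module.finrank_eq_card_basis P.uplus, Fintype.card_fin] at h

theorem EigenData.card_le' (d : fam.EigenData (-1) J) (P : R.PeriodMatrix σ τ) :
    Fintype.card J ≤ P.dm := by
  have : Module.Finite E (R.bettiSign τ (-1)) := Module.Finite.of_basis P.uminus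
  have h := d.u_li.fintype_card_le_finrank
  rwa [Module.finrank_eq_card_basis P.uminus, Fintype.card_fin] at h

theorem repr_eq_of_eq_sum {P : R.PeriodMatrix σ τ}
    {Ω : Module.Basis (Fin (P.dp + P.dm)) ℂ (R.DRC σ τ)}
    (hΩ : ∀ i, Ω i = (P.omega i : R.DRC σ τ)) {y : R.DRC σ τ} {a : Fin (P.dp + P.dm) → ℂ}
    (h : y = ∑ i, a i • ((P.omega i : R.deRham σ τ) : R.DRC σ τ)) (i) : Ω.repr y i = a i := by
  rw [h]
  simp_rw [← hΩ]
  simp [Finsupp.single_apply]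

/-- The expression of the Betti bases of a period matrix in terms of the vectors `w`. -/
theorem exists_matrices (hK : periodField σ τ = K) (P : R.PeriodMatrix σ τ)
    (d : fam.EigenData 1 J) (d' : fam.EigenData (-1) J')
    (hcard : Fintype.card J + Fintype.card J' = Fintype.card (Σ _ : Place τ, ι)) :
    ∃ (e : Fin P.dp ≃ J) (e' : Fin P.dm ≃ J') (B : Matrix J (Fin P.dp) ℂ)
      (B' : Matrix J' (Fin P.dm) ℂ),
      (∀ j, R.periodMap σ τ (P.uplus j) = ∑ i, B i j • R.compC σ τ (d.w i)) ∧
      (∀ j, R.periodMap σ τ (P.uminus j) = ∑ i, B' i j • R.compC σ τ (d'.w i)) ∧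
      EqUpTo K (B.submatrix e id).det d.H.det ∧ EqUpTo K (B'.submatrix e' id).det d'.H.det := by
  have h1 := d.card_le P
  have h2 := d'.card_le' P
  have h3 := fam.card_eq hK P
  obtain ⟨e, B, hB, hB'⟩ := d.exists_matrix (fun a => hK ▸ mem_periodField σ τ a) P.uplus (by omega)
  obtain ⟨e', C, hC, hC'⟩ :=
    d'.exists_matrix (fun a => hK ▸ mem_periodField σ τ a) P.uminus (by omega)
  refine ⟨e, e', B, C, fun j => ?_, fun j => ?_, hB', hC'⟩
  · rw [← R.compC_bettiOf, hB, map_sum]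
    exact Finset.sum_congr rfl fun i _ => map_smul _ _ _
  · rw [← R.compC_bettiOf, hC, map_sum]
    exact Finset.sum_congr rfl fun i _ => map_smul _ _ _

theorem sum_compC_li (d : fam.EigenData 1 J) (d' : fam.EigenData (-1) J') :
    LinearIndependent ℂ (fun j => R.compC σ τ (Sum.elim d.w d'.w j)) :=
  (d.sum_li d').map' (R.compC σ τ).toLinearMap (LinearEquiv.ker _)

/-- The period `δ` is the product of all factors `lam` and of the determinants which compare the
rational structures of the two eigenspaces. -/
theorem isDelta_eqUpTo (hK : periodField σ τ = K) (d : fam.EigenData 1 J)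
    (d' : fam.EigenData (-1) J')
    (hcard : Fintype.card J + Fintype.card J' = Fintype.card (Σ _ : Place τ, ι)) {x : ℂ}
    (hx : R.IsDelta σ τ x) :
    EqUpTo K x ((∏ κ, ∏ m, (fam.fr κ).lam m) * (d.H.det * d'.H.det)) := by
  obtain ⟨P, -, rfl⟩ := hx
  obtain ⟨Ω, hΩ, hΩ'⟩ := fam.exists_basis hK P
  classical
  obtain ⟨e, e', B, B', hB, hB', hdet, hdet'⟩ := exists_matrices hK P d d' hcard
  let H₀ : Matrix (J ⊕ J') (Fin P.dp ⊕ Fin P.dm) ℂ := Matrix.fromBlocks B 0 0 B'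
  let H : Matrix (J ⊕ J') (Fin (P.dp + P.dm)) ℂ := H₀.submatrix id finSumFinEquiv.symm
  let E₀ : Fin (P.dp + P.dm) ≃ J ⊕ J' := finSumFinEquiv.symm.trans (Equiv.sumCongr e e')
  let v₀ : Fin P.dp ⊕ Fin P.dm → R.DRC σ τ := Sum.elim
    (fun j => R.periodMap σ τ (P.uplus j : R.Betti τ))
    (fun j => R.periodMap σ τ (P.uminus j : R.Betti τ))
  have hv₀ : ∀ j i, Ω.repr (v₀ j) i = P.X i j := by
    rintro (j | j) i
    · exact repr_eq_of_eq_sum hΩ (P.plus_eq j) i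
    · exact repr_eq_of_eq_sum hΩ (P.minus_eq j) i
  -- the determinant is the minor of full degree, so all vectors are considered to have low level
  have key := minor_eqUpTo_of_bases (K := K) le_rfl Ω fam.ratBasis fam.hodgeBasis (fun _ => True)
    (fam.repr_ratBasis_mem hK hΩ') (fun l hl => absurd trivial hl) (fun x => (fam.fr x.1).lev x.2)
    (fun _ _ h => absurd trivial h) (fun x => (fam.fr x.1).lam x.2)
    fam.ratBasis_repr_hodgeBasis_self (fun m l => fam.ratBasis_repr_hodgeBasis)
    (by rw [fam.card_eq hK P]; exact Fintype.card_congr (Equiv.subtypeUnivEquiv fun _ => trivial))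
    E₀ (fun j => R.compC σ τ (Sum.elim d.w d'.w j)) (fun j m => by
      rw [hodgeBasis_repr_compC]
      rcases j with j | j
      · exact d.w_repr _ _ _
      · exact d'.w_repr _ _ _)
    (fun a ha => by
      ext j
      refine Fintype.linearIndependent_iff.1 (sum_compC_li d d') a ?_ j
      apply fam.hodgeBasis.repr.injective
      ext l
      rw [ha l trivial, map_zero, Finsupp.zero_apply])
    H (fun j => v₀ (finSumFinEquiv.symm j)) (fun j => by
      change v₀ (finSumFinEquiv.symm j) = ∑ i, H₀ i (finSumFinEquiv.symm j) • _
      generalize finSumFinEquiv.symm j = j'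
      rcases j' with j' | j'
      · rw [Fintype.sum_sum_type]
        exact (hB j').trans (((congrArg _ (Finset.sum_eq_zero fun i _ => zero_smul ℂ _)).trans
          (add_zero _)).symm)
      · rw [Fintype.sum_sum_type]
        exact (hB' j').trans (((congrArg (· + _) (Finset.sum_eq_zero fun i _ =>
          zero_smul ℂ _)).trans (zero_add _)).symm))
  have h1 : P.detX = (Matrix.of fun i j : Fin (P.dp + P.dm) =>
      Ω.repr (v₀ (finSumFinEquiv.symm j)) (Fin.castLE le_rfl i)).det := by
    rw [Realization.PeriodMatrix.detX, ← Matrix.det_submatrix_equiv_self finSumFinEquiv.symm]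
    congr 1
    ext i j
    simp [hv₀]
  have h2 : (H.submatrix E₀ id).det = (B.submatrix e id).det * (B'.submatrix e' id).det := by
    rw [← Matrix.det_fromBlocks_zero₂₁ _ 0, ← Matrix.det_submatrix_equiv_self finSumFinEquiv.symm]
    congr 1
    ext i j
    simp only [H, H₀, E₀, Matrix.submatrix_apply, id, Equiv.trans_apply]
    generalize finSumFinEquiv.symm j = j'
    generalize finSumFinEquiv.symm i = i'
    rcases i' with i' | i' <;> rcases j' with j' | j' <;> simp
  rw [h1]
  refine key.trans ?_
  rw [h2]
  refine EqUpTo.mul ?_ (hdet.mul hdet')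
  have h3 : ∏ m : {m : Σ _ : Place τ, ι // True}, (fam.fr m.1.1).lam m.1.2 =
      ∏ κ, ∏ m, (fam.fr κ).lam m := by
    rw [← Finset.prod_sigma (Finset.univ : Finset (Place τ)) (fun _ => (Finset.univ : Finset ι))
      fun x => (fam.fr x.1).lam x.2]
    exact (Finset.prod_subtype (p := fun x : Σ _ : Place τ, ι => True) _
      (fun x => by simp) fun x => (fam.fr x.1).lam x.2).symm
  rw [h3]
  exact EqUpTo.refl _ _

end General

section Invariant

variable {n : ℕ} {fam : FrameFamily R σ τ K (Fin n)}
  {J J' : Type} [Fintype J] [DecidableEq J] [Fintype J'] [DecidableEq J']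

/-- The involution `F_∞`, transported to the de Rham space, exchanges the lines of the Hodge basis
by `bar`. -/
theorem repr_frobC_hodgeBasis_ne_zero {i j : Σ _ : Place τ, Fin n}
    (h : fam.hodgeBasis.repr (R.compC σ τ (R.frobC σ τ ((R.compC σ τ).symm (fam.hodgeBasis j)))) i
      ≠ 0) : j.2 = fam.bar i.2 := by
  rw [hodgeBasis_repr_compC] at h
  have h1 := fam.repr_frobC ((R.compC σ τ).symm (fam.hodgeBasis j)) i.1 (fam.bar i.2)
  rw [fam.bar_bar] at h1
  rw [h1] at h
  have h2 := right_ne_zero_of_mul h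
  have h3 := fam.hodgeBasis_repr_compC ((R.compC σ τ).symm (fam.hodgeBasis j))
    ⟨i.1.conj, fam.bar i.2⟩
  rw [LinearEquiv.apply_symm_apply, Module.Basis.repr_self] at h3
  rw [← h3] at h2
  by_contra hne
  refine h2 (Finsupp.single_eq_of_ne fun h4 => hne ?_)
  rw [← h4]

/-- The numbering of the vectors of the reference bases of a place by blocks: the block `m` consists
of the `m`-th vectors at the embeddings of the place. -/
def blockEquiv {F : Type*} [Field F] (τ : F →+* ℂ) (n : ℕ) :
    (Σ _ : Place τ, Fin n) ≃ Fin (n * Fintype.card (Place τ)) :=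
  (Equiv.sigmaEquivProd _ _).trans ((Equiv.prodComm _ _).trans
    (((Equiv.refl _).prodCongr (Fintype.equivFin _)).trans finProdFinEquiv))

theorem blockEquiv_div {F : Type*} [Field F] {n : ℕ} {τ : F →+* ℂ} (x : Σ _ : Place τ, Fin n) :
    (blockEquiv τ n x : ℕ) / Fintype.card (Place τ) = x.2 := by
  have h : (blockEquiv τ n x : ℕ) =
      (Fintype.equivFin (Place τ) x.1 : ℕ) + Fintype.card (Place τ) * x.2 := rfl
  have h0 : 0 < Fintype.card (Place τ) := Fintype.card_pos_iff.2 ⟨x.1⟩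
  rw [h, Nat.add_mul_div_left _ _ h0, Nat.div_eq_of_lt (Fin.is_lt _), zero_add]

/-- The value of a relative invariant of type `{a; (1, 1)}` at a period matrix adapted to the steps
of the filtration, if all steps have the same size and `F_∞` reverses their order. -/
theorem evalPoly_period_eqUpTo (hK : periodField σ τ = K)
    (hlev : ∀ κ, StrictMono (fam.fr κ).lev) (hbar : ∀ m, fam.bar m = Fin.rev m)
    (d : fam.EigenData 1 J) (d' : fam.EigenData (-1) J')
    (hcard : Fintype.card J + Fintype.card J' = Fintype.card (Σ _ : Place τ, Fin n))
    (P : R.PeriodMatrix σ τ)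
    (hP : ∀ μ : Fin n, P.AdaptedTo
      (Submodule.span (periodField σ τ) (fam.ratBasis '' {i | μ ≤ i.2})))
    {s a : ℕ → ℕ} (hs : ∀ μ, 1 ≤ μ → μ ≤ n → s μ = Fintype.card (Place τ))
    {f : MvPolynomial (Fin (P.dp + P.dm) × (Fin P.dp ⊕ Fin P.dm)) ℚ} (hf0 : f ≠ 0)
    (hf : IsOfType n s a 1 1 f) :
    EqUpTo K (evalPoly f P.X)
      ((∏ m : Fin n, (∏ κ, (fam.fr κ).lam m) ^ a (m + 1)) * (d.H.det * d'.H.det)) := by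
  classical
  obtain ⟨Ω, hΩ, hΩ'⟩ := fam.exists_basis hK P
  obtain ⟨e, e', B, B', hB, hB', hdet, hdet'⟩ := exists_matrices hK P d d' hcard
  have hN : n * Fintype.card (Place τ) = P.dp + P.dm := by
    rw [fam.card_eq hK P, ← Fintype.card_fin (n * Fintype.card (Place τ))]
    exact (Fintype.card_congr (blockEquiv τ n)).symm
  let r : (Σ _ : Place τ, Fin n) ≃ Fin (P.dp + P.dm) := (blockEquiv τ n).trans (finCongr hN)
  have hc : 0 < Fintype.card (Place τ) := Fintype.card_pos_iff.2 ⟨⟨τ, Or.inl rfl⟩⟩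
  have hblock : ∀ x, blockIndex n s (r x) = x.2 + 1 := by
    intro x
    have h1 : ((r x : Fin (P.dp + P.dm)) : ℕ) = blockEquiv τ n x := rfl
    rw [h1, blockIndex_eq hc hs (Fin.is_lt _), blockEquiv_div]
  have hblock' : ∀ i : Fin (P.dp + P.dm), blockIndex n s i = (r.symm i).2 + 1 := by
    intro i
    rw [← hblock, Equiv.apply_symm_apply]
  have hCb : ∀ i l : Fin (P.dp + P.dm), blockIndex n s i < blockIndex n s l →
      Ω.repr (fam.ratBasis (r.symm l)) i = 0 := by
    intro i l hil
    rw [hblock' l] at hil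
    rw [blockIndex_eq hc hs (i.2.trans_eq hN.symm)] at hil
    refine fam.repr_ratBasis_eq_zero hK P hΩ rfl (hP (r.symm l).2) (le_refl (r.symm l).2) ?_
    have h1 : {x : Σ _ : Place τ, Fin n | (r.symm l).2 ≤ x.2}.ncard =
        Fintype.card (Place τ) * (n - (r.symm l).2) := by
      rw [show {x : Σ _ : Place τ, Fin n | (r.symm l).2 ≤ x.2} =
        ((Finset.univ.sigma fun _ => Finset.Ici (r.symm l).2 : Finset (Σ _ : Place τ, Fin n)) :
          Set _) by ext; simp, Set.ncard_coe_finset, Finset.card_sigma]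
      simp
    have h2 : (i : ℕ) / Fintype.card (Place τ) < (r.symm l).2 := by omega
    have h3 := (Nat.div_lt_iff_lt_mul hc).1 h2
    have h4 : Fintype.card (Σ _ : Place τ, Fin n) = Fintype.card (Place τ) * n := by simp
    rw [h1, h4]
    have h5 : (((r.symm l).2 : Fin n) : ℕ) ≤ n := (Fin.is_lt _).le
    obtain ⟨q, hq⟩ := Nat.exists_eq_add_of_le h5
    have h6 : n - (r.symm l).2 = q := by omega
    rw [h6]
    conv_rhs => rw [hq]
    nlinarith
  have hw₀ : LinearIndependent ℂ (fun j => R.compC σ τ (Sum.elim d.w d'.w j)) := sum_compC_li d d'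
  have key := evalPoly_eqUpTo (K := K) hf0 hf Ω (fam.ratBasis.reindex r) (fam.hodgeBasis.reindex r)
    (fun l i => by
      rw [Module.Basis.reindex_apply]
      exact fam.repr_ratBasis_mem hK hΩ' _ _)
    (fun i l h => by
      rw [Module.Basis.reindex_apply]
      exact hCb i l h)
    (fun i => (fam.fr (r.symm i).1).lam (r.symm i).2)
    (fun i => by
      rw [Module.Basis.reindex_apply, Module.Basis.repr_reindex_apply]
      exact fam.ratBasis_repr_hodgeBasis_self _)
    (fun i l hil hlt => by
      rw [Module.Basis.reindex_apply, Module.Basis.repr_reindex_apply]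
      rw [hblock', hblock'] at hlt
      have hne : r.symm l ≠ r.symm i := fun h => hil (r.symm.injective h)
      by_cases hκ : (r.symm l).1 = (r.symm i).1
      · refine fam.ratBasis_repr_hodgeBasis hne ?_
        rw [hκ, (hlev _).lt_iff_lt]
        intro h
        exact hlt (Nat.succ_lt_succ h)
      · exact fam.ratBasis_repr_hodgeBasis_of_ne hκ)
    (fun j => R.compC σ τ (Sum.elim d.w d'.w (Equiv.sumCongr e e' j)))
    (fun j i => by
      rw [Module.Basis.repr_reindex_apply, hodgeBasis_repr_compC]
      rcases j with j | j
      · exact d.w_repr _ _ _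
      · exact d'.w_repr _ _ _)
    (hw₀.comp _ (Equiv.sumCongr e e').injective)
    ((R.compC σ τ).toLinearMap ∘ₗ R.frobC σ τ ∘ₗ (R.compC σ τ).symm.toLinearMap)
    (fun x => by
      simp only [LinearMap.comp_apply, LinearEquiv.coe_coe, LinearEquiv.symm_apply_apply,
        R.frobC_frobC, LinearEquiv.apply_symm_apply])
    -- the blocks, which are numbered from `1`, are exchanged by `μ ↦ n + 1 - μ`
    (n + 1)
    (fun i j h => by
      rw [Module.Basis.reindex_apply, Module.Basis.repr_reindex_apply] at h
      have h1 := repr_frobC_hodgeBasis_ne_zero h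
      rw [hblock', hblock', h1, hbar, Fin.val_rev]
      omega)
    (fun j => by
      simp only [LinearMap.comp_apply, LinearEquiv.coe_coe, LinearEquiv.symm_apply_apply,
        Equiv.sumCongr_apply, Sum.map_inl, Sum.elim_inl, d.w_eig]
      simp)
    (fun j => by
      simp only [LinearMap.comp_apply, LinearEquiv.coe_coe, LinearEquiv.symm_apply_apply,
        Equiv.sumCongr_apply, Sum.map_inr, Sum.elim_inr, d'.w_eig]
      simp)
    (B.submatrix e id) (B'.submatrix e' id)
    (fun h0 => by
      obtain ⟨c, -, hc0, h⟩ := hdet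
      rw [h0] at h
      exact mul_ne_zero d.det_ne hc0 h.symm)
    (fun h0 => by
      obtain ⟨c, -, hc0, h⟩ := hdet'
      rw [h0] at h
      exact mul_ne_zero d'.det_ne hc0 h.symm)
    P.X
    (fun i j => by
      rw [← repr_eq_of_eq_sum hΩ (P.plus_eq j) i, hB]
      congr 2
      exact (Fintype.sum_equiv e _ _ fun i => rfl).symm)
    (fun i j => by
      rw [← repr_eq_of_eq_sum hΩ (P.minus_eq j) i, hB']
      congr 2
      exact (Fintype.sum_equiv e' _ _ fun i => rfl).symm)
  refine key.trans ?_
  rw [pow_one, pow_one, mul_assoc]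
  refine EqUpTo.mul ?_ (hdet.mul hdet')
  have hprod : ∏ μ ∈ Finset.Icc 1 n, (∏ i ∈ Finset.univ.filter
      fun i : Fin (P.dp + P.dm) => blockIndex n s i = μ,
        (fam.fr (r.symm i).1).lam (r.symm i).2) ^ a μ =
      ∏ m : Fin n, (∏ κ, (fam.fr κ).lam m) ^ a (m + 1) := by
    have h1 : ∀ m : Fin n, ∏ i ∈ Finset.univ.filter
        (fun i : Fin (P.dp + P.dm) => blockIndex n s i = m + 1),
        (fam.fr (r.symm i).1).lam (r.symm i).2 = ∏ κ, (fam.fr κ).lam m := by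
      intro m
      refine Finset.prod_nbij' (fun i => (r.symm i).1) (fun κ => r ⟨κ, m⟩) ?_ ?_ ?_ ?_ ?_
      · simp
      · intro κ _
        simp [hblock]
      · intro i hi
        have h2 : (r.symm i).2 = m := by
          have h3 := (Finset.mem_filter.1 hi).2
          rw [hblock'] at h3
          exact Fin.ext (Nat.succ_injective h3)
        rw [← h2]
        exact r.apply_symm_apply i
      · intro κ _
        rw [Equiv.symm_apply_apply]
      · intro i hi
        have h2 : (r.symm i).2 = m := by
          have h3 := (Finset.mem_filter.1 hi).2
          rw [hblock'] at h3
          exact Fin.ext (Nat.succ_injective h3)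
        rw [h2]
    rw [prod_Icc_one]
    simp_rw [h1]
  rw [hprod]
  exact EqUpTo.refl _ _

end Invariant

end FrameFamily

end

noncomputable section

/-! ### Hodge types of regular motives -/

variable {E F : Type*} [Field E] [CharZero E] [Field F] [CharZero F]

theorem Ext.finrank_of_basis {E S : Type*} [Field E] [Field S] {V : Type*} [AddCommGroup V]
    [Module E V] {n : ℕ} (f : E →+* S)
    (b : Module.Basis (Fin n) E V) : Module.finrank S (Ext f V) = n := by
  rw [Module.finrank_eq_card_basis (Ext.basis f b), Fintype.card_fin]

namespace PureMotive

variable (M : PureMotive E F) {σ : E →+* ℂ} {κ κ' : F →+* ℂ}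

theorem mem_hodgeTypes {p : ℤ} : p ∈ M.hodgeTypes σ κ ↔ M.hodge σ κ p ≠ ⊥ := by
  simp [hodgeTypes]

theorem hodgeP_eq_orderEmbOfFin {n : ℕ} (hn : (M.hodgeTypes σ κ).card = n) (m : Fin n) :
    M.hodgeP σ κ (m + 1) = (M.hodgeTypes σ κ).orderEmbOfFin hn m := by
  subst hn
  rw [hodgeP, dif_pos (by simp)]
  rfl

theorem hodgeP_strictMono {n : ℕ} (hn : (M.hodgeTypes σ κ).card = n) :
    StrictMono fun m : Fin n => M.hodgeP σ κ (m + 1) := by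
  simp_rw [M.hodgeP_eq_orderEmbOfFin hn]
  exact OrderEmbedding.strictMono _

theorem hodge_hodgeP_ne_bot {n : ℕ} (hn : (M.hodgeTypes σ κ).card = n) (m : Fin n) :
    M.hodge σ κ (M.hodgeP σ κ (m + 1)) ≠ ⊥ := by
  rw [M.hodgeP_eq_orderEmbOfFin hn, ← mem_hodgeTypes]
  exact Finset.orderEmbOfFin_mem _ _ _

theorem exists_hodgeP_eq {n : ℕ} (hn : (M.hodgeTypes σ κ).card = n) {p : ℤ}
    (hp : M.hodge σ κ p ≠ ⊥) : ∃ m : Fin n, M.hodgeP σ κ (m + 1) = p := by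
  have h1 : p ∈ Set.range ((M.hodgeTypes σ κ).orderEmbOfFin hn) := by
    rw [Finset.range_orderEmbOfFin]
    exact M.mem_hodgeTypes.2 hp
  obtain ⟨m, hm⟩ := h1
  exact ⟨m, (M.hodgeP_eq_orderEmbOfFin hn m).trans hm⟩

theorem hodgeP_eq_of_strictMono {n : ℕ} (hn : (M.hodgeTypes σ κ).card = n) {f : Fin n → ℤ}
    (hf : ∀ m, M.hodge σ κ (f m) ≠ ⊥) (hmono : StrictMono f) (m : Fin n) :
    M.hodgeP σ κ (m + 1) = f m := by
  rw [M.hodgeP_eq_orderEmbOfFin hn,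
    ← Finset.orderEmbOfFin_unique hn (fun x => M.mem_hodgeTypes.2 (hf x)) hmono]

theorem hodge_eq_span (h : Module.finrank ℂ (M.hodge σ κ p) ≤ 1) {v : Ext σ (M.HB κ)}
    (hv : v ∈ M.hodge σ κ p) (hv0 : v ≠ 0) : M.hodge σ κ p = Submodule.span ℂ {v} := by
  obtain ⟨b⟩ := M.betti_basis κ
  have : Module.Finite E (M.HB κ) := Module.Finite.of_basis b
  have : Module.Finite ℂ (Ext σ (M.HB κ)) := Ext.finite σ
  have h1 : Submodule.span ℂ {v} ≤ M.hodge σ κ p := by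
    rwa [Submodule.span_singleton_le_iff_mem]
  exact (Submodule.eq_of_le_of_finrank_le h1 (by rwa [finrank_span_singleton hv0])).symm

/-- Nonzero vectors of the one-dimensional Hodge components form a basis. -/
theorem exists_hodge_basis (h : ∀ p, Module.finrank ℂ (M.hodge σ κ p) ≤ 1) {ι : Type} {p : ι → ℤ}
    (hp : Function.Injective p) (hT : ∀ i, M.hodge σ κ i ≠ ⊥ → ∃ m, p m = i)
    {v : ι → Ext σ (M.HB κ)} (hv : ∀ m, v m ∈ M.hodge σ κ (p m)) (hv0 : ∀ m, v m ≠ 0) :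
    ∃ b : Module.Basis ι ℂ (Ext σ (M.HB κ)), ⇑b = v := by
  have hli : LinearIndependent ℂ v :=
    ((M.hodge_internal σ κ).submodule_iSupIndep.comp hp).linearIndependent _ hv hv0
  have hsp : ⊤ ≤ Submodule.span ℂ (Set.range v) := by
    rw [← (M.hodge_internal σ κ).submodule_iSup_eq_top, iSup_le_iff]
    intro i
    by_cases hi : M.hodge σ κ i = ⊥
    · rw [hi]
      exact bot_le
    · obtain ⟨m, rfl⟩ := hT i hi
      rw [M.hodge_eq_span (h _) (hv m) (hv0 m)]
      exact Submodule.span_mono (Set.singleton_subset_iff.2 ⟨m, rfl⟩)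
  exact ⟨Module.Basis.mk hli hsp, Module.Basis.coe_mk hli hsp⟩

theorem card_hodgeTypes (h : ∀ p, Module.finrank ℂ (M.hodge σ κ p) ≤ 1) :
    (M.hodgeTypes σ κ).card = M.rank := by
  obtain ⟨b⟩ := M.betti_basis κ
  have h1 := fun m => Submodule.exists_mem_ne_zero_of_ne_bot
    (M.hodge_hodgeP_ne_bot (σ := σ) (κ := κ) rfl m)
  choose v hv hv0 using h1
  obtain ⟨c, -⟩ := M.exists_hodge_basis h (M.hodgeP_strictMono rfl).injective
    (fun i hi => M.exists_hodgeP_eq rfl hi) hv hv0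
  have h2 := Module.finrank_eq_card_basis c
  rwa [Ext.finrank_of_basis σ b, Fintype.card_fin, eq_comm] at h2

theorem map_finf_injective (h : κ' = conjugate κ) :
    Function.Injective (Ext.map σ (M.Finf κ κ' h)) := fun x y hxy => by
  have h' : κ = conjugate κ' := by rw [h]; exact (involutive_conjugate F κ).symm
  rw [← M.map_finf_finf h h' x, hxy, M.map_finf_finf]

theorem map_finf_mem_hodge (h : κ' = conjugate κ) {p : ℤ} {x : Ext σ (M.HB κ)}
    (hx : x ∈ M.hodge σ κ p) : Ext.map σ (M.Finf κ κ' h) x ∈ M.hodge σ κ' (M.weight - p) := by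
  rw [← M.hodge_Finf σ κ κ' h p]
  exact Submodule.mem_map_of_mem hx

theorem hodge_conj_ne_bot (h : κ' = conjugate κ) {p : ℤ} (hp : M.hodge σ κ p ≠ ⊥) :
    M.hodge σ κ' (M.weight - p) ≠ ⊥ := by
  obtain ⟨x, hx, hx0⟩ := Submodule.exists_mem_ne_zero_of_ne_bot hp
  exact (Submodule.ne_bot_iff _).2 ⟨_, M.map_finf_mem_hodge h hx, fun h0 =>
    hx0 (M.map_finf_injective h (h0.trans (map_zero _).symm))⟩

/-- The Hodge types at complex conjugate embeddings: passing to the conjugate replaces `p` by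
`weight - p`, which reverses the order. -/
theorem hodgeP_conj (h : κ' = conjugate κ) {n : ℕ} (hn : (M.hodgeTypes σ κ).card = n)
    (hn' : (M.hodgeTypes σ κ').card = n) (m : Fin n) :
    M.hodgeP σ κ' (m + 1) = M.weight - M.hodgeP σ κ (Fin.rev m + 1) := by
  refine M.hodgeP_eq_of_strictMono hn' (f := fun m => M.weight - M.hodgeP σ κ (Fin.rev m + 1))
    (fun m => M.hodge_conj_ne_bot h (M.hodge_hodgeP_ne_bot hn _)) (fun a b hab => ?_) m
  have := M.hodgeP_strictMono hn (Fin.rev_lt_rev.2 hab)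
  simp only at this ⊢
  omega

end PureMotive

/-! ### Existence of rational and Hodge bases -/

/-- Vectors with a triangular matrix with respect to a basis form a basis, and the inverse matrix is
triangular as well. -/
theorem exists_triangular_basis {W : Type*} [AddCommGroup W] [Module ℂ W] {n : ℕ}
    (b : Module.Basis (Fin n) ℂ W) (w : Fin n → W) (h : ∀ m l, l < m → b.repr (w m) l = 0)
    (h0 : ∀ m, b.repr (w m) m ≠ 0) :
    ∃ Ω : Module.Basis (Fin n) ℂ W, ⇑Ω = w ∧ (∀ m l, l < m → Ω.repr (b m) l = 0) ∧
      ∀ m, Ω.repr (b m) m ≠ 0 := by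
  let A : Matrix (Fin n) (Fin n) ℂ := b.toMatrix w
  have hA : A.BlockTriangular OrderDual.toDual := fun i j hij => h j i hij
  have hdet : A.det ≠ 0 := by
    rw [Matrix.det_of_isLowerTriangular A hA]
    exact Finset.prod_ne_zero_iff.2 fun m _ => h0 m
  have hbas : LinearIndependent ℂ w ∧ Submodule.span ℂ (Set.range w) = ⊤ := by
    rw [Module.Basis.is_basis_iff_det b]
    exact isUnit_iff_ne_zero.2 hdet
  let Ω := Module.Basis.mk hbas.1 hbas.2.ge
  have hΩ : ⇑Ω = w := Module.Basis.coe_mk _ _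
  let B : Matrix (Fin n) (Fin n) ℂ := Ω.toMatrix b
  have hBA : B * A = 1 := by
    have := Module.Basis.toMatrix_mul_toMatrix_flip Ω b
    rwa [hΩ] at this
  have hinv : B = A⁻¹ := (Matrix.inv_eq_left_inv hBA).symm
  let hu : Invertible A := ⟨B, hBA, mul_eq_one_comm.1 hBA⟩
  have hB : B.BlockTriangular OrderDual.toDual := by
    rw [hinv]
    exact Matrix.blockTriangular_inv_of_blockTriangular hA
  refine ⟨Ω, hΩ, fun m l hlm => hB hlm, fun m h1 => ?_⟩
  have h2 : B.det ≠ 0 := by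
    intro h3
    have := congrArg Matrix.det hBA
    rw [Matrix.det_mul, h3, zero_mul, Matrix.det_one] at this
    exact zero_ne_one this
  rw [Matrix.det_of_isLowerTriangular B hB] at h2
  exact Finset.prod_ne_zero_iff.1 h2 m (Finset.mem_univ m) h1

/-- A Hodge basis extends to a pair of compatible bases.  As the graded pieces of the filtration are
lines, elements of `Fil^{p m}` outside the next step form a rational basis adapted to the
filtration, whose matrix with respect to the Hodge basis is triangular. -/
theorem PureMotive.exists_frame (M : PureMotive E F) {σ : E →+* ℂ} {κ : F →+* ℂ} {K : Subfield ℂ}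
    (hK : ∀ x, embTensor σ κ x ∈ K) (h : ∀ p, Module.finrank ℂ (M.hodge σ κ p) ≤ 1) {n : ℕ}
    {p : Fin n → ℤ} (hp : StrictMono p) (hT : ∀ i, M.hodge σ κ i ≠ ⊥ → ∃ m, p m = i)
    (b : Module.Basis (Fin n) ℂ (Ext σ (M.HB κ))) (hb : ∀ m, b m ∈ M.hodge σ κ (p m)) :
    ∃ fr : Frame M.toRealization σ κ K (Fin n), fr.h = b ∧ ∀ m, fr.lev m = p m := by
  obtain ⟨c⟩ := M.deRham_basis
  let c' := Ext.basis (embTensor σ κ) c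
  let b' := b.map (M.comp σ κ)
  -- the Hodge filtration in terms of the Hodge basis
  have hfil : ∀ q, Submodule.span ℂ (Ext.of (embTensor σ κ) '' (M.Fil q : Set M.HdR)) =
      Submodule.span ℂ (b' '' {m | q ≤ p m}) := by
    intro q
    have h1 : (⨆ i : {i : ℤ // q ≤ i}, M.hodge σ κ i.1) =
        Submodule.span ℂ (b '' {m | q ≤ p m}) := by
      apply le_antisymm
      · refine iSup_le fun i => ?_
        by_cases hi : M.hodge σ κ i.1 = ⊥
        · rw [hi]
          exact bot_le
        · obtain ⟨m, hm⟩ := hT _ hi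
          have h2 := M.hodge_eq_span (h _) (hb m) (b.ne_zero m)
          rw [← hm, h2]
          refine Submodule.span_mono (Set.singleton_subset_iff.2 ⟨m, ?_, rfl⟩)
          exact i.2.trans_eq hm.symm
      · rw [Submodule.span_le]
        rintro _ ⟨m, hm, rfl⟩
        exact Submodule.mem_iSup_of_mem (⟨p m, hm⟩ : {i : ℤ // q ≤ i}) (hb m)
    rw [M.fil_eq, h1, Submodule.map_span, ← Set.image_comp]
    rfl
  -- vectors of the filtration which do not belong to the next step
  have hex : ∀ m, ∃ x ∈ M.Fil (p m), b'.repr (Ext.of (embTensor σ κ) x) m ≠ 0 := by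
    intro m
    by_contra! hcon
    have h1 : Submodule.span ℂ (Ext.of (embTensor σ κ) '' (M.Fil (p m) : Set M.HdR)) ≤
        LinearMap.ker (b'.coord m) := by
      rw [Submodule.span_le]
      rintro _ ⟨x, hx, rfl⟩
      exact hcon x hx
    have h2 : b' m ∈ Submodule.span ℂ (b' '' {l | p m ≤ p l}) :=
      Submodule.subset_span ⟨m, le_refl (p m), rfl⟩
    rw [← hfil] at h2
    have h3 := h1 h2
    rw [LinearMap.mem_ker, Module.Basis.coord_apply, Module.Basis.repr_self,
      Finsupp.single_eq_same] at h3
    exact one_ne_zero h3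
  choose x hx hx0 using hex
  have hxrepr : ∀ m l, l < m → b'.repr (Ext.of (embTensor σ κ) (x m)) l = 0 := by
    intro m l hlm
    have h1 : Ext.of (embTensor σ κ) (x m) ∈
        Submodule.span ℂ (Ext.of (embTensor σ κ) '' (M.Fil (p m) : Set M.HdR)) :=
      Submodule.subset_span ⟨x m, hx m, rfl⟩
    rw [hfil, mem_span_image_iff_repr] at h1
    exact h1 l (not_le.2 (hp hlm))
  obtain ⟨Ω, hΩ, hΩb, hΩ0⟩ := exists_triangular_basis b' (fun m => Ext.of (embTensor σ κ) (x m))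
    hxrepr hx0
  have hc' : Submodule.span K (Set.range (Ext.of (embTensor σ κ) (V := M.HdR))) =
      Submodule.span K (Set.range c') := by
    have h1 := Ext.span_of_span hK (Set.range c)
    rw [c.span_eq, Submodule.top_coe, Set.image_univ, ← Set.range_comp] at h1
    rw [h1]
    congr 2
    ext i
    exact (Ext.basis_apply _ _ _).symm
  have hle : ∀ A : Set M.HdR, Submodule.span K (Ext.of (embTensor σ κ) '' A) ≤
      Submodule.span K (Set.range c') := fun A =>
    (Submodule.span_mono (Set.image_subset_range _ _)).trans_eq hc'
  have hleΩ : ∀ A : Set (Fin n), Submodule.span K (Ω '' A) ≤ Submodule.span K (Set.range c') := by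
    intro A
    rw [hΩ, ← Set.image_image (Ext.of (embTensor σ κ)) x A]
    exact hle _
  have hspan : ∀ q, Submodule.span ℂ (Ω '' {m | q ≤ p m}) =
      Submodule.span ℂ (b' '' {m | q ≤ p m}) := by
    intro q
    apply le_antisymm
    · rw [Submodule.span_le]
      rintro _ ⟨m, hm, rfl⟩
      rw [SetLike.mem_coe, mem_span_image_iff_repr]
      intro l hl
      rw [hΩ]
      exact hxrepr m l (hp.lt_iff_lt.1 (lt_of_not_ge fun h' => hl (le_trans hm h')))
    · rw [Submodule.span_le]
      rintro _ ⟨m, hm, rfl⟩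
      rw [SetLike.mem_coe, mem_span_image_iff_repr]
      intro l hl
      exact hΩb m l (hp.lt_iff_lt.1 (lt_of_not_ge fun h' => hl (le_trans hm h')))
  refine ⟨{
    mem := hK
    ω := Ω
    h := b
    lam := fun m => Ω.repr (b' m) m
    lam_ne := hΩ0
    lev := p
    top_eq := ?_
    fil_eq := fun q => ?_
    diag := fun m => rfl
    tri := fun m l hlm hlt => hΩb m l ?_ }, rfl, fun m => rfl⟩
  -- the `K`-spaces are subspaces of one `K`-form, so it suffices to compare their complex spans
  · rw [hc', ← Set.image_univ (f := Ω)]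
    refine eq_of_span_complex_eq c' le_rfl (hleΩ _) ?_
    rw [span_complex_span_subfield, span_complex_span_subfield, c'.span_eq, Set.image_univ,
      Ω.span_eq]
  · refine eq_of_span_complex_eq c' (hle _) (hleΩ _) ?_
    rw [span_complex_span_subfield, span_complex_span_subfield, hfil, hspan]
  · exact lt_of_le_of_ne (hp.le_iff_le.1 (not_lt.1 hlt)) hlm

end

noncomputable section

/-! ### Rational and Hodge bases at a place -/

variable {E F : Type*} [Field E] [CharZero E] [Field F] [CharZero F]

theorem Place.eq_conjugate_conj {F : Type*} [Field F] {τ : F →+* ℂ} (κ : Place τ) :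
    κ.1 = conjugate κ.conj.1 :=
  (involutive_conjugate F κ.1).symm

theorem Place.eq_conj {F : Type*} [Field F] {τ : F →+* ℂ} {κ κ' : Place τ}
    (h : κ'.1 = conjugate κ.1) : κ' = κ.conj :=
  Subtype.ext h

/-- If one embedding of a place is real, the place has only one embedding. -/
theorem Place.eq_of_conj_eq {F : Type*} [Field F] {τ : F →+* ℂ} {κ : Place τ} (h : κ.conj = κ)
    (κ' : Place τ) : κ' = κ := by
  have h1 : conjugate κ.1 = κ.1 := congrArg Subtype.val h
  refine Subtype.ext ?_
  rcases κ.2 with h2 | h2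
  · rcases κ'.2 with h3 | h3
    · rw [h2, h3]
    · exact h3.trans ((congrArg conjugate h2.symm).trans h1)
  · have h4 : τ = κ.1 :=
      (involutive_conjugate F τ).symm.trans ((congrArg conjugate h2.symm).trans h1)
    rcases κ'.2 with h3 | h3
    · exact h3.trans h4
    · exact h3.trans h2.symm

/-- The pairs `(κ, m)` for which the `m`-th Hodge vector at `κ` is chosen freely; the remaining
vectors are obtained by applying `F_∞`, which exchanges `(κ, m)` with `(ρκ, n - 1 - m)`. -/
def isChosen {F : Type*} [Field F] {τ : F →+* ℂ} {n : ℕ} (κ : Place τ) (m : Fin n) : Prop :=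
  if κ.conj = κ then m ≤ Fin.rev m else κ.1 = τ

theorem isChosen_or {F : Type*} [Field F] {τ : F →+* ℂ} {n : ℕ} (κ : Place τ) (m : Fin n) :
    isChosen κ m ∨ isChosen κ.conj (Fin.rev m) := by
  unfold isChosen
  by_cases h : κ.conj = κ
  · rw [if_pos h, if_pos (by rw [h, h]), Fin.rev_rev]
    exact le_total _ _
  · rw [if_neg h, if_neg (fun h' => h (by rw [Place.conj_conj] at h'; exact h'.symm))]
    rcases κ.2 with h1 | h1
    · exact Or.inl h1
    · right
      change conjugate κ.1 = τ
      rw [h1]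
      exact involutive_conjugate F τ

/-- Only the middle type of a real embedding is exchanged with itself. -/
theorem isChosen_and {F : Type*} [Field F] {τ : F →+* ℂ} {n : ℕ} {κ : Place τ} {m : Fin n}
    (h : isChosen κ m) (h' : isChosen κ.conj (Fin.rev m)) : κ.conj = κ ∧ Fin.rev m = m := by
  unfold isChosen at h h'
  by_cases hκ : κ.conj = κ
  · rw [if_pos hκ] at h
    rw [if_pos (by rw [hκ, hκ]), Fin.rev_rev] at h'
    exact ⟨hκ, le_antisymm h' h⟩
  · rw [if_neg hκ] at h
    rw [if_neg (fun h' => hκ (by rw [Place.conj_conj] at h'; exact h'.symm))] at h'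
    exact absurd (Subtype.ext (h'.trans h.symm)) hκ

namespace PureMotive

variable (M : PureMotive E F) {σ : E →+* ℂ} {τ : F →+* ℂ}

open Classical in
/-- The rational and Hodge bases of a regular motive: the levels are the Hodge types in increasing
order, and `F_∞` reverses the order. -/
theorem exists_frameFamily (hM : M.IsRegularAt σ τ) {K : Subfield ℂ}
    (hK : ∀ κ : Place τ, ∀ x, embTensor σ κ.1 x ∈ K) {n : ℕ} (hn : M.rank = n) :
    ∃ fam : FrameFamily M.toRealization σ τ K (Fin n),
      (∀ κ m, (fam.fr κ).lev m = M.hodgeP σ κ.1 (m + 1)) ∧ ∀ m, fam.bar m = Fin.rev m := by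
  have hcard : ∀ κ : Place τ, (M.hodgeTypes σ κ.1).card = n := fun κ =>
    (M.card_hodgeTypes (hM κ)).trans hn
  have hex := fun (κ : Place τ) (m : Fin n) =>
    Submodule.exists_mem_ne_zero_of_ne_bot (M.hodge_hodgeP_ne_bot (hcard κ) m)
  choose v hv hv0 using hex
  let w : ∀ κ : Place τ, Fin n → Ext σ (M.HB κ.1) := fun κ m =>
    if isChosen κ m then v κ m
    else Ext.map σ (M.Finf κ.conj.1 κ.1 κ.eq_conjugate_conj) (v κ.conj (Fin.rev m))
  have hFmem : ∀ (κ κ' : Place τ) (h : κ'.1 = conjugate κ.1) (m : Fin n) (x),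
      x ∈ M.hodge σ κ.1 (M.hodgeP σ κ.1 (m + 1)) →
      Ext.map σ (M.Finf κ.1 κ'.1 h) x ∈ M.hodge σ κ'.1 (M.hodgeP σ κ'.1 (Fin.rev m + 1)) := by
    intro κ κ' h m x hx
    rw [M.hodgeP_conj h (hcard κ) (hcard κ') (Fin.rev m), Fin.rev_rev]
    exact M.map_finf_mem_hodge h hx
  have hw : ∀ (κ : Place τ) (m : Fin n), w κ m ∈ M.hodge σ κ.1 (M.hodgeP σ κ.1 (m + 1)) := by
    intro κ m
    simp only [w]
    split_ifs with h
    · exact hv κ m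
    · have h1 := hFmem κ.conj κ κ.eq_conjugate_conj (Fin.rev m) _ (hv κ.conj (Fin.rev m))
      rwa [Fin.rev_rev] at h1
  have hw0 : ∀ κ m, w κ m ≠ 0 := by
    intro κ m
    simp only [w]
    split_ifs with h
    · exact hv0 κ m
    · exact fun h0 => hv0 _ _ (M.map_finf_injective _ (h0.trans (map_zero _).symm))
  have hbasis := fun κ : Place τ => M.exists_hodge_basis (hM κ)
    (M.hodgeP_strictMono (hcard κ)).injective (fun i hi => M.exists_hodgeP_eq (hcard κ) hi)
    (hw κ) (hw0 κ)
  choose b hb using hbasis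
  have hframe := fun κ : Place τ => M.exists_frame (hK κ) (hM κ) (M.hodgeP_strictMono (hcard κ))
    (fun i hi => M.exists_hodgeP_eq (hcard κ) hi) (b κ) (fun m => by rw [hb]; exact hw κ m)
  choose fr hfr hlev using hframe
  -- outside the middle type of a real place, `F_∞` maps the chosen vectors to the other ones
  have key : ∀ (κ κ' : Place τ) (h : κ'.1 = conjugate κ.1) (m : Fin n),
      ¬ (isChosen κ m ∧ isChosen κ.conj (Fin.rev m)) →
      Ext.map σ (M.Finf κ.1 κ'.1 h) (w κ m) = w κ' (Fin.rev m) := by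
    intro κ κ' h m hnot
    obtain rfl : κ' = κ.conj := Place.eq_conj h
    by_cases h1 : isChosen κ m
    · have h2 : ¬ isChosen κ.conj (Fin.rev m) := fun h2 => hnot ⟨h1, h2⟩
      simp only [w, if_pos h1, if_neg h2]
      have h3 : ∀ κ'' : Place τ, κ'' = κ → ∀ m'', m'' = m → ∀ hh : κ.conj.1 = conjugate κ''.1,
          Ext.map σ (M.Finf κ.1 κ.conj.1 h) (v κ m) =
            Ext.map σ (M.Finf κ''.1 κ.conj.1 hh) (v κ'' m'') := by
        rintro _ rfl _ rfl _
        rfl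
      exact h3 _ κ.conj_conj _ (Fin.rev_rev m) _
    · have h2 := (isChosen_or κ m).resolve_left h1
      simp only [w, if_neg h1, if_pos h2]
      exact M.map_finf_finf _ _ _
  -- in the middle type of a real place, `F_∞` is an involution of a line, hence a sign
  have hsgn : ∀ m : Fin n, ∃ s : ℤˣ, ∀ (κ κ' : Place τ) (h : κ'.1 = conjugate κ.1),
      Ext.map σ (M.Finf κ.1 κ'.1 h) (w κ m) = ((s : ℤ) : ℂ) • w κ' (Fin.rev m) := by
    intro m
    by_cases hfix : ∃ κ : Place τ, isChosen κ m ∧ isChosen κ.conj (Fin.rev m)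
    · obtain ⟨κ, hκ⟩ := hfix
      obtain ⟨h1, h2⟩ := isChosen_and hκ.1 hκ.2
      have hreal : κ.1 = conjugate κ.1 := (congrArg Subtype.val h1).symm
      have h3 := hFmem κ κ hreal m _ (hw κ m)
      rw [h2, M.hodge_eq_span (hM κ _) (hw κ m) (hw0 κ m), Submodule.mem_span_singleton] at h3
      obtain ⟨a, ha⟩ := h3
      have h4 := M.map_finf_finf hreal hreal (w κ m)
      rw [← ha, map_smul, ← ha, smul_smul] at h4
      have h5 : (a * a - 1) • w κ m = 0 := by
        rw [sub_smul, h4, one_smul, sub_self]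
      have h6 := (smul_eq_zero.1 h5).resolve_right (hw0 κ m)
      have h7 : ∃ s : ℤˣ, a = ((s : ℤ) : ℂ) := by
        rcases mul_self_eq_one_iff.1 (sub_eq_zero.1 h6) with h | h
        · exact ⟨1, by rw [h]; simp⟩
        · exact ⟨-1, by rw [h]; simp⟩
      obtain ⟨s, rfl⟩ := h7
      refine ⟨s, fun κ₁ κ₂ h => ?_⟩
      obtain rfl : κ₁ = κ := Place.eq_of_conj_eq h1 κ₁
      obtain rfl : κ₂ = κ₁ := Place.eq_of_conj_eq h1 κ₂
      rw [h2]
      exact ha.symm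
    · refine ⟨1, fun κ κ' h => ?_⟩
      rw [key κ κ' h m fun h' => hfix ⟨κ, h'⟩]
      simp
  choose sgn hsgn using hsgn
  refine ⟨{
    fr := fr
    bar := Fin.rev
    bar_bar := Fin.rev_rev
    sgn := sgn
    finf_h := fun κ κ' h m => ?_ }, hlev, fun m => rfl⟩
  rw [hfr, hfr, hb, hb]
  exact hsgn m κ κ' h

end PureMotive

namespace FrameFamily

variable {M N : Realization E F} {σ : E →+* ℂ} {τ : F →+* ℂ} {K : Subfield ℂ}
  {ι ι' : Type} [Fintype ι] [Fintype ι']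

/-- The bases of a tensor product. -/
def tensor (fM : FrameFamily M σ τ K ι) (fN : FrameFamily N σ τ K ι') :
    FrameFamily (M.tensor N) σ τ K (ι × ι') where
  fr κ := (fM.fr κ).tensor (fN.fr κ)
  bar x := (fM.bar x.1, fN.bar x.2)
  bar_bar x := Prod.ext (fM.bar_bar _) (fN.bar_bar _)
  sgn x := fM.sgn x.1 * fN.sgn x.2
  finf_h κ κ' h x := by
    change Ext.map σ ((M.tensor N).Finf κ.1 κ'.1 h) (Frame.tensorh (fM.fr κ) (fN.fr κ) x) =
      _ • Frame.tensorh (fM.fr κ') (fN.fr κ') (fM.bar x.1, fN.bar x.2)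
    rw [Frame.tensorh_apply, Frame.tensorh_apply, Realization.map_bettiTensor, fM.finf_h, fN.finf_h,
      TensorProduct.smul_tmul_smul, map_smul]
    congr 1
    push_cast
    ring

/-- The bases of an extension of scalars, at a place above the given one. -/
def baseChange {L : Type*} [Field L] [CharZero L] {j : F →+* L} {ι₀ : L →+* ℂ}
    (f : FrameFamily M σ τ K ι) (hτ : ∀ κ : Place ι₀, κ.1.comp j = τ ∨ κ.1.comp j = conjugate τ)
    (hK : ∀ κ : Place ι₀, ∀ x, embTensor σ κ.1 x ∈ K) :
    FrameFamily (M.baseChange j) σ ι₀ K ι where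
  fr κ := (f.fr ⟨κ.1.comp j, hτ κ⟩).baseChange (hK κ)
  bar := f.bar
  bar_bar := f.bar_bar
  sgn := f.sgn
  finf_h κ κ' h m := f.finf_h ⟨κ.1.comp j, hτ κ⟩ ⟨κ'.1.comp j, hτ κ'⟩
    (by change κ'.1.comp j = _; rw [h, conjugate_comp]) m

end FrameFamily

end

noncomputable section

/-! ### Bases of the eigenspaces of `F_∞` -/

variable {E F : Type*} [Field E] [CharZero E] [Field F] [CharZero F]

/-- A basis `u` of a space spanned by a finite family `y` is related by an invertible matrix to a
basis consisting of members of `y`. -/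
theorem exists_basis_of_span_eq {V : Type*} [AddCommGroup V] [Module ℂ V] {J X : Type*} [Fintype J]
    [DecidableEq J] [Finite X] {u : J → V} (hu : LinearIndependent ℂ u) {y : X → V}
    (h : Submodule.span ℂ (Set.range u) = Submodule.span ℂ (Set.range y)) :
    ∃ (w : J → V) (H : Matrix J J ℂ), LinearIndependent ℂ w ∧ (∀ j, ∃ x, w j = y x) ∧
      (∀ j, u j = ∑ i, H i j • w i) ∧ H.det ≠ 0 := by
  obtain ⟨s, hs, hsspan, hsli⟩ := exists_linearIndependent ℂ (Set.range y)
  have hsfin : s.Finite := (Set.finite_range _).subset hs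
  have : Fintype s := hsfin.fintype
  let W := Submodule.span ℂ (Set.range u)
  obtain ⟨bU, hbU⟩ : ∃ bU : Module.Basis J ℂ W, ∀ j, ((bU j : W) : V) = u j :=
    ⟨Module.Basis.span hu, fun j => congrArg Subtype.val (Module.Basis.span_apply hu j)⟩
  obtain ⟨bS, hbS⟩ : ∃ bS : Module.Basis s ℂ W, ∀ j, ((bS j : W) : V) = j := by
    have hW : Submodule.span ℂ (Set.range ((↑) : s → V)) = W := by
      rw [Subtype.range_coe, hsspan, ← h]
    refine ⟨(Module.Basis.span hsli).map (LinearEquiv.ofEq _ _ hW), fun j => ?_⟩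
    rw [Module.Basis.map_apply, LinearEquiv.coe_ofEq_apply]
    exact congrArg Subtype.val (Module.Basis.span_apply hsli j)
  obtain ⟨w, hw⟩ : ∃ w : Module.Basis J ℂ W, ∀ j, ∃ x, ((w j : W) : V) = y x := by
    refine ⟨bS.reindex (bS.indexEquiv bU), fun j => ?_⟩
    rw [Module.Basis.reindex_apply, hbS]
    obtain ⟨x, hx⟩ := hs ((bS.indexEquiv bU).symm j).2
    exact ⟨x, hx.symm⟩
  refine ⟨fun j => w j, w.toMatrix bU, w.linearIndependent.map' _ (Submodule.ker_subtype _), hw,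
    fun j => ?_, ?_⟩
  · rw [← hbU]
    refine (congrArg Subtype.val (w.sum_repr (bU j))).symm.trans ?_
    rw [Submodule.coe_sum]
    rfl
  · have h1 := congrArg Matrix.det (Module.Basis.toMatrix_mul_toMatrix_flip w bU)
    rw [Matrix.det_mul, Matrix.det_one] at h1
    exact left_ne_zero_of_mul_eq_one h1

theorem sign_mul_self {R : Type*} [Ring R] (ε : ℤˣ) : ((ε : ℤ) : R) * ((ε : ℤ) : R) = 1 := by
  rcases Int.units_eq_one_or ε with rfl | rfl <;> simp

theorem Realization.finite_betti {R : Realization E F} {τ : F →+* ℂ}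
    (h : ∀ κ : Place τ, Module.Finite E (R.HB κ.1)) : Module.Finite E (R.Betti τ) :=
  Module.Finite.pi

namespace Realization

variable (R : Realization E F) {σ : E →+* ℂ} {τ : F →+* ℂ} (ε : ℤˣ)

/-- `x ↦ x + ε F_∞ x`, with values in the `ε`-eigenspace. -/
def symmetrize : R.Betti τ →ₗ[E] R.Betti τ := LinearMap.id + ((ε : ℤ) : E) • R.frob τ

variable (σ τ) in
/-- The complex linear extension of `symmetrize`. -/
def symmetrizeC : R.BettiC σ τ →ₗ[ℂ] R.BettiC σ τ := LinearMap.id + ((ε : ℤ) : ℂ) • R.frobC σ τ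

theorem symmetrize_apply (x : R.Betti τ) : R.symmetrize ε x = x + ((ε : ℤ) : E) • R.frob τ x := rfl

theorem symmetrizeC_apply (x : R.BettiC σ τ) :
    R.symmetrizeC σ τ ε x = x + ((ε : ℤ) : ℂ) • R.frobC σ τ x := rfl

theorem bettiOf_symmetrize (x : R.Betti τ) :
    R.bettiOf σ τ (R.symmetrize ε x) = R.symmetrizeC σ τ ε (R.bettiOf σ τ x) := by
  rw [symmetrize_apply, symmetrizeC_apply, map_add, map_smulₛₗ, frobC_bettiOf, map_intCast]

theorem symmetrize_mem (x : R.Betti τ) : R.symmetrize ε x ∈ R.bettiSign τ ε := by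
  rw [mem_bettiSign, symmetrize_apply, map_add, map_smul, frob_frob, smul_add, smul_smul,
    sign_mul_self, one_smul, add_comm]

theorem frobC_symmetrizeC (x : R.BettiC σ τ) :
    R.frobC σ τ (R.symmetrizeC σ τ ε x) = ((ε : ℤ) : ℂ) • R.symmetrizeC σ τ ε x := by
  rw [symmetrizeC_apply, map_add, map_smul, frobC_frobC, smul_add, smul_smul,
    sign_mul_self, one_smul, add_comm]

theorem symmetrizeC_single {κ : Place τ} (hκ : κ.conj ≠ κ) (x : Ext σ (R.HB κ.1)) :
    R.symmetrizeC σ τ ε (Pi.single κ x) κ = x := by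
  have h2 : R.frobC σ τ (Pi.single κ x) κ = 0 := by
    change Ext.map σ _ ((Pi.single κ x : R.BettiC σ τ) κ.conj) = 0
    rw [Pi.single_eq_of_ne hκ, map_zero]
  rw [R.symmetrizeC_apply, Pi.add_apply, Pi.smul_apply, h2, smul_zero, add_zero, Pi.single_eq_same]

/-- At a real place, there is only one component. -/
theorem ker_proj_eq_bot {κ : Place τ} (hκ : κ.conj = κ) : LinearMap.ker
    (LinearMap.proj κ : R.BettiC σ τ →ₗ[ℂ] Ext σ (R.HB κ.1)) = ⊥ := by
  rw [LinearMap.ker_eq_bot']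
  intro x hx
  funext κ'
  obtain rfl := Place.eq_of_conj_eq hκ κ'
  exact hx

theorem range_symmetrizeC : LinearMap.range (R.symmetrizeC σ τ ε) =
    Module.End.eigenspace (R.frobC σ τ) ((ε : ℤ) : ℂ) := by
  apply le_antisymm
  · rintro _ ⟨x, rfl⟩
    exact Module.End.mem_eigenspace_iff.2 (R.frobC_symmetrizeC ε x)
  · intro x hx
    rw [Module.End.mem_eigenspace_iff] at hx
    refine ⟨(2⁻¹ : ℂ) • x, ?_⟩
    rw [map_smul, symmetrizeC_apply, hx, smul_smul, sign_mul_self, one_smul, ← two_smul ℂ x,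
      smul_smul, inv_mul_cancel₀ two_ne_zero, one_smul]

end Realization

/-- A basis of the rational eigenspace spans the complex eigenspace. -/
theorem Realization.span_bettiSign_basis (R : Realization E F) {σ : E →+* ℂ} {τ : F →+* ℂ} {ε : ℤˣ}
    {J : Type*} [Fintype J] (u : Module.Basis J E (R.bettiSign τ ε)) :
    Submodule.span ℂ (Set.range fun j => R.bettiOf σ τ (u j : R.Betti τ)) =
      LinearMap.range (R.symmetrizeC σ τ ε) := by
  apply le_antisymm
  · rw [Submodule.span_le, R.range_symmetrizeC]
    rintro _ ⟨j, rfl⟩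
    rw [SetLike.mem_coe, Module.End.mem_eigenspace_iff, R.frobC_bettiOf,
      R.mem_bettiSign.1 (u j).2, map_smulₛₗ, map_intCast]
  · rw [LinearMap.range_eq_map, ← R.span_range_bettiOf, Submodule.map_span, Submodule.span_le]
    rintro _ ⟨_, ⟨x, rfl⟩, rfl⟩
    rw [← R.bettiOf_symmetrize]
    have h1 := congrArg Subtype.val (u.sum_repr ⟨_, R.symmetrize_mem ε x⟩)
    rw [Submodule.coe_sum] at h1
    rw [← show _ = R.symmetrize ε x from h1, map_sum]
    refine Submodule.sum_mem _ fun j _ => ?_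
    rw [Submodule.coe_smul, map_smulₛₗ]
    exact Submodule.smul_mem _ _ (Submodule.subset_span ⟨j, rfl⟩)

namespace FrameFamily

variable {R : Realization E F} {σ : E →+* ℂ} {τ : F →+* ℂ} {K : Subfield ℂ} {ι : Type} [Fintype ι]
  (fam : FrameFamily R σ τ K ι)

theorem repr_symmetrizeC_mem (ε : ℤˣ) {x : R.BettiC σ τ}
    (hx : ∀ κ m, (fam.fr κ).h.repr (x κ) m ∈ K) (κ m) :
    (fam.fr κ).h.repr (R.symmetrizeC σ τ ε x κ) m ∈ K := by
  have h1 := fam.repr_frobC x κ (fam.bar m)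
  rw [fam.bar_bar] at h1
  rw [R.symmetrizeC_apply, Pi.add_apply, Pi.smul_apply, map_add, map_smul, Finsupp.add_apply,
    Finsupp.smul_apply, h1, smul_eq_mul]
  exact K.add_mem (hx _ _) (K.mul_mem (intCast_mem K _) (K.mul_mem (intCast_mem K _) (hx _ _)))

/-- Corresponding bases of the eigenspaces exist: the symmetrizations of the vectors of the Hodge
basis span the complex eigenspace, and their coordinates are rational. -/
theorem exists_eigenData (ε : ℤˣ) : Nonempty (fam.EigenData ε (Fin (R.dSign τ ε))) := by
  classical
  have hfin : ∀ κ : Place τ, Module.Finite E (R.HB κ.1) := fun κ =>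
    Module.Finite.of_basis (fam.nonempty_basis κ).some
  have hfin' : Module.Finite E (R.Betti τ) := Realization.finite_betti hfin
  obtain ⟨u⟩ : Nonempty (Module.Basis (Fin (R.dSign τ ε)) E (R.bettiSign τ ε)) :=
    ⟨Module.finBasis E _⟩
  have huli : LinearIndependent ℂ fun j => R.bettiOf σ τ (u j : R.Betti τ) :=
    fam.bettiOf_linearIndependent (u.linearIndependent.map' _ (Submodule.ker_subtype _))
  -- a basis of the complex eigenspace is found among the symmetrized vectors of the Hodge basis
  obtain ⟨hB, hBapply⟩ : ∃ hB : Module.Basis (Σ _ : Place τ, ι) ℂ (R.BettiC σ τ),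
      ∀ x, hB x = Pi.single x.1 ((fam.fr x.1).h x.2) :=
    ⟨Pi.basis fun κ => (fam.fr κ).h, fun x => Pi.basis_apply _ _⟩
  have hspan : Submodule.span ℂ (Set.range fun j => R.bettiOf σ τ (u j : R.Betti τ)) =
      Submodule.span ℂ (Set.range fun x => R.symmetrizeC σ τ ε (hB x)) := by
    rw [R.span_bettiSign_basis, LinearMap.range_eq_map, ← hB.span_eq, Submodule.map_span,
      ← Set.range_comp]
    rfl
  obtain ⟨w, H, hwli, hw, hH, hdet⟩ := exists_basis_of_span_eq huli hspan
  have hw_eig : ∀ j, R.frobC σ τ (w j) = ((ε : ℤ) : ℂ) • w j := fun j => by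
    obtain ⟨x, hx⟩ := hw j
    rw [hx]
    exact R.frobC_symmetrizeC ε _
  have hwK : ∀ j κ m, (fam.fr κ).h.repr (w j κ) m ∈ K := by
    intro j κ m
    obtain ⟨x, hx⟩ := hw j
    rw [hx]
    refine fam.repr_symmetrizeC_mem ε (fun κ m => ?_) κ m
    rw [hBapply]
    by_cases h : κ = x.1
    · subst h
      rw [Pi.single_eq_same, Module.Basis.repr_self, Finsupp.single_apply]
      split_ifs
      exacts [K.one_mem, K.zero_mem]
    · rw [Pi.single_eq_of_ne h, map_zero]
      exact K.zero_mem
  exact ⟨{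
    u := fun j => u j
    w := w
    H := H
    u_mem := fun j => (u j).2
    w_eig := hw_eig
    w_li := hwli
    w_repr := hwK
    u_eq := hH
    det_ne := hdet }⟩

/-- The matrix of an `E`-basis of the Betti space of an embedding with respect to the Hodge basis.
-/
def bettiMatrix (κ : Place τ) (v : Module.Basis ι E (R.HB κ.1)) : Matrix ι ι ℂ :=
  (fam.fr κ).h.toMatrix fun j => Ext.of σ (v j)

theorem det_bettiMatrix_ne_zero [DecidableEq ι] (κ : Place τ) (v : Module.Basis ι E (R.HB κ.1)) :
    (fam.bettiMatrix κ v).det ≠ 0 := by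
  have h1 : fam.bettiMatrix κ v = (fam.fr κ).h.toMatrix (Ext.basis σ v) := by
    ext i j
    rw [bettiMatrix, Module.Basis.toMatrix_apply, Module.Basis.toMatrix_apply, Ext.basis_apply]
  rw [h1]
  exact ((Matrix.isUnit_iff_isUnit_det _).1 (isUnit_iff_exists.2
    ⟨(Ext.basis σ v).toMatrix (fam.fr κ).h, Module.Basis.toMatrix_mul_toMatrix_flip _ _,
      Module.Basis.toMatrix_mul_toMatrix_flip _ _⟩)).ne_zero

/-- At a complex place, both eigenspaces are described by the Betti space of one embedding `κ`,
because `x ↦ x + ε F_∞ x` maps this space isomorphically to the `ε`-eigenspace. -/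
def complexEigenData [DecidableEq ι] (κ : Place τ) (hκ : κ.conj ≠ κ)
    (v : Module.Basis ι E (R.HB κ.1)) (ε : ℤˣ) : fam.EigenData ε ι where
  u j := R.symmetrize ε (Pi.single κ (v j))
  w j := R.symmetrizeC σ τ ε (Pi.single κ ((fam.fr κ).h j))
  H := fam.bettiMatrix κ v
  u_mem j := R.symmetrize_mem ε _
  w_eig j := R.frobC_symmetrizeC ε _
  w_li := by
    refine LinearIndependent.of_comp (LinearMap.proj κ : R.BettiC σ τ →ₗ[ℂ] Ext σ (R.HB κ.1)) ?_
    rw [show (LinearMap.proj κ : R.BettiC σ τ →ₗ[ℂ] Ext σ (R.HB κ.1)) ∘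
      (fun j => R.symmetrizeC σ τ ε (Pi.single κ ((fam.fr κ).h j))) = (fam.fr κ).h from
        funext fun j => R.symmetrizeC_single ε hκ _]
    exact (fam.fr κ).h.linearIndependent
  w_repr j κ' m := by
    refine fam.repr_symmetrizeC_mem ε (fun κ' m => ?_) κ' m
    by_cases h : κ' = κ
    · subst h
      classical
      rw [Pi.single_eq_same, Module.Basis.repr_self, Finsupp.single_apply]
      split_ifs
      exacts [K.one_mem, K.zero_mem]
    · rw [Pi.single_eq_of_ne h, map_zero]
      exact K.zero_mem
  u_eq j := by
    have h1 : R.bettiOf σ τ (Pi.single κ (v j)) = Pi.single κ (Ext.of σ (v j)) := by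
      ext κ'
      by_cases h : κ' = κ
      · subst h
        simp [Realization.bettiOf]
      · simp [Realization.bettiOf, h]
    have h2 : (Pi.single κ (Ext.of σ (v j)) : R.BettiC σ τ) =
        ∑ i, fam.bettiMatrix κ v i j • Pi.single κ ((fam.fr κ).h i) := by
      have h3 := (fam.fr κ).h.sum_repr (Ext.of σ (v j))
      have h4 := congrArg (LinearMap.single ℂ (fun κ : Place τ => Ext σ (R.HB κ.1)) κ) h3
      rw [map_sum] at h4
      refine h4.symm.trans (Finset.sum_congr rfl fun i _ => ?_)
      rw [map_smul]
      rfl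
    rw [R.bettiOf_symmetrize, h1, h2, map_sum]
    exact Finset.sum_congr rfl fun i _ => map_smul _ _ _
  det_ne := fam.det_bettiMatrix_ne_zero κ v

/-- `F_∞` transports a Betti basis to the conjugate embedding; the determinants agree up to a sign.
-/
theorem exists_bettiMatrix_conj [DecidableEq ι] {κ κ' : Place τ} (h : κ'.1 = conjugate κ.1)
    (v : Module.Basis ι E (R.HB κ.1)) : ∃ v' : Module.Basis ι E (R.HB κ'.1),
      EqUpTo K (fam.bettiMatrix κ' v').det (fam.bettiMatrix κ v).det := by
  have h' : κ.1 = conjugate κ'.1 := by rw [h]; exact (involutive_conjugate F κ.1).symm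
  let e : R.HB κ.1 ≃ₗ[E] R.HB κ'.1 := LinearEquiv.ofLinearMap (R.Finf _ _ h) (R.Finf _ _ h')
    (LinearMap.ext fun x => R.Finf_Finf _ _ _ _ x) (LinearMap.ext fun x => R.Finf_Finf _ _ _ _ x)
  refine ⟨v.map e, ?_⟩
  let p : Equiv.Perm ι := ⟨fam.bar, fam.bar, fam.bar_bar, fam.bar_bar⟩
  have h1 : (fam.bettiMatrix κ' (v.map e)).submatrix p id =
      Matrix.diagonal (fun i => ((fam.sgn i : ℤ) : ℂ)) * fam.bettiMatrix κ v := by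
    ext i j
    rw [Matrix.diagonal_mul, Matrix.submatrix_apply, bettiMatrix, bettiMatrix,
      Module.Basis.toMatrix_apply, Module.Basis.toMatrix_apply, Module.Basis.map_apply]
    have h2 : Ext.of σ (e (v j)) = Ext.map σ (R.Finf _ _ h) (Ext.of σ (v j)) :=
      (Ext.map_of _ _ _).symm
    have hκ : κ = κ'.conj := Place.eq_conj h'
    subst hκ
    have h3 := fam.repr_frobC (Pi.single κ'.conj (Ext.of σ (v j))) κ' i
    rw [Pi.single_eq_same] at h3
    rw [id, h2, ← h3]
    change _ = (fam.fr κ').h.repr (Ext.map σ _ ((Pi.single κ'.conj (Ext.of σ (v j)) :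
      R.BettiC σ τ) κ'.conj)) _
    rw [Pi.single_eq_same]
    rfl
  have h2 := congrArg Matrix.det h1
  rw [Matrix.det_permute, Matrix.det_mul, Matrix.det_diagonal] at h2
  have h3 : ∀ s : ℤˣ, ((s : ℤ) : ℂ) ≠ 0 := fun s => by
    rcases Int.units_eq_one_or s with rfl | rfl <;> simp
  refine (EqUpTo.mul_left (intCast_mem K _) (h3 (Equiv.Perm.sign p))).symm.trans ?_
  rw [h2]
  exact EqUpTo.mul_left (K.prod_mem fun i _ => intCast_mem K _)
    (Finset.prod_ne_zero_iff.2 fun i _ => h3 _)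

end FrameFamily

end

noncomputable section

/-! ### Eigenspaces of tensor products -/

variable {E F : Type*} [Field E] [CharZero E] [Field F] [CharZero F]

namespace Realization

variable (M N : Realization E F) {σ : E →+* ℂ} {τ : F →+* ℂ}

/-- The product of two elements of the Betti spaces of a place, formed at every embedding. -/
def placeMul (x : M.Betti τ) (y : N.Betti τ) : (M.tensor N).Betti τ :=
  fun κ => M.bettiMul N κ.1 (x κ) (y κ)

/-- The product of two elements of the complex Betti spaces of a place. -/
def placeMulC : M.BettiC σ τ →ₗ[ℂ] N.BettiC σ τ →ₗ[ℂ] (M.tensor N).BettiC σ τ :=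
  LinearMap.mk₂ ℂ (fun x y κ => M.bettiTensor N σ κ.1 (x κ ⊗ₜ y κ))
    (fun x x' y => funext fun κ => by
      rw [Pi.add_apply, TensorProduct.add_tmul, map_add]; rfl)
    (fun a x y => funext fun κ => by
      rw [Pi.smul_apply, ← TensorProduct.smul_tmul', map_smul]; rfl)
    (fun x y y' => funext fun κ => by
      rw [Pi.add_apply, TensorProduct.tmul_add, map_add]; rfl)
    (fun a x y => funext fun κ => by
      rw [Pi.smul_apply, TensorProduct.tmul_smul, map_smul]; rfl)

theorem placeMulC_apply (x : M.BettiC σ τ) (y : N.BettiC σ τ) (κ : Place τ) :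
    M.placeMulC N x y κ = M.bettiTensor N σ κ.1 (x κ ⊗ₜ y κ) := rfl

theorem bettiOf_placeMul (x : M.Betti τ) (y : N.Betti τ) :
    (M.tensor N).bettiOf σ τ (M.placeMul N x y) =
      M.placeMulC N (M.bettiOf σ τ x) (N.bettiOf σ τ y) :=
  funext fun κ => (M.bettiTensor_of N σ κ.1 (x κ) (y κ)).symm

theorem frob_placeMul (x : M.Betti τ) (y : N.Betti τ) :
    (M.tensor N).frob τ (M.placeMul N x y) = M.placeMul N (M.frob τ x) (N.frob τ y) :=
  funext fun κ => M.finf_bettiMul N _ (x κ.conj) (y κ.conj)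

theorem frobC_placeMulC (x : M.BettiC σ τ) (y : N.BettiC σ τ) :
    (M.tensor N).frobC σ τ (M.placeMulC N x y) =
      M.placeMulC N (M.frobC σ τ x) (N.frobC σ τ y) :=
  funext fun κ => M.map_bettiTensor N σ _ (x κ.conj) (y κ.conj)

theorem placeMul_mem {ε ε' : ℤˣ} {x : M.Betti τ} {y : N.Betti τ} (hx : x ∈ M.bettiSign τ ε)
    (hy : y ∈ N.bettiSign τ ε') : M.placeMul N x y ∈ (M.tensor N).bettiSign τ (ε * ε') := by
  rw [mem_bettiSign] at hx hy ⊢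
  rw [frob_placeMul, hx, hy]
  funext κ
  change M.bettiMul N κ.1 (((ε : ℤ) : E) • x κ) (((ε' : ℤ) : E) • y κ) =
    (((ε * ε' : ℤˣ) : ℤ) : E) • M.bettiMul N κ.1 (x κ) (y κ)
  rw [LinearMap.map_smul₂, map_smul, smul_smul]
  push_cast
  rfl

theorem linearIndependent_bettiTensor {κ : F →+* ℂ} {J J' : Type*} {a : J → Ext σ (M.HB κ)}
    {b : J' → Ext σ (N.HB κ)} (ha : LinearIndependent ℂ a) (hb : LinearIndependent ℂ b) :
    LinearIndependent ℂ fun p : J × J' => M.bettiTensor N σ κ (a p.1 ⊗ₜ b p.2) :=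
  (ha.tmul_of_flat_left hb).map' (M.bettiTensor N σ κ).toLinearMap (LinearEquiv.ker _)

end Realization

namespace FrameFamily

variable {M N R : Realization E F} {σ : E →+* ℂ} {τ : F →+* ℂ} {K : Subfield ℂ}
  {ι ι' : Type} [Fintype ι] [Fintype ι'] {fM : FrameFamily M σ τ K ι} {fN : FrameFamily N σ τ K ι'}
  {J J' : Type} [Fintype J] [DecidableEq J] [Fintype J'] [DecidableEq J']

/-- Eigenvectors of a tensor product formed from eigenvectors of the factors.  Their linear
independence is left as a hypothesis, since it is checked on the components at one embedding. -/
def EigenData.mul {ε ε' : ℤˣ} (d : fM.EigenData ε J) (d' : fN.EigenData ε' J')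
    (hli : LinearIndependent ℂ fun p : J × J' => M.placeMulC N (d.w p.1) (d'.w p.2)) :
    (fM.tensor fN).EigenData (ε * ε') (J × J') where
  u p := M.placeMul N (d.u p.1) (d'.u p.2)
  w p := M.placeMulC N (d.w p.1) (d'.w p.2)
  H := Matrix.kroneckerMap (· * ·) d.H d'.H
  u_mem p := M.placeMul_mem N (d.u_mem _) (d'.u_mem _)
  w_eig p := by
    rw [M.frobC_placeMulC, d.w_eig, d'.w_eig, LinearMap.map_smul₂, map_smul, smul_smul]
    push_cast
    rfl
  w_li := hli
  w_repr p κ m := by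
    rw [M.placeMulC_apply]
    have h1 := Frame.tensorh_repr (fM.fr κ) (fN.fr κ) (d.w p.1 κ) (d'.w p.2 κ) m
    exact h1 ▸ K.mul_mem (d.w_repr _ _ _) (d'.w_repr _ _ _)
  u_eq p := by
    rw [M.bettiOf_placeMul, d.u_eq, d'.u_eq, LinearMap.map_sum₂, Fintype.sum_prod_type]
    refine Finset.sum_congr rfl fun i _ => ?_
    rw [map_sum]
    refine Finset.sum_congr rfl fun i' _ => ?_
    rw [LinearMap.map_smul₂, map_smul, smul_smul, Matrix.kroneckerMap_apply]
  det_ne := by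
    rw [Matrix.det_kronecker]
    exact mul_ne_zero (pow_ne_zero _ d.det_ne) (pow_ne_zero _ d'.det_ne)

theorem EigenData.det_mul {ε ε' : ℤˣ} (d : fM.EigenData ε J) (d' : fN.EigenData ε' J') (hli) :
    (d.mul d' hli).H.det = d.H.det ^ Fintype.card J' * d'.H.det ^ Fintype.card J :=
  Matrix.det_kronecker d.H d'.H

variable {fam : FrameFamily R σ τ K ι}

/-- The union of two families of eigenvectors. -/
def EigenData.sum {ε : ℤˣ} (d : fam.EigenData ε J) (d' : fam.EigenData ε J')
    (hli : LinearIndependent ℂ (Sum.elim d.w d'.w)) : fam.EigenData ε (J ⊕ J') where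
  u := Sum.elim d.u d'.u
  w := Sum.elim d.w d'.w
  H := Matrix.fromBlocks d.H 0 0 d'.H
  u_mem p := by
    rcases p with p | p
    exacts [d.u_mem p, d'.u_mem p]
  w_eig p := by
    rcases p with p | p
    exacts [d.w_eig p, d'.w_eig p]
  w_li := hli
  w_repr p := by
    rcases p with p | p
    exacts [d.w_repr p, d'.w_repr p]
  u_eq p := by
    rw [Fintype.sum_sum_type]
    rcases p with p | p
    · exact (d.u_eq p).trans (((congrArg _ (Finset.sum_eq_zero fun i _ => zero_smul ℂ _)).trans
        (add_zero _)).symm)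
    · exact (d'.u_eq p).trans (((congrArg (· + _) (Finset.sum_eq_zero fun i _ =>
        zero_smul ℂ _)).trans (zero_add _)).symm)
  det_ne := by
    rw [Matrix.det_fromBlocks_zero₂₁]
    exact mul_ne_zero d.det_ne d'.det_ne

theorem EigenData.det_sum {ε : ℤˣ} (d : fam.EigenData ε J) (d' : fam.EigenData ε J') (hli) :
    (d.sum d' hli).H.det = d.H.det * d'.H.det :=
  Matrix.det_fromBlocks_zero₂₁ _ _ _

/-- At a real place, the eigenspaces of a tensor product are sums of tensor products of
eigenspaces. -/
theorem exists_realTensorData (κ : Place τ) (hκ : κ.conj = κ) {a b c e : ℕ}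
    (d₁ : fM.EigenData 1 (Fin a)) (d₂ : fM.EigenData (-1) (Fin b))
    {ε : ℤˣ} (d₁' : fN.EigenData ε (Fin c)) (d₂' : fN.EigenData (-ε) (Fin e)) :
    ∃ D : (fM.tensor fN).EigenData ε ((Fin a × Fin c) ⊕ (Fin b × Fin e)),
      D.H.det = d₁.H.det ^ c * d₁'.H.det ^ a * (d₂.H.det ^ e * d₂'.H.det ^ b) := by
  have hM : LinearIndependent ℂ fun j => Sum.elim d₁.w d₂.w j κ :=
    (d₁.sum_li d₂).map' _ (M.ker_proj_eq_bot hκ)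
  have hN : LinearIndependent ℂ fun j => Sum.elim d₁'.w d₂'.w j κ := by
    refine LinearIndependent.map' ?_ _ (N.ker_proj_eq_bot hκ)
    rcases Int.units_eq_one_or ε with rfl | rfl
    · exact d₁'.sum_li d₂'
    · have h1 := EigenData.sum_li (d := (d₂' : fN.EigenData 1 (Fin e))) d₁'
      have h2 := h1.comp _ (Equiv.sumComm (Fin c) (Fin e)).injective
      have h3 : Sum.elim d₂'.w d₁'.w ∘ Equiv.sumComm (Fin c) (Fin e) = Sum.elim d₁'.w d₂'.w := by
        funext j
        rcases j with j | j <;> rfl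
      rw [h3] at h2
      exact h2
  have hMN := M.linearIndependent_bettiTensor N hM hN
  have hli : ∀ {X : Type} (f : X → (Fin a ⊕ Fin b) × (Fin c ⊕ Fin e)), Function.Injective f →
      LinearIndependent ℂ fun p => M.placeMulC N (Sum.elim d₁.w d₂.w (f p).1)
        (Sum.elim d₁'.w d₂'.w (f p).2) := by
    intro X f hf
    exact LinearIndependent.of_comp
      (LinearMap.proj κ : (M.tensor N).BettiC σ τ →ₗ[ℂ] Ext σ ((M.tensor N).HB κ.1))
      (hMN.comp f hf)
  have h1 := hli (fun p : Fin a × Fin c => (Sum.inl p.1, Sum.inl p.2)) (fun p q h => by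
    simpa [Prod.ext_iff] using h)
  have h2 := hli (fun p : Fin b × Fin e => (Sum.inr p.1, Sum.inr p.2)) (fun p q h => by
    simpa [Prod.ext_iff] using h)
  have h3 := hli (Sum.elim (fun p : Fin a × Fin c => (Sum.inl p.1, Sum.inl p.2))
    (fun p : Fin b × Fin e => (Sum.inr p.1, Sum.inr p.2))) (by
      rintro (p | p) (q | q) h <;> simp_all [Prod.ext_iff])
  have hε₁ : (1 : ℤˣ) * ε = ε := one_mul ε
  have hε₂ : (-1 : ℤˣ) * -ε = ε := by rw [neg_mul_neg, one_mul]
  -- the signs are generalized in order to replace `1 * ε` and `-1 * -ε` by `ε` in the types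
  have D₁ : ∃ D₁ : (fM.tensor fN).EigenData ε (Fin a × Fin c),
      (∀ p, D₁.w p = M.placeMulC N (d₁.w p.1) (d₁'.w p.2)) ∧
      D₁.H.det = d₁.H.det ^ c * d₁'.H.det ^ a := by
    have h := d₁.det_mul d₁' h1
    rw [Fintype.card_fin, Fintype.card_fin] at h
    revert h
    generalize hD : d₁.mul d₁' h1 = D
    have hw : ∀ p, D.w p = M.placeMulC N (d₁.w p.1) (d₁'.w p.2) := by rw [← hD]; exact fun p => rfl
    clear hD
    revert D
    rw [hε₁]
    exact fun D hw h => ⟨D, hw, h⟩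
  have D₂ : ∃ D₂ : (fM.tensor fN).EigenData ε (Fin b × Fin e),
      (∀ p, D₂.w p = M.placeMulC N (d₂.w p.1) (d₂'.w p.2)) ∧
      D₂.H.det = d₂.H.det ^ e * d₂'.H.det ^ b := by
    have h := d₂.det_mul d₂' h2
    rw [Fintype.card_fin, Fintype.card_fin] at h
    revert h
    generalize hD : d₂.mul d₂' h2 = D
    have hw : ∀ p, D.w p = M.placeMulC N (d₂.w p.1) (d₂'.w p.2) := by rw [← hD]; exact fun p => rfl
    clear hD
    revert D
    rw [hε₂]
    exact fun D hw h => ⟨D, hw, h⟩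
  obtain ⟨D₁, hw₁, hD₁⟩ := D₁
  obtain ⟨D₂, hw₂, hD₂⟩ := D₂
  have hsum : LinearIndependent ℂ (Sum.elim D₁.w D₂.w) := by
    convert h3 using 1
    funext p
    rcases p with p | p
    exacts [hw₁ p, hw₂ p]
  refine ⟨D₁.sum D₂ hsum, ?_⟩
  rw [EigenData.det_sum, hD₁, hD₂]

/-- At a complex place, the eigenspaces of a tensor product are described by the Betti spaces of the
factors at one embedding: for `x` and `y` at the embedding `κ`, the `κ`-component of the product of
`x + ε F_∞ x` and `y + F_∞ y` is `x ⊗ y`. -/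
theorem exists_complexTensorData [DecidableEq ι] [DecidableEq ι'] (κ : Place τ) (hκ : κ.conj ≠ κ)
    (v : Module.Basis ι E (M.HB κ.1)) (v' : Module.Basis ι' E (N.HB κ.1)) (ε : ℤˣ) :
    ∃ D : (fM.tensor fN).EigenData ε (ι × ι'),
      D.H.det = (fM.bettiMatrix κ v).det ^ Fintype.card ι' *
        (fN.bettiMatrix κ v').det ^ Fintype.card ι := by
  let d := fM.complexEigenData κ hκ v ε
  let d' := fN.complexEigenData κ hκ v' 1
  have hli : LinearIndependent ℂ fun p : ι × ι' => M.placeMulC N (d.w p.1) (d'.w p.2) := by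
    refine LinearIndependent.of_comp
      (LinearMap.proj κ : (M.tensor N).BettiC σ τ →ₗ[ℂ] Ext σ ((M.tensor N).HB κ.1)) ?_
    have h1 := M.linearIndependent_bettiTensor N (fM.fr κ).h.linearIndependent
      (fN.fr κ).h.linearIndependent
    convert h1 using 1
    funext p
    change M.bettiTensor N σ κ.1 (M.symmetrizeC σ τ ε (Pi.single κ ((fM.fr κ).h p.1)) κ ⊗ₜ
      N.symmetrizeC σ τ 1 (Pi.single κ ((fN.fr κ).h p.2)) κ) = _
    rw [M.symmetrizeC_single ε hκ, N.symmetrizeC_single 1 hκ]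
  have h := d.det_mul d' hli
  revert h
  generalize d.mul d' hli = D
  revert D
  rw [mul_one]
  exact fun D h => ⟨D, h⟩

end FrameFamily

end

noncomputable section

/-! ### The fields of the periods -/

variable {E F : Type*} [Field E] [CharZero E] [Field F] [CharZero F]

theorem embTensor_mem {K : Subfield ℂ} {σ : E →+* ℂ} {κ : F →+* ℂ} (hσ : ∀ a, σ a ∈ K)
    (hκ : ∀ x, κ x ∈ K) (x : E ⊗[ℚ] F) : embTensor σ κ x ∈ K := by
  induction x using TensorProduct.induction_on with
  | zero => rw [map_zero]; exact K.zero_mem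
  | tmul a b =>
    have h : embTensor σ κ (a ⊗ₜ b) = σ a * κ b :=
      Algebra.TensorProduct.productMap_apply_tmul _ _ _ _
    rw [h]
    exact K.mul_mem (hσ a) (hκ b)
  | add x y hx hy => rw [map_add]; exact K.add_mem hx hy

theorem Place.mem_periodField {E F : Type*} [Field E] [Field F] (σ : E →+* ℂ) {τ : F →+* ℂ}
    (κ : Place τ) (x : F) : κ.1 x ∈ periodField σ τ := by
  refine (le_sup_right : conjClosure τ ≤ _) ?_
  rcases κ.2 with h | h
  · exact (le_sup_left : τ.fieldRange ≤ _) ⟨x, by rw [h]⟩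
  · exact (le_sup_right : (conjugate τ).fieldRange ≤ _) ⟨x, by rw [h]⟩

theorem embTensor_mem_periodField (σ : E →+* ℂ) {τ : F →+* ℂ} (κ : Place τ) (x : E ⊗[ℚ] F) :
    embTensor σ κ.1 x ∈ periodField σ τ :=
  embTensor_mem (YoshidaPeriod.mem_periodField σ τ) (κ.mem_periodField σ) x

/-- The field `F^{(τ,ρ)}` is stable under complex conjugation. -/
theorem conjClosure_subtype {F : Type*} [Field F] (τ : F →+* ℂ) :
    conjClosure (conjClosure τ).subtype = conjClosure τ := by
  have h1 : ∀ φ : F →+* ℂ, φ.fieldRange.map (starRingEnd ℂ) = (conjugate φ).fieldRange := fun φ =>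
    RingHom.map_fieldRange _ _
  have h2 : (conjugate (conjClosure τ).subtype).fieldRange = conjClosure τ := by
    have h3 : (conjugate (conjClosure τ).subtype).fieldRange =
        (conjClosure τ).subtype.fieldRange.map (starRingEnd ℂ) := (RingHom.map_fieldRange _ _).symm
    rw [h3, Subfield.fieldRange_subtype, conjClosure, Subfield.map_sup, h1, h1,
      involutive_conjugate F τ, sup_comm]
  rw [conjClosure, h2, Subfield.fieldRange_subtype, sup_idem]

theorem periodField_subtype {E F : Type*} [Field E] [Field F] (σ : E →+* ℂ) (τ : F →+* ℂ) :
    periodField σ (conjClosure τ).subtype = periodField σ τ := by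
  rw [periodField, periodField, conjClosure_subtype]

theorem not_isReal_subtype {F : Type*} [Field F] {τ : F →+* ℂ} (h : ¬ IsReal τ) :
    ¬ IsReal (conjClosure τ).subtype := by
  intro h'
  refine h (RingHom.ext fun x => ?_)
  exact RingHom.congr_fun h' (toConjClosure τ x)

theorem Place.conj_eq_of_isReal {F : Type*} [Field F] {τ : F →+* ℂ} (h : IsReal τ) (κ : Place τ) :
    κ.conj = κ := by
  refine Subtype.ext ?_
  change conjugate κ.1 = κ.1
  have h1 : conjugate τ = τ := h
  have h2 : κ.1 = τ := by
    rcases κ.2 with h2 | h2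
    exacts [h2, h2.trans h1]
  rw [h2, h1]

theorem Place.conj_ne_of_not_isReal {F : Type*} [Field F] {τ : F →+* ℂ} (h : ¬ IsReal τ)
    (κ : Place τ) : κ.conj ≠ κ := by
  intro h1
  have h2 : (⟨τ, Or.inl rfl⟩ : Place τ) = κ := Place.eq_of_conj_eq h1 _
  subst h2
  exact h (congrArg Subtype.val h1)

theorem Place.card_of_isReal {F : Type*} [Field F] {τ : F →+* ℂ} (h : IsReal τ) :
    Fintype.card (Place τ) = 1 :=
  Fintype.card_eq_one_iff.2 ⟨⟨τ, Or.inl rfl⟩, Place.eq_of_conj_eq (Place.conj_eq_of_isReal h _)⟩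

theorem Place.eq_or_eq_conj {F : Type*} [Field F] {τ : F →+* ℂ} (κ κ' : Place τ) :
    κ' = κ ∨ κ' = κ.conj := by
  have h3 := involutive_conjugate F τ
  rcases κ.2 with h | h <;> rcases κ'.2 with h' | h'
  · exact Or.inl (Subtype.ext (h'.trans h.symm))
  · exact Or.inr (Subtype.ext (h'.trans (congrArg conjugate h.symm)))
  · exact Or.inr (Subtype.ext (h'.trans (h3.symm.trans (congrArg conjugate h.symm))))
  · exact Or.inl (Subtype.ext (h'.trans h.symm))

theorem Place.card_of_not_isReal {F : Type*} [Field F] {τ : F →+* ℂ} (h : ¬ IsReal τ) :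
    Fintype.card (Place τ) = 2 := by
  let κ : Place τ := ⟨τ, Or.inl rfl⟩
  rw [← Finset.card_univ, Finset.card_eq_two]
  refine ⟨κ, κ.conj, (κ.conj_ne_of_not_isReal h).symm, ?_⟩
  ext κ'
  simpa using κ.eq_or_eq_conj κ'

/-! ### The periods of regular motives -/

namespace PureMotive

variable (M : PureMotive E F) {σ : E →+* ℂ} {τ : F →+* ℂ}

theorem numTypes_eq_rank (hM : M.IsRegularAt σ τ) (κ : Place τ) : M.numTypes σ κ.1 = M.rank :=
  M.card_hodgeTypes (hM κ)

theorem stepDim_eq (hM : M.IsRegularAt σ τ) {n : ℕ} (hn : M.rank = n) (m : Fin n) :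
    M.stepDim σ τ (m + 1) = Fintype.card (Place τ) := by
  rw [stepDim, finsum_eq_sum_of_fintype]
  have h1 : ∀ κ : Place τ, Module.finrank ℂ (M.hodge σ κ.1 (M.hodgeP σ κ.1 (m + 1))) = 1 := by
    intro κ
    have hcard : (M.hodgeTypes σ κ.1).card = n := (M.numTypes_eq_rank hM κ).trans hn
    obtain ⟨v, hv, hv0⟩ := Submodule.exists_mem_ne_zero_of_ne_bot (M.hodge_hodgeP_ne_bot hcard m)
    rw [M.hodge_eq_span (hM κ _) hv hv0, finrank_span_singleton hv0]
  simp [h1]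

/-- The Hodge types at the conjugate embedding are the numbers `q_i`. -/
theorem hodgeP_conj_eq_hodgeQ (hM : M.IsRegularAt σ τ) {n : ℕ} (hn : M.rank = n) (κ : Place τ)
    (m : Fin n) : M.hodgeP σ κ.conj.1 (m + 1) = M.hodgeQ σ κ.1 (n - m) := by
  rw [M.hodgeP_conj (κ := κ.1) (κ' := κ.conj.1) rfl ((M.numTypes_eq_rank hM κ).trans hn)
    ((M.numTypes_eq_rank hM κ.conj).trans hn), hodgeQ, Fin.val_rev]
  congr 3
  omega

end PureMotive

namespace FrameFamily

variable {M : PureMotive E F} {σ : E →+* ℂ} {τ : F →+* ℂ} {K : Subfield ℂ} {n : ℕ}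
  {fam : FrameFamily M.toRealization σ τ K (Fin n)}
  {J J' : Type} [Fintype J] [DecidableEq J] [Fintype J'] [DecidableEq J']

/-- The fundamental periods of a regular motive, including `c_0 = δ`, for which all exponents are
`1`. -/
theorem isFundamentalPeriod_eqUpTo (hK : periodField σ τ = K) (hM : M.IsRegularAt σ τ)
    (hn : M.rank = n) (hlev : ∀ κ m, (fam.fr κ).lev m = M.hodgeP σ κ.1 (m + 1))
    (hbar : ∀ m, fam.bar m = Fin.rev m) (d : fam.EigenData 1 J) (d' : fam.EigenData (-1) J')
    (hcard : Fintype.card J + Fintype.card J' = Fintype.card (Σ _ : Place τ, Fin n)) {β : ℕ} {x : ℂ}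
    (hx : M.IsFundamentalPeriod σ τ β x) :
    EqUpTo K x ((∏ m : Fin n, (∏ κ, (fam.fr κ).lam m) ^ betaExponent n β (m + 1)) *
      (d.H.det * d'.H.det)) := by
  by_cases hβ : β = 0
  · subst hβ
    rw [PureMotive.IsFundamentalPeriod, if_pos rfl] at hx
    have h := isDelta_eqUpTo hK d d' hcard hx
    rw [Finset.prod_comm] at h
    convert h using 2
    refine Finset.prod_congr rfl fun m _ => ?_
    rw [betaExponent, if_neg (by omega), if_pos (by omega), pow_one]
  · rw [PureMotive.IsFundamentalPeriod, if_neg hβ] at hx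
    obtain ⟨P, hP, f, hf0, hf, rfl⟩ := hx
    have ht : M.numTypes σ τ = n := (M.numTypes_eq_rank hM ⟨τ, Or.inl rfl⟩).trans hn
    rw [ht] at hP hf
    have hmono : ∀ κ, StrictMono (fam.fr κ).lev := fun κ => by
      have h := M.hodgeP_strictMono (σ := σ) (κ := κ.1) ((M.numTypes_eq_rank hM κ).trans hn)
      intro a b hab
      rw [hlev, hlev]
      exact h hab
    refine evalPoly_period_eqUpTo hK hmono hbar d d' hcard P (fun μ => ?_) (fun μ h1 h2 => ?_)
      hf0 hf
    · have h1 := hP (μ + 1) (by omega) (by omega)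
      have h2 : M.hodgeStep σ τ (μ + 1) =
          Submodule.span (periodField σ τ) (fam.ratBasis '' {i | μ ≤ i.2}) := by
        refine fam.ratPart_eq hK fun κ => ?_
        rw [(fam.fr κ).fil_eq]
        congr 2
        ext i
        change M.hodgeP σ κ.1 (μ + 1) ≤ (fam.fr κ).lev i ↔ μ ≤ i
        rw [← hlev, (hmono κ).le_iff_le]
      rwa [h2] at h1
    · have h := M.stepDim_eq hM hn ⟨μ - 1, by omega⟩
      rwa [show ((⟨μ - 1, _⟩ : Fin n) : ℕ) + 1 = μ from Nat.sub_add_cancel h1] at h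

/-- The periods `c^±` in even rank, if a step of the filtration has half the dimension at all
embeddings. -/
theorem isPeriod_eqUpTo_of_even {R : Realization E F} {fam : FrameFamily R σ τ K (Fin n)}
    (hK : periodField σ τ = K) (hbar : ∀ m, fam.bar m = Fin.rev m) {q : ℕ} (hq : n = 2 * q) {c : ℤ}
    (hc : ∀ κ m, (fam.fr κ).lev m < c ↔ (m : ℕ) < q) {ε : ℤˣ} (d : fam.EigenData ε J)
    (hcard : 2 * Fintype.card J = Fintype.card (Place τ) * n) {x : ℂ} (hx : R.IsPeriod σ τ ε x) :
    EqUpTo K x ((∏ m ∈ Finset.univ.filter (fun m : Fin n => (m : ℕ) < q),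
      ∏ κ, (fam.fr κ).lam m) * d.H.det) := by
  have h := fam.isPeriod_eqUpTo hK c (fun κ m => by
    rw [hc, ← not_lt, hc, hbar, Fin.val_rev]
    omega) d (by rw [hcard, Fintype.card_fin]) hx
  have h1 : ∀ κ, ∏ m with (fam.fr κ).lev m < c, (fam.fr κ).lam m =
      ∏ m ∈ Finset.univ.filter (fun m : Fin n => (m : ℕ) < q), (fam.fr κ).lam m := by
    intro κ
    refine Finset.prod_congr ?_ fun _ _ => rfl
    ext m
    simp [hc]
  simp_rw [h1] at h
  rwa [Finset.prod_comm] at h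

/-- The periods `c^±` of a tensor product, if the Hodge types of the factors interlace. -/
theorem isPeriod_tensor_eqUpTo {M N : Realization E F} {r : ℕ}
    {fM : FrameFamily M σ τ K (Fin (r + 1))} {fN : FrameFamily N σ τ K (Fin r)}
    (hK : periodField σ τ = K) (hbM : ∀ m, fM.bar m = Fin.rev m) (hbN : ∀ m, fN.bar m = Fin.rev m)
    {c : ℤ} (hc : ∀ κ a i, (fM.fr κ).lev a + (fN.fr κ).lev i < c ↔ (a : ℕ) + i < r)
    {ε : ℤˣ} (d : (fM.tensor fN).EigenData ε J)
    (hcard : 2 * Fintype.card J = Fintype.card (Place τ) * ((r + 1) * r)) {x : ℂ}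
    (hx : (M.tensor N).IsPeriod σ τ ε x) :
    EqUpTo K x ((∏ p : Fin (r + 1) × Fin r with (p.1 : ℕ) + p.2 < r,
      (∏ κ, (fM.fr κ).lam p.1) * (∏ κ, (fN.fr κ).lam p.2)) * d.H.det) := by
  have hlow : ∀ κ p, ((fM.tensor fN).fr κ).lev p < c ↔ (p.1 : ℕ) + p.2 < r := fun κ p =>
    hc κ p.1 p.2
  have h := (fM.tensor fN).isPeriod_eqUpTo hK c (fun κ p => by
    have hb : (fM.tensor fN).bar p = (Fin.rev p.1, Fin.rev p.2) :=
      Prod.ext (hbM p.1) (hbN p.2)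
    rw [hlow, ← not_lt, hlow, hb, Fin.val_rev, Fin.val_rev]
    omega) d (by rw [hcard]; simp) hx
  have h1 : ∀ κ, ∏ p with ((fM.tensor fN).fr κ).lev p < c, ((fM.tensor fN).fr κ).lam p =
      ∏ p : Fin (r + 1) × Fin r with (p.1 : ℕ) + p.2 < r,
        (fM.fr κ).lam p.1 * (fN.fr κ).lam p.2 := by
    intro κ
    refine Finset.prod_congr ?_ fun _ _ => rfl
    ext p
    simp [hlow]
  simp_rw [h1] at h
  rw [Finset.prod_comm] at h
  simpa only [Finset.prod_mul_distrib] using h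

end FrameFamily

/-! ### Interlacing Hodge types -/

namespace PureMotive

variable {M N : PureMotive E F} {σ : E →+* ℂ} {τ : F →+* ℂ}

/-- Inequalities between consecutive values of monotone functions determine the order of the sums
`f a + g i` relative to `1 - Q`. -/
theorem exists_cut_of_bounds {r : ℕ} {X : Type*} {f : X → Fin (r + 1) → ℤ} {g : X → Fin r → ℤ}
    (hf : ∀ x, StrictMono (f x)) {Q : ℤ}
    (h1 : ∀ x y (i : Fin r), 0 < f x (Fin.rev i.castSucc) + g y i + Q)
    (h2 : ∀ x y (i : Fin r), f x (Fin.rev i.succ) + g y i + Q ≤ 0) (x y) (a : Fin (r + 1))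
    (i : Fin r) : f x a + g y i < 1 - Q ↔ (a : ℕ) + i < r := by
  have h1 := h1 x y i
  have h2 := h2 x y i
  constructor
  · intro h
    by_contra hai
    have h3 : Fin.rev i.castSucc ≤ a := by
      rw [Fin.le_def, Fin.val_rev]
      simp only [Fin.val_castSucc]
      omega
    have := (hf x).monotone h3
    omega
  · intro h
    have h3 : a ≤ Fin.rev i.succ := by
      rw [Fin.le_def, Fin.val_rev]
      simp only [Fin.val_succ]
      omega
    have := (hf x).monotone h3
    omega

/-- If the Hodge types interlace at a real place, the step `Fil^c` of the tensor product, for a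
suitable `c`, is spanned by the products of the `a`-th and the `i`-th vectors with `a + i ≥ r`. -/
theorem Interlace.exists_cut (h : M.Interlace N σ τ) (hτ : IsReal τ) (hM : M.IsRegularAt σ τ)
    (hN : N.IsRegularAt σ τ) {r : ℕ} (hr : N.rank = r) (hr' : M.rank = r + 1) :
    ∃ c : ℤ, ∀ (κ κ' : Place τ) (a : Fin (r + 1)) (i : Fin r),
      M.hodgeP σ κ.1 (a + 1) + N.hodgeP σ κ'.1 (i + 1) < c ↔ (a : ℕ) + i < r := by
  obtain ⟨Q, hQ⟩ := h
  have ht : N.numTypes σ τ = r := (N.numTypes_eq_rank hN ⟨τ, Or.inl rfl⟩).trans hr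
  rw [ht] at hQ
  have hκ : ∀ κ : Place τ, κ.1 = τ := fun κ => congrArg Subtype.val
    (Place.eq_of_conj_eq (Place.conj_eq_of_isReal hτ ⟨τ, Or.inl rfl⟩) κ)
  refine ⟨1 - Q, exists_cut_of_bounds
    (f := fun (κ : Place τ) (a : Fin (r + 1)) => M.hodgeP σ κ.1 (a + 1))
    (g := fun (κ : Place τ) (i : Fin r) => N.hodgeP σ κ.1 (i + 1))
    (fun κ => M.hodgeP_strictMono ((M.numTypes_eq_rank hM κ).trans hr')) (fun κ κ' i => ?_)
    (fun κ κ' i => ?_)⟩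
  · have h1 := (hQ (i + 1) (by omega) (by omega)).1.1
    rw [hκ, hκ, Fin.val_rev, Fin.val_castSucc,
      show r + 1 - (i + 1) + 1 = r + 2 - (i + 1) by omega]
    omega
  · have h1 := (hQ (i + 1) (by omega) (by omega)).1.2
    rw [hκ, hκ, Fin.val_rev, Fin.val_succ,
      show r + 1 - (i + 1 + 1) + 1 = r + 1 - (i + 1) by omega]
    omega

/-- The analogous statement at a complex place, the Hodge types of the factors being taken at
arbitrary embeddings of the place. -/
theorem StrongInterlace.exists_cut (h : M.StrongInterlace N σ τ) (hM : M.IsRegularAt σ τ)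
    (hN : N.IsRegularAt σ τ) {r : ℕ} (hr : N.rank = r) (hr' : M.rank = r + 1) :
    ∃ c : ℤ, ∀ (κ κ' : Place τ) (a : Fin (r + 1)) (i : Fin r),
      M.hodgeP σ κ.1 (a + 1) + N.hodgeP σ κ'.1 (i + 1) < c ↔ (a : ℕ) + i < r := by
  obtain ⟨Q, hQ⟩ := h
  let κ₀ : Place τ := ⟨τ, Or.inl rfl⟩
  have ht : N.numTypes σ τ = r := (N.numTypes_eq_rank hN κ₀).trans hr
  rw [ht] at hQ
  have hMp : ∀ (κ : Place τ) (a : Fin (r + 1)), M.hodgeP σ κ.1 (a + 1) = M.hodgeP σ τ (a + 1) ∨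
      M.hodgeP σ κ.1 (a + 1) = M.hodgeQ σ τ (r + 1 - a) := by
    intro κ a
    rcases κ₀.eq_or_eq_conj κ with rfl | rfl
    · exact Or.inl rfl
    · exact Or.inr (M.hodgeP_conj_eq_hodgeQ hM hr' κ₀ a)
  have hNp : ∀ (κ : Place τ) (i : Fin r), N.hodgeP σ κ.1 (i + 1) = N.hodgeP σ τ (i + 1) ∨
      N.hodgeP σ κ.1 (i + 1) = N.hodgeQ σ τ (r - i) := by
    intro κ i
    rcases κ₀.eq_or_eq_conj κ with rfl | rfl
    · exact Or.inl rfl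
    · exact Or.inr (N.hodgeP_conj_eq_hodgeQ hN hr κ₀ i)
  refine ⟨1 - Q, exists_cut_of_bounds
    (f := fun (κ : Place τ) (a : Fin (r + 1)) => M.hodgeP σ κ.1 (a + 1))
    (g := fun (κ : Place τ) (i : Fin r) => N.hodgeP σ κ.1 (i + 1))
    (fun κ => M.hodgeP_strictMono ((M.numTypes_eq_rank hM κ).trans hr')) (fun κ κ' i => ?_)
    (fun κ κ' i => ?_)⟩
  · have h1 := (hQ (i + 1) (by omega) (by omega)).1
    have h2 := hMp κ (Fin.rev i.castSucc)
    have h3 := hNp κ' i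
    rw [Fin.val_rev, Fin.val_castSucc,
      show r + 1 - (r + 1 - (i + 1)) = i + 1 by omega,
      show r + 1 - (i + 1) + 1 = r + 2 - (i + 1) by omega] at h2
    rw [show r - (i : ℕ) = r + 1 - (i + 1) by omega] at h3
    rw [Fin.val_rev, Fin.val_castSucc, show r + 1 - (i + 1) + 1 = r + 2 - (i + 1) by omega]
    omega
  · have h1 := (hQ (i + 1) (by omega) (by omega)).2
    have h2 := hMp κ (Fin.rev i.succ)
    have h3 := hNp κ' i
    rw [Fin.val_rev, Fin.val_succ,
      show r + 1 - (r + 1 - (i + 1 + 1)) = i + 1 + 1 by omega,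
      show r + 1 - (i + 1 + 1) + 1 = r + 1 - (i + 1) by omega] at h2
    rw [show r - (i : ℕ) = r + 1 - (i + 1) by omega] at h3
    rw [Fin.val_rev, Fin.val_succ, show r + 1 - (i + 1 + 1) + 1 = r + 1 - (i + 1) by omega]
    omega

end PureMotive

end

noncomputable section

/-! ### Exponents -/

/-- The total exponent of the `μ`-th step in `c_0, …, c_{k-1}`. -/
theorem sum_betaExponent {t μ : ℕ} (h1 : 1 ≤ μ) (h2 : μ ≤ t) (k : ℕ) (hk : 2 * k ≤ t + 2) :
    ∑ β ∈ Finset.range k, betaExponent t β μ = min k (t + 1 - μ) + (k - μ) := by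
  induction k with
  | zero => simp
  | succ k ih =>
    rw [Finset.sum_range_succ, ih (by omega), betaExponent]
    split_ifs <;> omega

theorem sum_Icc_betaExponent {t μ : ℕ} (h1 : 1 ≤ μ) (h2 : μ ≤ t) (k : ℕ) (hk : 2 * k ≤ t) :
    ∑ β ∈ Finset.Icc 1 k, betaExponent t β μ + 1 = min (k + 1) (t + 1 - μ) + (k + 1 - μ) := by
  rw [← sum_betaExponent h1 h2 (k + 1) (by omega), Finset.sum_range_succ']
  have h3 : betaExponent t 0 μ = 1 := by
    rw [betaExponent, if_neg (by omega), if_pos (by omega)]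
  have h4 : ∑ β ∈ Finset.Icc 1 k, betaExponent t β μ =
      ∑ β ∈ Finset.range k, betaExponent t (β + 1) μ := by
    rw [Finset.range_eq_Ico, Finset.sum_Ico_add' (fun β => betaExponent t β μ) 0 k 1]
    rfl
  rw [h3, h4]

theorem card_filter_add_lt (r a : ℕ) :
    (Finset.univ.filter fun i : Fin r => a + (i : ℕ) < r).card = r - a := by
  rw [Finset.card_filter, Fin.sum_univ_eq_sum_range (fun i => if a + i < r then 1 else 0) r,
    ← Finset.card_filter]
  have h : (Finset.range r).filter (fun i => a + i < r) = Finset.range (r - a) := by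
    ext i
    simp only [Finset.mem_filter, Finset.mem_range]
    omega
  rw [h, Finset.card_range]

theorem card_filter_add_lt' (r i : ℕ) :
    (Finset.univ.filter fun a : Fin (r + 1) => (a : ℕ) + i < r).card = r - i := by
  rw [Finset.card_filter, Fin.sum_univ_eq_sum_range (fun a => if a + i < r then 1 else 0) (r + 1),
    ← Finset.card_filter]
  have h : (Finset.range (r + 1)).filter (fun a => a + i < r) = Finset.range (r - i) := by
    ext i
    simp only [Finset.mem_filter, Finset.mem_range]
    omega
  rw [h, Finset.card_range]

/-- The exponents with which the factors of `M` and `N` occur in the periods of the tensor product.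
-/
theorem prod_filter_add_lt {r : ℕ} (f : Fin (r + 1) → ℂ) (g : Fin r → ℂ) :
    ∏ p : Fin (r + 1) × Fin r with (p.1 : ℕ) + p.2 < r, f p.1 * g p.2 =
      (∏ a, f a ^ (r - (a : ℕ))) * ∏ i, g i ^ (r - (i : ℕ)) := by
  rw [Finset.prod_mul_distrib, Finset.prod_filter, Finset.prod_filter, Fintype.prod_prod_type,
    Fintype.prod_prod_type_right]
  congr 1
  · refine Finset.prod_congr rfl fun a _ => ?_
    rw [← Finset.prod_filter]
    exact (Finset.prod_const (f a)).trans (congrArg _ (card_filter_add_lt r a))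
  · refine Finset.prod_congr rfl fun i _ => ?_
    rw [← Finset.prod_filter]
    exact (Finset.prod_const (g i)).trans (congrArg _ (card_filter_add_lt' r i))

theorem prod_fundamental_eqUpTo {K : Subfield ℂ} {t : ℕ} {f : Fin t → ℂ} {D : ℂ} {b : ℕ → ℂ}
    {s : Finset ℕ}
    (h : ∀ β ∈ s, EqUpTo K (b β) ((∏ m : Fin t, f m ^ betaExponent t β (m + 1)) * D)) :
    EqUpTo K (∏ β ∈ s, b β)
      ((∏ m : Fin t, f m ^ ∑ β ∈ s, betaExponent t β (m + 1)) * D ^ s.card) := by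
  convert EqUpTo.prod s h using 1
  rw [Finset.prod_mul_distrib, Finset.prod_const, Finset.prod_comm]
  simp_rw [Finset.prod_pow_eq_pow_sum]

theorem prod_filter_eq_prod_pow {t : ℕ} (f : Fin t → ℂ) (q : ℕ) :
    ∏ m ∈ Finset.univ.filter (fun m : Fin t => (m : ℕ) < q), f m =
      ∏ m : Fin t, f m ^ (if (m : ℕ) < q then 1 else 0) := by
  rw [Finset.prod_filter]
  refine Finset.prod_congr rfl fun m _ => ?_
  split_ifs <;> simp

/-- If the rank `r` of the second factor is even, the exponents of the fundamental periods and of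
one period `c^±` of the second factor add up to those of the tensor product. -/
theorem prod_eqUpTo_of_even {K : Subfield ℂ} {r q : ℕ} (hr : r = 2 * q) {f : Fin (r + 1) → ℂ}
    {g : Fin r → ℂ} {A B D x : ℂ} {b b' : ℕ → ℂ}
    (hb : ∀ β ∈ Finset.Icc 1 q,
      EqUpTo K (b β) ((∏ m : Fin (r + 1), f m ^ betaExponent (r + 1) β (m + 1)) * A))
    (hb' : ∀ β ∈ Finset.range q,
      EqUpTo K (b' β) ((∏ m : Fin r, g m ^ betaExponent r β (m + 1)) * B))
    (hx : EqUpTo K x ((∏ m ∈ Finset.univ.filter (fun m : Fin r => (m : ℕ) < q), g m) * D)) :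
    EqUpTo K ((∏ β ∈ Finset.Icc 1 q, b β) * (∏ β ∈ Finset.range q, b' β) * x)
      ((∏ p : Fin (r + 1) × Fin r with (p.1 : ℕ) + p.2 < r, f p.1 * g p.2) *
        (A ^ q * B ^ q * D)) := by
  have h := ((prod_fundamental_eqUpTo hb).mul (prod_fundamental_eqUpTo hb')).mul hx
  convert h using 1
  have h1 : ∏ a, f a ^ (r - (a : ℕ)) =
      ∏ m : Fin (r + 1), f m ^ ∑ β ∈ Finset.Icc 1 q, betaExponent (r + 1) β (m + 1) := by
    refine Finset.prod_congr rfl fun m _ => ?_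
    have := sum_Icc_betaExponent (t := r + 1) (μ := m + 1) (by omega) (by omega) q (by omega)
    congr 1
    omega
  have h2 : ∏ i, g i ^ (r - (i : ℕ)) =
      (∏ m : Fin r, g m ^ ∑ β ∈ Finset.range q, betaExponent r β (m + 1)) *
        ∏ m : Fin r, g m ^ (if (m : ℕ) < q then 1 else 0) := by
    rw [← Finset.prod_mul_distrib]
    refine Finset.prod_congr rfl fun m _ => ?_
    rw [← pow_add, sum_betaExponent (by omega) (by omega) q (by omega)]
    congr 1
    split_ifs <;> omega
  rw [prod_filter_add_lt, prod_filter_eq_prod_pow, h1, h2, Nat.card_Icc, Finset.card_range,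
    Nat.add_sub_cancel]
  ring

/-- If the rank `r + 1` of the first factor is even, the exponents of the fundamental periods and of
one period `c^±` of the first factor add up to those of the tensor product. -/
theorem prod_eqUpTo_of_odd {K : Subfield ℂ} {r q : ℕ} (hr : r = 2 * q + 1) {f : Fin (r + 1) → ℂ}
    {g : Fin r → ℂ} {A B D x : ℂ} {b b' : ℕ → ℂ}
    (hb : ∀ β ∈ Finset.Icc 1 q,
      EqUpTo K (b β) ((∏ m : Fin (r + 1), f m ^ betaExponent (r + 1) β (m + 1)) * A))
    (hb' : ∀ β ∈ Finset.range (q + 1),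
      EqUpTo K (b' β) ((∏ m : Fin r, g m ^ betaExponent r β (m + 1)) * B))
    (hx : EqUpTo K x
      ((∏ m ∈ Finset.univ.filter (fun m : Fin (r + 1) => (m : ℕ) < q + 1), f m) * D)) :
    EqUpTo K ((∏ β ∈ Finset.Icc 1 q, b β) * (∏ β ∈ Finset.range (q + 1), b' β) * x)
      ((∏ p : Fin (r + 1) × Fin r with (p.1 : ℕ) + p.2 < r, f p.1 * g p.2) *
        (A ^ q * B ^ (q + 1) * D)) := by
  have h := ((prod_fundamental_eqUpTo hb).mul (prod_fundamental_eqUpTo hb')).mul hx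
  convert h using 1
  have h1 : ∏ a, f a ^ (r - (a : ℕ)) =
      (∏ m : Fin (r + 1), f m ^ ∑ β ∈ Finset.Icc 1 q, betaExponent (r + 1) β (m + 1)) *
        ∏ m : Fin (r + 1), f m ^ (if (m : ℕ) < q + 1 then 1 else 0) := by
    rw [← Finset.prod_mul_distrib]
    refine Finset.prod_congr rfl fun m _ => ?_
    have := sum_Icc_betaExponent (t := r + 1) (μ := m + 1) (by omega) (by omega) q (by omega)
    rw [← pow_add]
    congr 1
    split_ifs <;> omega
  have h2 : ∏ i, g i ^ (r - (i : ℕ)) =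
      ∏ m : Fin r, g m ^ ∑ β ∈ Finset.range (q + 1), betaExponent r β (m + 1) := by
    refine Finset.prod_congr rfl fun m _ => ?_
    rw [sum_betaExponent (by omega) (by omega) (q + 1) (by omega)]
    congr 1
    omega
  rw [prod_filter_add_lt, prod_filter_eq_prod_pow, h1, h2, Nat.card_Icc, Finset.card_range,
    Nat.add_sub_cancel]
  ring

end

noncomputable section

/-! ### Periods of tensor products at a real place -/

variable {E F : Type*} [Field E] [CharZero E] [Field F] [CharZero F]

namespace FrameFamily

section Dimension

variable {R : Realization E F} {σ : E →+* ℂ} {τ : F →+* ℂ} {K : Subfield ℂ} {n : ℕ}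
  {fam : FrameFamily R σ τ K (Fin n)}

theorem dSign_add (hK : periodField σ τ = K) (fam : FrameFamily R σ τ K (Fin n))
    (P : R.PeriodMatrix σ τ) :
    R.dSign τ 1 + R.dSign τ (-1) = Fintype.card (Place τ) * n := by
  have h1 : R.dSign τ 1 = P.dp := by
    rw [Realization.dSign, Module.finrank_eq_card_basis P.uplus, Fintype.card_fin]
  have h2 : R.dSign τ (-1) = P.dm := by
    rw [Realization.dSign, Module.finrank_eq_card_basis P.uminus, Fintype.card_fin]
  rw [h1, h2, fam.card_eq hK P]
  simp

/-- At a real place, the eigenspaces have at most dimension `q + 1` in rank at most `2 q + 1`. -/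
theorem dSign_le (hτ : IsReal τ) (hbar : ∀ m, fam.bar m = Fin.rev m)
    (hlev : ∀ κ, StrictMono (fam.fr κ).lev) {q : ℕ} (hq : n ≤ 2 * q + 1) (ε : ℤˣ) :
    R.dSign τ ε ≤ q + 1 := by
  classical
  have hfin : Module.Finite E (R.Betti τ) := Realization.finite_betti fun κ =>
    Module.Finite.of_basis (fam.nonempty_basis κ).some
  let κ₀ : Place τ := ⟨τ, Or.inl rfl⟩
  by_cases hn : n ≤ q
  · have hfinC : Module.Finite ℂ (R.BettiC σ τ) :=
      Module.Finite.of_basis (Pi.basis fun κ => (fam.fr κ).h)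
    have h1 := (fam.exists_eigenData ε).some.w_li.fintype_card_le_finrank
    have h3 : Module.finrank ℂ (R.BettiC σ τ) = Fintype.card (Σ _ : Place τ, Fin n) :=
      Module.finrank_eq_card_basis (Pi.basis fun κ => (fam.fr κ).h)
    rw [h3, Fintype.card_sigma, Fintype.card_fin] at h1
    have h4 := Place.card_of_isReal hτ
    simp only [Fintype.card_fin, Finset.sum_const, Finset.card_univ, h4, one_smul] at h1
    omega
  · push Not at hn
    have hκ : ∀ κ : Place τ, κ = κ₀ := Place.eq_of_conj_eq (Place.conj_eq_of_isReal hτ κ₀)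
    have hlow : ∀ κ m, (fam.fr κ).lev m < (fam.fr κ₀).lev ⟨q, hn⟩ + 1 ↔ (m : ℕ) < q + 1 := by
      intro κ m
      rw [hκ κ, Int.lt_add_one_iff, (hlev κ₀).le_iff_le, Fin.le_def, Nat.lt_succ_iff]
    have h1 := fam.finrank_eigenspace_le ((fam.fr κ₀).lev ⟨q, hn⟩ + 1) (fun κ m h => by
      rw [← not_lt, hlow] at h
      rw [hlow, hbar, Fin.val_rev]
      omega) (Module.finBasis E (R.bettiSign τ ε))
    refine h1.trans ?_
    have h2 : Fintype.card {x : Σ _ : Place τ, Fin n //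
        (fam.fr x.1).lev x.2 < (fam.fr κ₀).lev ⟨q, hn⟩ + 1} ≤ Fintype.card (Fin (q + 1)) := by
      refine Fintype.card_le_of_injective (fun x => ⟨x.1.2, (hlow _ _).1 x.2⟩) fun x y h => ?_
      have h3 : x.1.2 = y.1.2 := Fin.ext (congrArg (fun z : Fin (q + 1) => (z : ℕ)) h)
      refine Subtype.ext (Sigma.ext ((hκ _).trans (hκ _).symm) (heq_of_eq h3))
    rwa [Fintype.card_fin] at h2

/-- In even rank, if a step of the filtration has half the dimension, both eigenspaces at a real
place have half the dimension as well. -/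
theorem dSign_eq (hK : periodField σ τ = K) (hτ : IsReal τ) (hbar : ∀ m, fam.bar m = Fin.rev m)
    {q : ℕ} (hq : n = 2 * q) {c : ℤ} (hc : ∀ κ m, (fam.fr κ).lev m < c ↔ (m : ℕ) < q)
    (P : R.PeriodMatrix σ τ) (ε : ℤˣ) : R.dSign τ ε = q := by
  classical
  have hfin : Module.Finite E (R.Betti τ) := Realization.finite_betti fun κ =>
    Module.Finite.of_basis (fam.nonempty_basis κ).some
  have hcut : ∀ κ m, (fam.fr κ).lev m < c ↔ c ≤ (fam.fr κ.conj).lev (fam.bar m) := by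
    intro κ m
    rw [hc, ← not_lt, hc, hbar, Fin.val_rev]
    omega
  have hle : ∀ ε, R.dSign τ ε ≤ Fintype.card {x : Σ _ : Place τ, Fin n //
      (fam.fr x.1).lev x.2 < c} := fun ε =>
    fam.finrank_eigenspace_le c (fun κ m h => not_le.1 fun h' =>
      absurd ((hcut κ m).2 h') (not_lt.2 h)) (Module.finBasis E (R.bettiSign τ ε))
  have h1 := fam.two_mul_card_low c hcut
  have h2 := dSign_add hK fam P
  rw [Place.card_of_isReal hτ] at h2
  have h3 : Fintype.card (Σ _ : Place τ, Fin n) = n := by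
    rw [Fintype.card_sigma]
    simp [Place.card_of_isReal hτ]
  have h4 := hle 1
  have h5 := hle (-1)
  rcases Int.units_eq_one_or ε with rfl | rfl <;> omega

end Dimension

end FrameFamily

namespace PureMotive

variable {M N : PureMotive E F} {σ : E →+* ℂ} {τ : F →+* ℂ}

/-- The period of a tensor product at a real place.  One factor has even rank and eigenspaces of the
same dimension; the eigenspaces of the other one differ by one in dimension, and the larger one
decides which of the two periods `c^±` of the factor of even rank occurs. -/
theorem tensorPeriod_eqUpTo_of_isReal (hτ : IsReal τ) (hI : M.Interlace N σ τ)
    (hM : M.IsRegularAt σ τ) (hN : N.IsRegularAt σ τ) (hr : M.rank = N.rank + 1) {ε : ℤˣ} {x : ℂ}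
    (hx : (M.tensor N.toRealization).IsPeriod σ τ ε x) {cM cN : ℤˣ → ℂ}
    (hcM : ∀ s, M.IsPeriod σ τ s (cM s)) (hcN : ∀ s, N.IsPeriod σ τ s (cN s)) {bM bN : ℕ → ℂ}
    (hbM : ∀ β, 1 ≤ β → β ≤ N.rank / 2 → M.IsFundamentalPeriod σ τ β (bM β))
    (hbN : ∀ β, β < (N.rank + 1) / 2 → N.IsFundamentalPeriod σ τ β (bN β)) :
    (∀ q, N.rank = 2 * q → ∀ s : ℤˣ,
      ((s = ε ∧ M.dSign τ (-1) < M.dSign τ 1) ∨ (s = -ε ∧ M.dSign τ 1 < M.dSign τ (-1))) →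
      EqUpTo (periodField σ τ) x
        ((∏ β ∈ Finset.Icc 1 q, bM β) * (∏ β ∈ Finset.range q, bN β) * cN s)) ∧
    (∀ q, N.rank = 2 * q + 1 → ∀ s : ℤˣ,
      ((s = ε ∧ N.dSign τ (-1) < N.dSign τ 1) ∨ (s = -ε ∧ N.dSign τ 1 < N.dSign τ (-1))) →
      EqUpTo (periodField σ τ) x
        ((∏ β ∈ Finset.Icc 1 q, bM β) * (∏ β ∈ Finset.range (q + 1), bN β) * cM s)) := by
  let κ₀ : Place τ := ⟨τ, Or.inl rfl⟩
  obtain ⟨fM, hlM, hbarM⟩ := M.exists_frameFamily hM (embTensor_mem_periodField σ) hr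
  obtain ⟨fN, hlN, hbarN⟩ := N.exists_frameFamily hN (embTensor_mem_periodField σ) rfl
  obtain ⟨c, hc⟩ := hI.exists_cut hτ hM hN rfl hr
  simp only [← hlM, ← hlN] at hc
  obtain ⟨PM, -⟩ := hcM 1
  obtain ⟨PN, -⟩ := hcN 1
  have hp := Place.card_of_isReal hτ
  have hsM := FrameFamily.dSign_add rfl fM PM
  have hsN := FrameFamily.dSign_add rfl fN PN
  rw [hp, one_mul] at hsM hsN
  let dM := fun s => (fM.exists_eigenData s).some
  let dN := fun s => (fN.exists_eigenData s).some
  have hbM' : ∀ β, 1 ≤ β → β ≤ N.rank / 2 → EqUpTo (periodField σ τ) (bM β)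
      ((∏ m : Fin (N.rank + 1), (∏ κ, (fM.fr κ).lam m) ^ betaExponent (N.rank + 1) β (m + 1)) *
        ((dM 1).H.det * (dM (-1)).H.det)) := fun β h1 h2 =>
    FrameFamily.isFundamentalPeriod_eqUpTo rfl hM hr hlM hbarM (dM 1) (dM (-1))
      (by simp [hp, hsM]) (hbM β h1 h2)
  have hbN' : ∀ β, β < (N.rank + 1) / 2 → EqUpTo (periodField σ τ) (bN β)
      ((∏ m : Fin N.rank, (∏ κ, (fN.fr κ).lam m) ^ betaExponent N.rank β (m + 1)) *
        ((dN 1).H.det * (dN (-1)).H.det)) := fun β h1 =>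
    FrameFamily.isFundamentalPeriod_eqUpTo rfl hN rfl hlN hbarN (dN 1) (dN (-1))
      (by simp [hp, hsN]) (hbN β h1)
  obtain ⟨D, hD⟩ := FrameFamily.exists_realTensorData κ₀ (Place.conj_eq_of_isReal hτ κ₀) (dM 1)
    (dM (-1)) (dN ε) (dN (-ε))
  have hmonoM : ∀ κ, StrictMono (fM.fr κ).lev := fun κ a b hab => by
    rw [hlM, hlM]
    exact M.hodgeP_strictMono ((M.numTypes_eq_rank hM κ).trans hr) hab
  have hmonoN : ∀ κ, StrictMono (fN.fr κ).lev := fun κ a b hab => by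
    rw [hlN, hlN]
    exact N.hodgeP_strictMono (N.numTypes_eq_rank hN κ) hab
  have hx' : 2 * (M.dSign τ 1 * N.dSign τ ε + M.dSign τ (-1) * N.dSign τ (-ε)) =
      (N.rank + 1) * N.rank → _ := fun hcard =>
    FrameFamily.isPeriod_tensor_eqUpTo rfl hbarM hbarN (fun κ a i => hc κ κ a i) D
      (by simpa [hp] using hcard) hx
  have hsNε : N.dSign τ ε + N.dSign τ (-ε) = N.rank := by
    rcases Int.units_eq_one_or ε with rfl | rfl
    · exact hsN
    · rw [neg_neg, add_comm]
      exact hsN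
  rw [hD] at hx'
  have hevenN : ∀ q, N.rank = 2 * q → (∀ s, N.dSign τ s = q) ∧ ∀ s, EqUpTo (periodField σ τ) (cN s)
      ((∏ m ∈ Finset.univ.filter (fun m : Fin N.rank => (m : ℕ) < q), ∏ κ, (fN.fr κ).lam m) *
        (dN s).H.det) := by
    intro q hq
    -- the step of `N` of half the dimension is found by fixing the middle index of `M`
    have hcut : ∀ κ m, (fN.fr κ).lev m < c - (fM.fr κ₀).lev ⟨q, by omega⟩ ↔ (m : ℕ) < q := by
      intro κ m
      rw [lt_sub_iff_add_lt', hc]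
      simp only
      omega
    have hdim := fun s => FrameFamily.dSign_eq rfl hτ hbarN hq hcut PN s
    refine ⟨hdim, fun s => ?_⟩
    refine FrameFamily.isPeriod_eqUpTo_of_even rfl hbarN hq hcut (dN s) ?_ (hcN s)
    rw [Fintype.card_fin, hdim, hp, one_mul, hq]
  have hevenM : ∀ q, N.rank = 2 * q + 1 → (∀ s, M.dSign τ s = q + 1) ∧
      ∀ s, EqUpTo (periodField σ τ) (cM s)
        ((∏ m ∈ Finset.univ.filter (fun m : Fin (N.rank + 1) => (m : ℕ) < q + 1),
          ∏ κ, (fM.fr κ).lam m) * (dM s).H.det) := by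
    intro q hq
    have hcut : ∀ κ m, (fM.fr κ).lev m < c - (fN.fr κ₀).lev ⟨q, by omega⟩ ↔ (m : ℕ) < q + 1 := by
      intro κ m
      rw [lt_sub_iff_add_lt, hc]
      simp only
      omega
    have hq' : N.rank + 1 = 2 * (q + 1) := by omega
    have hdim := fun s => FrameFamily.dSign_eq rfl hτ hbarM hq' hcut PM s
    refine ⟨hdim, fun s => ?_⟩
    refine FrameFamily.isPeriod_eqUpTo_of_even rfl hbarM hq' hcut (dM s) ?_ (hcM s)
    rw [Fintype.card_fin, hdim, hp, one_mul, hq']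
  -- only the determinants matter from here on
  obtain ⟨A, hA⟩ : ∃ A : ℤˣ → ℂ, ∀ s, (dM s).H.det = A s := ⟨_, fun _ => rfl⟩
  obtain ⟨B, hB⟩ : ∃ B : ℤˣ → ℂ, ∀ s, (dN s).H.det = B s := ⟨_, fun _ => rfl⟩
  simp only [hA, hB] at hx' hbM' hbN' hevenN hevenM
  have hAε : A 1 * A (-1) = A ε * A (-ε) := by
    rcases Int.units_eq_one_or ε with rfl | rfl
    · rfl
    · rw [neg_neg, mul_comm]
  have hBε : B 1 * B (-1) = B ε * B (-ε) := by
    rcases Int.units_eq_one_or ε with rfl | rfl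
    · rfl
    · rw [neg_neg, mul_comm]
  refine ⟨fun q hq s hs => ?_, fun q hq s hs => ?_⟩
  · obtain ⟨hdim, hper⟩ := hevenN q hq
    have h1 := FrameFamily.dSign_le hτ hbarM hmonoM (q := q) (by omega) 1
    have h2 := FrameFamily.dSign_le hτ hbarM hmonoM (q := q) (by omega) (-1)
    have key := prod_eqUpTo_of_even hq (fun β hβ => hbM' β (Finset.mem_Icc.1 hβ).1
      (by have := (Finset.mem_Icc.1 hβ).2; omega))
      (fun β hβ => hbN' β (by have := Finset.mem_range.1 hβ; omega)) (hper s)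
    have hx₁ := hx' (by rw [hdim, hdim, ← add_mul, hsM, hq]; ring)
    refine hx₁.trans (EqUpTo.trans ?_ key.symm)
    refine (EqUpTo.refl _ _).mul ?_
    have hval : A 1 ^ N.dSign τ ε * B ε ^ M.dSign τ 1 *
        (A (-1) ^ N.dSign τ (-ε) * B (-ε) ^ M.dSign τ (-1)) =
        (A 1 * A (-1)) ^ q * (B 1 * B (-1)) ^ q * B s := by
      rw [hdim, hdim, hBε]
      rcases hs with ⟨rfl, h3⟩ | ⟨rfl, h3⟩
      · rw [show M.dSign τ 1 = q + 1 by omega, show M.dSign τ (-1) = q by omega]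
        ring
      · rw [show M.dSign τ 1 = q by omega, show M.dSign τ (-1) = q + 1 by omega]
        ring
    rw [hval]
    exact EqUpTo.refl _ _
  · obtain ⟨hdim, hper⟩ := hevenM q hq
    have h1 := FrameFamily.dSign_le hτ hbarN hmonoN (q := q) (by omega) 1
    have h2 := FrameFamily.dSign_le hτ hbarN hmonoN (q := q) (by omega) (-1)
    have key := prod_eqUpTo_of_odd hq (fun β hβ => hbM' β (Finset.mem_Icc.1 hβ).1
      (by have := (Finset.mem_Icc.1 hβ).2; omega))
      (fun β hβ => hbN' β (by have := Finset.mem_range.1 hβ; omega)) (hper s)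
    have hx₁ := hx' (by rw [hdim, hdim, ← mul_add, hsNε, hq]; ring)
    refine hx₁.trans (EqUpTo.trans ?_ key.symm)
    refine (EqUpTo.refl _ _).mul ?_
    have hval : A 1 ^ N.dSign τ ε * B ε ^ M.dSign τ 1 *
        (A (-1) ^ N.dSign τ (-ε) * B (-ε) ^ M.dSign τ (-1)) =
        (A 1 * A (-1)) ^ q * (B 1 * B (-1)) ^ (q + 1) * A s := by
      rw [hdim, hdim, hBε]
      rcases Int.units_eq_one_or ε with rfl | rfl
      · rcases hs with ⟨rfl, h3⟩ | ⟨rfl, h3⟩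
        · rw [show N.dSign τ 1 = q + 1 by omega, show N.dSign τ (-1) = q by omega]
          ring
        · rw [show N.dSign τ 1 = q by omega, show N.dSign τ (-1) = q + 1 by omega]
          ring
      · rw [neg_neg] at hs ⊢
        rcases hs with ⟨rfl, h3⟩ | ⟨rfl, h3⟩
        · rw [show N.dSign τ 1 = q + 1 by omega, show N.dSign τ (-1) = q by omega]
          ring
        · rw [show N.dSign τ 1 = q by omega, show N.dSign τ (-1) = q + 1 by omega]
          ring
    rw [hval]
    exact EqUpTo.refl _ _

end PureMotive

end

noncomputable section

/-! ### Periods of tensor products at a complex place -/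

variable {E F : Type*} [Field E] [CharZero E] [Field F] [CharZero F]

theorem comp_toConjClosure {F : Type*} [Field F] {τ : F →+* ℂ}
    (κ : Place (conjClosure τ).subtype) :
    κ.1.comp (toConjClosure τ) = τ ∨ κ.1.comp (toConjClosure τ) = conjugate τ := by
  rcases κ.2 with h | h
  · exact Or.inl (by rw [h]; rfl)
  · exact Or.inr (by rw [h]; rfl)

theorem comp_conjToConjClosure {F : Type*} [Field F] {τ : F →+* ℂ}
    (κ : Place (conjClosure τ).subtype) :
    κ.1.comp (conjToConjClosure τ) = τ ∨ κ.1.comp (conjToConjClosure τ) = conjugate τ := by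
  rcases κ.2 with h | h
  · exact Or.inr (by rw [h]; rfl)
  · refine Or.inl ?_
    rw [h]
    exact RingHom.ext fun x => Complex.conj_conj (τ x)

namespace FrameFamily

/-- The embeddings of a complex place are the restrictions of those of a complex place above it. -/
theorem prod_place_comp {F : Type*} [Field F] {τ : F →+* ℂ} {L : Type*} [Field L] {ι₀ : L →+* ℂ}
    (hτ : ¬ IsReal τ) (hι : ¬ IsReal ι₀) {j : F →+* L}
    (h : ∀ κ : Place ι₀, κ.1.comp j = τ ∨ κ.1.comp j = conjugate τ)
    (f : Place τ → ℂ) : ∏ κ : Place ι₀, f ⟨κ.1.comp j, h κ⟩ = ∏ κ, f κ := by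
  refine Function.Bijective.prod_comp (g := f) (e := fun κ : Place ι₀ => ⟨κ.1.comp j, h κ⟩) ?_
  rw [Fintype.bijective_iff_injective_and_card]
  refine ⟨fun κ κ' hκ => ?_, by rw [Place.card_of_not_isReal hτ, Place.card_of_not_isReal hι]⟩
  rcases κ.eq_or_eq_conj κ' with h1 | h1
  · exact h1.symm
  · subst h1
    exact absurd (Subtype.ext (congrArg Subtype.val hκ).symm)
      (Place.conj_ne_of_not_isReal hτ ⟨κ.1.comp j, h κ⟩)

variable {M N : Realization E F} {σ : E →+* ℂ} {τ : F →+* ℂ} {K : Subfield ℂ} {r : ℕ}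
  {fM : FrameFamily M σ τ K (Fin (r + 1))} {fN : FrameFamily N σ τ K (Fin r)}

/-- The periods of a tensor product at a complex place.  Up to a factor in `K`, they do not depend
on the sign. -/
theorem isPeriod_tensor_eqUpTo_of_not_isReal (hK : periodField σ τ = K) (hτ : ¬ IsReal τ)
    (hbM : ∀ m, fM.bar m = Fin.rev m) (hbN : ∀ m, fN.bar m = Fin.rev m) {c : ℤ}
    (hc : ∀ κ a i, (fM.fr κ).lev a + (fN.fr κ).lev i < c ↔ (a : ℕ) + i < r) (κ : Place τ)
    (v : Module.Basis (Fin (r + 1)) E (M.HB κ.1)) (v' : Module.Basis (Fin r) E (N.HB κ.1))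
    {ε : ℤˣ} {x : ℂ} (hx : (M.tensor N).IsPeriod σ τ ε x) :
    EqUpTo K x ((∏ p : Fin (r + 1) × Fin r with (p.1 : ℕ) + p.2 < r,
      (∏ κ, (fM.fr κ).lam p.1) * (∏ κ, (fN.fr κ).lam p.2)) *
        ((fM.bettiMatrix κ v).det ^ r * (fN.bettiMatrix κ v').det ^ (r + 1))) := by
  obtain ⟨D, hD⟩ := exists_complexTensorData (fM := fM) (fN := fN) κ
    (Place.conj_ne_of_not_isReal hτ κ) v v' ε
  have h := isPeriod_tensor_eqUpTo hK hbM hbN hc D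
    (by simp [Place.card_of_not_isReal hτ]) hx
  rwa [hD, Fintype.card_fin, Fintype.card_fin] at h

/-- The period of `M^{[τ]} ⊗ N^{[ρτ]}` is given by the same formula as that of `M ⊗ N`, as the
determinants of the Betti spaces at conjugate embeddings agree up to a factor in `K`. -/
theorem isPeriod_twisted_eqUpTo (hK : periodField σ τ = K) (hτ : ¬ IsReal τ)
    (hbM : ∀ m, fM.bar m = Fin.rev m) (hbN : ∀ m, fN.bar m = Fin.rev m) {c : ℤ}
    (hc : ∀ κ κ' a i, (fM.fr κ).lev a + (fN.fr κ').lev i < c ↔ (a : ℕ) + i < r) {κ : Place τ}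
    (hκ : κ.1 = τ) (v : Module.Basis (Fin (r + 1)) E (M.HB κ.1))
    (v' : Module.Basis (Fin r) E (N.HB κ.1))
    {ε : ℤˣ} {x : ℂ} (hx : ((M.baseChange (toConjClosure τ)).tensor
      (N.baseChange (conjToConjClosure τ))).IsPeriod σ (conjClosure τ).subtype ε x) :
    EqUpTo K x ((∏ p : Fin (r + 1) × Fin r with (p.1 : ℕ) + p.2 < r,
      (∏ κ, (fM.fr κ).lam p.1) * (∏ κ, (fN.fr κ).lam p.2)) *
        ((fM.bettiMatrix κ v).det ^ r * (fN.bettiMatrix κ v').det ^ (r + 1))) := by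
  have hι := not_isReal_subtype hτ
  have hK' : periodField σ (conjClosure τ).subtype = K := (periodField_subtype σ τ).trans hK
  have hmem : ∀ (κ : Place (conjClosure τ).subtype) x, embTensor σ κ.1 x ∈ K := fun κ x => by
    rw [← hK']
    exact embTensor_mem_periodField σ κ x
  let κ₀ : Place (conjClosure τ).subtype := ⟨_, Or.inl rfl⟩
  obtain rfl : κ = ⟨κ₀.1.comp (toConjClosure τ), comp_toConjClosure κ₀⟩ := Subtype.ext hκ
  obtain ⟨v'', hv''⟩ := fN.exists_bettiMatrix_conj
    (κ' := ⟨κ₀.1.comp (conjToConjClosure τ), comp_conjToConjClosure κ₀⟩) rfl v'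
  have h := isPeriod_tensor_eqUpTo_of_not_isReal
    (fM := fM.baseChange comp_toConjClosure hmem) (fN := fN.baseChange comp_conjToConjClosure hmem)
    hK' hι hbM hbN (fun κ a i => hc _ _ a i) κ₀ v v'' hx
  refine h.trans (EqUpTo.mul ?_ ((EqUpTo.refl _ _).mul (hv''.pow _)))
  have h1 : ∀ a, ∏ κ, ((fM.baseChange comp_toConjClosure hmem).fr κ).lam a =
      ∏ κ, (fM.fr κ).lam a := fun a =>
    prod_place_comp hτ hι comp_toConjClosure fun κ => (fM.fr κ).lam a
  have h2 : ∀ i, ∏ κ, ((fN.baseChange comp_conjToConjClosure hmem).fr κ).lam i =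
      ∏ κ, (fN.fr κ).lam i := fun i =>
    prod_place_comp hτ hι comp_conjToConjClosure fun κ => (fN.fr κ).lam i
  simp_rw [h1, h2]
  exact EqUpTo.refl _ _

end FrameFamily

namespace PureMotive

variable {M N : PureMotive E F} {σ : E →+* ℂ} {τ : F →+* ℂ}

/-- The period of a tensor product at a complex place.  The determinants comparing the rational
structures of the two eigenspaces coincide, so that no choice of signs occurs; `c^±(M ⊗ N)` and the
period of the twisted tensor product contribute the same factor. -/
theorem tensorPeriod_eqUpTo_of_not_isReal (hτ : ¬ IsReal τ) (hI : M.StrongInterlace N σ τ)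
    (hM : M.IsRegularAt σ τ) (hN : N.IsRegularAt σ τ) (hr : M.rank = N.rank + 1) {ε : ℤˣ}
    {x y : ℂ} (hx : (M.tensor N.toRealization).IsPeriod σ τ ε x)
    (hy : ((M.baseChange (toConjClosure τ)).tensor
      (N.baseChange (conjToConjClosure τ))).IsPeriod σ (conjClosure τ).subtype ε y)
    {cM cN : ℤˣ → ℂ}
    (hcM : ∀ s, M.IsPeriod σ τ s (cM s)) (hcN : ∀ s, N.IsPeriod σ τ s (cN s)) {bM bN : ℕ → ℂ}
    (hbM : ∀ β, 1 ≤ β → β ≤ N.rank / 2 → M.IsFundamentalPeriod σ τ β (bM β))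
    (hbN : ∀ β, β < (N.rank + 1) / 2 → N.IsFundamentalPeriod σ τ β (bN β)) :
    (∀ q, N.rank = 2 * q → EqUpTo (periodField σ τ) (x * y)
      ((∏ β ∈ Finset.Icc 1 q, bM β ^ 2) * (∏ β ∈ Finset.range q, bN β ^ 2) *
        (cN 1 * cN (-1)))) ∧
    (∀ q, N.rank = 2 * q + 1 → EqUpTo (periodField σ τ) (x * y)
      ((∏ β ∈ Finset.Icc 1 q, bM β ^ 2) * (∏ β ∈ Finset.range (q + 1), bN β ^ 2) *
        (cM 1 * cM (-1)))) := by
  let κ₀ : Place τ := ⟨τ, Or.inl rfl⟩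
  obtain ⟨fM, hlM, hbarM⟩ := M.exists_frameFamily hM (embTensor_mem_periodField σ) hr
  obtain ⟨fN, hlN, hbarN⟩ := N.exists_frameFamily hN (embTensor_mem_periodField σ) rfl
  obtain ⟨c, hc⟩ := hI.exists_cut hM hN rfl hr
  simp only [← hlM, ← hlN] at hc
  have hp := Place.card_of_not_isReal hτ
  have hκ₀ := Place.conj_ne_of_not_isReal hτ κ₀
  obtain ⟨v⟩ := fM.nonempty_basis κ₀
  obtain ⟨v'⟩ := fN.nonempty_basis κ₀
  have hx' := FrameFamily.isPeriod_tensor_eqUpTo_of_not_isReal rfl hτ hbarM hbarN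
    (fun κ a i => hc κ κ a i) κ₀ v v' hx
  have hy' := FrameFamily.isPeriod_twisted_eqUpTo rfl hτ hbarM hbarN hc rfl v v' hy
  have hbM' : ∀ β, 1 ≤ β → β ≤ N.rank / 2 → EqUpTo (periodField σ τ) (bM β)
      ((∏ m : Fin (N.rank + 1), (∏ κ, (fM.fr κ).lam m) ^ betaExponent (N.rank + 1) β (m + 1)) *
        ((fM.bettiMatrix κ₀ v).det * (fM.bettiMatrix κ₀ v).det)) := fun β h1 h2 =>
    FrameFamily.isFundamentalPeriod_eqUpTo rfl hM hr hlM hbarM (fM.complexEigenData κ₀ hκ₀ v 1)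
      (fM.complexEigenData κ₀ hκ₀ v (-1)) (by simp [hp, two_mul]) (hbM β h1 h2)
  have hbN' : ∀ β, β < (N.rank + 1) / 2 → EqUpTo (periodField σ τ) (bN β)
      ((∏ m : Fin N.rank, (∏ κ, (fN.fr κ).lam m) ^ betaExponent N.rank β (m + 1)) *
        ((fN.bettiMatrix κ₀ v').det * (fN.bettiMatrix κ₀ v').det)) := fun β h1 =>
    FrameFamily.isFundamentalPeriod_eqUpTo rfl hN rfl hlN hbarN (fN.complexEigenData κ₀ hκ₀ v' 1)
      (fN.complexEigenData κ₀ hκ₀ v' (-1)) (by simp [hp, two_mul]) (hbN β h1)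
  have hevenN : ∀ q, N.rank = 2 * q → ∀ s, EqUpTo (periodField σ τ) (cN s)
      ((∏ m ∈ Finset.univ.filter (fun m : Fin N.rank => (m : ℕ) < q), ∏ κ, (fN.fr κ).lam m) *
        (fN.bettiMatrix κ₀ v').det) := by
    intro q hq s
    refine FrameFamily.isPeriod_eqUpTo_of_even rfl hbarN hq
      (c := c - (fM.fr κ₀).lev ⟨q, by omega⟩) (fun κ m => ?_)
      (fN.complexEigenData κ₀ hκ₀ v' s) (by rw [Fintype.card_fin, hp]) (hcN s)
    rw [lt_sub_iff_add_lt', hc]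
    simp only
    omega
  have hevenM : ∀ q, N.rank = 2 * q + 1 → ∀ s, EqUpTo (periodField σ τ) (cM s)
      ((∏ m ∈ Finset.univ.filter (fun m : Fin (N.rank + 1) => (m : ℕ) < q + 1),
        ∏ κ, (fM.fr κ).lam m) * (fM.bettiMatrix κ₀ v).det) := by
    intro q hq s
    refine FrameFamily.isPeriod_eqUpTo_of_even rfl hbarM (q := q + 1) (by omega)
      (c := c - (fN.fr κ₀).lev ⟨q, by omega⟩) (fun κ m => ?_)
      (fM.complexEigenData κ₀ hκ₀ v s) (by rw [Fintype.card_fin, hp]) (hcM s)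
    rw [lt_sub_iff_add_lt, hc]
    simp only
    omega
  generalize (fM.bettiMatrix κ₀ v).det = A at *
  generalize (fN.bettiMatrix κ₀ v').det = B at *
  refine ⟨fun q hq => ?_, fun q hq => ?_⟩
  · have key := fun s => prod_eqUpTo_of_even hq (fun β hβ => hbM' β (Finset.mem_Icc.1 hβ).1
      (by have := (Finset.mem_Icc.1 hβ).2; omega))
      (fun β hβ => hbN' β (by have := Finset.mem_range.1 hβ; omega)) (hevenN q hq s)
    have hval : A ^ N.rank * B ^ (N.rank + 1) = (A * A) ^ q * (B * B) ^ q * B := by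
      rw [hq]
      ring
    rw [hval] at hx' hy'
    convert (hx'.trans (key 1).symm).mul (hy'.trans (key (-1)).symm) using 1
    simp only [Finset.prod_pow]
    ring
  · have key := fun s => prod_eqUpTo_of_odd hq (fun β hβ => hbM' β (Finset.mem_Icc.1 hβ).1
      (by have := (Finset.mem_Icc.1 hβ).2; omega))
      (fun β hβ => hbN' β (by have := Finset.mem_range.1 hβ; omega)) (hevenM q hq s)
    have hval : A ^ N.rank * B ^ (N.rank + 1) = (A * A) ^ q * (B * B) ^ (q + 1) * A := by
      rw [hq]
      ring
    rw [hval] at hx' hy'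
    convert (hx'.trans (key 1).symm).mul (hy'.trans (key (-1)).symm) using 1
    simp only [Finset.prod_pow]
    ring

end PureMotive

end

end YoshidaPeriod

theorem proposition4p6 {E F : Type*} [Field E] [NumberField E] [Field F] [NumberField F]
    (M : YoshidaPeriod.PureMotive E F) (N : YoshidaPeriod.PureMotive E F) (σ : E →+* ℂ) (τ : F →+* ℂ)
    (hM : M.IsRegularAt σ τ) (hN : N.IsRegularAt σ τ)
    (ht : M.numTypes σ τ = N.numTypes σ τ + 1)
    -- the period `c^ε(M, N)`, where `ε` is a sign
    (ε : ℤˣ) (cMN : ℂ) (hcMN : M.IsTensorPeriod N σ τ ε cMN)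
    -- the periods `c^±(M)` and `c^±(N)`
    (cM cN : ℤˣ → ℂ) (hcM : ∀ s, M.IsPeriod σ τ s (cM s)) (hcN : ∀ s, N.IsPeriod σ τ s (cN s))
    -- the fundamental periods `c_β(M)` and `c_β(N)`
    (bM bN : ℕ → ℂ)
    (hbM : ∀ β, 1 ≤ β → β ≤ N.rank / 2 → M.IsFundamentalPeriod σ τ β (bM β))
    (hbN : ∀ β, β < (N.rank + 1) / 2 → N.IsFundamentalPeriod σ τ β (bN β)) :
    (NumberField.ComplexEmbedding.IsReal τ → M.Interlace N σ τ →
      (Even N.rank →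
        (M.dSign τ (-1) < M.dSign τ 1 →
          YoshidaPeriod.EqUpTo (YoshidaPeriod.periodField σ τ) cMN
            ((∏ β ∈ Finset.Icc 1 (N.rank / 2), bM β) *
              (∏ β ∈ Finset.range (N.rank / 2), bN β) * cN ε)) ∧
        (M.dSign τ 1 < M.dSign τ (-1) →
          YoshidaPeriod.EqUpTo (YoshidaPeriod.periodField σ τ) cMN
            ((∏ β ∈ Finset.Icc 1 (N.rank / 2), bM β) *
              (∏ β ∈ Finset.range (N.rank / 2), bN β) * cN (-ε)))) ∧
      (Odd N.rank →
        (N.dSign τ (-1) < N.dSign τ 1 →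
          YoshidaPeriod.EqUpTo (YoshidaPeriod.periodField σ τ) cMN
            ((∏ β ∈ Finset.Icc 1 ((N.rank - 1) / 2), bM β) *
              (∏ β ∈ Finset.range ((N.rank - 1) / 2 + 1), bN β) * cM ε)) ∧
        (N.dSign τ 1 < N.dSign τ (-1) →
          YoshidaPeriod.EqUpTo (YoshidaPeriod.periodField σ τ) cMN
            ((∏ β ∈ Finset.Icc 1 ((N.rank - 1) / 2), bM β) *
              (∏ β ∈ Finset.range ((N.rank - 1) / 2 + 1), bN β) * cM (-ε))))) ∧
    (¬ NumberField.ComplexEmbedding.IsReal τ → M.StrongInterlace N σ τ →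
      (Even N.rank →
        YoshidaPeriod.EqUpTo (YoshidaPeriod.periodField σ τ) cMN
          ((∏ β ∈ Finset.Icc 1 (N.rank / 2), bM β ^ 2) *
            (∏ β ∈ Finset.range (N.rank / 2), bN β ^ 2) * (cN 1 * cN (-1)))) ∧
      (Odd N.rank →
        YoshidaPeriod.EqUpTo (YoshidaPeriod.periodField σ τ) cMN
          ((∏ β ∈ Finset.Icc 1 ((N.rank - 1) / 2), bM β ^ 2) *
            (∏ β ∈ Finset.range ((N.rank - 1) / 2 + 1), bN β ^ 2) * (cM 1 * cM (-1))))) := by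
  have hr : M.rank = N.rank + 1 := by
    have h1 := M.numTypes_eq_rank hM ⟨τ, Or.inl rfl⟩
    have h2 := N.numTypes_eq_rank hN ⟨τ, Or.inl rfl⟩
    exact h1.symm.trans (ht.trans (congrArg (· + 1) h2))
  refine ⟨fun hτ hI => ?_, fun hτ hI => ?_⟩
  · have h := YoshidaPeriod.PureMotive.tensorPeriod_eqUpTo_of_isReal hτ hI hM hN hr (hcMN.1 hτ)
      hcM hcN hbM hbN
    refine ⟨fun hd => ?_, fun hd => ?_⟩
    · have hq : N.rank = 2 * (N.rank / 2) := (Nat.two_mul_div_two_of_even hd).symm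
      exact ⟨fun hs => h.1 _ hq ε (Or.inl ⟨rfl, hs⟩), fun hs => h.1 _ hq (-ε) (Or.inr ⟨rfl, hs⟩)⟩
    · have hq : N.rank = 2 * ((N.rank - 1) / 2) + 1 := by
        obtain ⟨k, hk⟩ := hd
        omega
      exact ⟨fun hs => h.2 _ hq ε (Or.inl ⟨rfl, hs⟩), fun hs => h.2 _ hq (-ε) (Or.inr ⟨rfl, hs⟩)⟩
  · obtain ⟨c₁, c₂, h₁, h₂, rfl⟩ := hcMN.2 hτ
    have h := YoshidaPeriod.PureMotive.tensorPeriod_eqUpTo_of_not_isReal hτ hI hM hN hr h₁ h₂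
      hcM hcN hbM hbN
    refine ⟨fun hd => h.1 _ (Nat.two_mul_div_two_of_even hd).symm, fun hd => h.2 _ ?_⟩
    obtain ⟨k, hk⟩ := hd
    omega
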